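/- **Setting.** Let $n\in\mathbb N$, let $D\in\mathbb R^{n\times n}$ be symmetric and positive definite, and let $f\colon\mathbb R^n\to\mathbb R^n$ be smooth. Write $C^m_{\mathrm{ub}}(\mathbb R)$ for the functions that are $m$ times differentiable with all derivatives up to order $m$ bounded and uniformly continuous, and $\langle u,w\rangle=\int_0^1 u(\zeta)^*w(\zeta)\,\mathrm d\zeta$. Assume: * **(H1)** There are $k_0\in\mathbb R\setminus\{0\}$, $\omega_0\in\mathbb R$ and a nonconstant, smooth, $1$-periodic $\phi_0\colon\mathbb R\to\mathbb R^n$ such that $u(x,t)=\phi_0(k_0x-\omega_0t)$ solves $\partial_tu=Du_{xx}+f(u)$. Let $\mathcal L_0u=k_0^2Du''+\omega_0u'+f'(\phi_0)u$ on $C_{\mathrm{ub}}(\mathbb R)$ with domain $C^2_{\mathrm{ub}}(\mathbb R)$, and, for $\xi\in[-\pi,\pi)$, let $\mathcal L(\xi)u=k_0^2D(\partial_\zeta+\mathrm i\xi)^2u+\omega_0(\partial_\zeta+\mathrm i\xi)u+f'(\phi_0)u$ on $L^2_{\mathrm{per}}(0,1)$ with domain $H^2_{\mathrm{per}}(0,1)$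 (functions with values in $\mathbb C^n$). Assume further: * **(D1)** $\sigma(\mathcal L_0)\subset\{\operatorname{Re}\lambda<0\}\cup\{0\}$; * **(D2)** there is $\theta>0$ with $\operatorname{Re}\sigma(\mathcal L(\xi))\le-\theta\xi^2$ for all $\xi\in[-\pi,\pi)$; * **(D3)** $0$ is an (algebraically) simple eigenvalue of $\mathcal L(0)$. Let $\xi_0\in(0,\pi)$ and let $\lambda_c\colon(-\xi_0,\xi_0)\to\mathbb C$ be an analytic curve such that, for $|\xi|<\xi_0$, $\lambda_c(\xi)$ is a simple eigenvalue of $\mathcal L(\xi)$ with smooth eigenfunction $\Phi_\xi$, and $\overline{\lambda_c(\xi)}$ is a simple eigenvalue of the adjoint $\mathcal L(\xi)^*$ with smooth eigenfunction $\widetilde\Phi_\xi$, where $\Phi_\xi$ depends analytically and $\widetilde\Phi_\xi$ smoothly on $\xi$, and $\Phi_0=\phi_0'$, $\langle\widetilde\Phi_0,\Phi_\xi\rangle=1$, $\langle\widetilde\Phi_\xi,\Phi_\xi\rangle=1$. Let $r_0\in(0,\tfrac12)$ and let $\phi(\zeta;k)\in\mathbb R^n$ and $\omega(k)\in\mathbb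 R$ be smooth in $\zeta\in\mathbb R$, $|k-k_0|<r_0$, with $\phi(\cdot;k)$ $1$-periodic, such that $\phi(kx-\omega(k)t;k)$ solves $\partial_tu=Du_{xx}+f(u)$ for each $k$, and $\omega(k_0)=\omega_0$, $\phi(\cdot;k_0)=\phi_0$, $\langle\widetilde\Phi_0,\partial_k\phi(\cdot;k_0)\rangle=0$. Put $$a=\omega_0-k_0\omega'(k_0),\qquad d=k_0^2\,\big\langle\widetilde\Phi_0,\;D\phi_0'+2k_0D\,\partial_{\zeta k}\phi(\cdot;k_0)\big\rangle .$$ Let $\rho\colon\mathbb R\to[0,1]$ be smooth with $\rho(\xi)=1$ for $|\xi|<\xi_0/2$ and support in a compact subset of $(-\xi_0,\xi_0)$, and let $\chi\colon[0,\infty)\to[0,1]$ be smooth with $\chi=0$ on $[0,1]$ and $\chi=1$ on $[2,\infty)$. Define the principal part of the semigroup by $$S_p^0(t)w(\zeta)=\chi(t)\int_{\mathbb R}G_p^0(\zeta,\bar\zeta,t)\,w(\bar\zeta)\,\mathrm d\bar\zeta,\qquad G_p^0(\zeta,\bar\zeta,t)=\frac1{2\pi}\int_{\mathbb R}\rho(\xi)\,\mathrm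 e^{\mathrm i\xi(\zeta-\bar\zeta)}\,\mathrm e^{\lambda_c(\xi)t}\,\widetilde\Phi_\xi(\bar\zeta)^*\,\mathrm d\xi .$$ **Proposition 4.4.** Let $g\in L^2_{\mathrm{per}}(0,1)$ and let $l,m\in\mathbb N_0$ with $l\ge1$. Then $d>0$; for every $h\in L^2_{\mathrm{per}}(0,1)$ (in particular for $h=g$ and $h=\phi_0'$) and $v\in C^1_{\mathrm{ub}}(\mathbb R,\mathbb R)$ the integral defining $S_p^0(t)(hv)(\zeta)$ converges absolutely for $t\ge 0$ and $\zeta\in\mathbb R$, and $S_p^0(t)(hv)(\zeta)$ is smooth in $(t,\zeta)$; and there is a constant $C>0$, independent of $t$ and $v$, such that $$\big\|(\partial_t-a\partial_\zeta)^m\partial_\zeta^l\,S_p^0(t)(gv)\big\|_\infty\le C\,(1+t)^{-\frac{2m+l-1}2}\,\|v'\|_\infty,$$ $$\big\|(\partial_t-a\partial_\zeta)^m S_p^0(t)(\phi_0'v)-\big(\partial_t^m\chi(t)\big)\,\mathrm e^{(d\partial_\zeta^2+a\partial_\zeta)t}v\big\|_\infty\le C\,\|v'\|_\infty$$ for all $t\ge0$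 and all $v\in C^1_{\mathrm{ub}}(\mathbb R,\mathbb R)$. -/

import Mathlib

open MeasureTheory Set
open scoped ContDiff Matrix

noncomputable section

namespace WaveTrain

/-! ### Function spaces -/

/-- The supremum norm of a function on the line (meaningful for bounded functions). -/
def supNorm {E : Type*} [NormedAddCommGroup E] (u : ℝ → E) : ℝ := ⨆ x, ‖u x‖

/-- Membership in `C_ub^m(ℝ)`: `u` is `m` times continuously differentiable, and all derivatives
up to order `m` are bounded and uniformly continuous. -/
def IsCub {E : Type*} [NormedAddCommGroup E] [NormedSpace ℝ E] (m : ℕ) (u : ℝ → E) : Prop :=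
  ContDiff ℝ m u ∧ ∀ j ≤ m,
    UniformContinuous (iteratedDeriv j u) ∧ ∃ M : ℝ, ∀ x, ‖iteratedDeriv j u x‖ ≤ M

/-- Lebesgue measure on the period cell. -/
def cell : Measure ℝ := volume.restrict (Ioc (0 : ℝ) 1)

/-- Membership in `L²_per(0,1)`, for `1`-periodic functions on the line. Equality in this space is
equality almost everywhere. -/
def IsL2per {n : ℕ} (u : ℝ → Fin n → ℂ) : Prop :=
  Function.Periodic u 1 ∧ MemLp u 2 cell

/-- The inner product of `L²((0,1), ℂⁿ)`, conjugate-linear in the first entry. -/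
def innerL2 {n : ℕ} (u w : ℝ → Fin n → ℂ) : ℂ := ∫ ζ in Ioc (0 : ℝ) 1, star (u ζ) ⬝ᵥ w ζ

/-- `u` lies in `H²_per(0,1)`, with first derivative `u₁` and second (weak) derivative `u₂`:
`u` is `1`-periodic and differentiable, and its derivative `u₁` is absolutely continuous with
almost-everywhere derivative `u₂ ∈ L²_per(0,1)`. -/
structure IsH2per {n : ℕ} (u u₁ u₂ : ℝ → Fin n → ℂ) : Prop where
  periodic : Function.Periodic u 1
  hasDerivAt : ∀ x, HasDerivAt u (u₁ x) x
  integral_eq : ∀ x, u₁ x = u₁ 0 + ∫ y in (0 : ℝ)..x, u₂ y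
  memL2 : IsL2per u₂

/-! ### The reaction-diffusion system and its wave trains -/

/-- Componentwise embedding of `ℝⁿ` into `ℂⁿ`. -/
def toC {n : ℕ} (w : Fin n → ℝ) : Fin n → ℂ := fun j => (w j : ℂ)

/-- `u(x,t) = φ(k x - ω t)` is a solution of `∂ₜ u = D u_xx + f(u)` with smooth, `1`-periodic
profile `φ`. -/
structure IsWaveTrain {n : ℕ} (D : Matrix (Fin n) (Fin n) ℝ) (f : (Fin n → ℝ) → (Fin n → ℝ))
    (k om : ℝ) (φ : ℝ → Fin n → ℝ) : Prop where
  smooth : ContDiff ℝ ∞ φ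
  periodic : Function.Periodic φ 1
  solves : ∀ x t : ℝ,
    deriv (fun s => φ (k * x - om * s)) t
      = D *ᵥ iteratedDeriv 2 (fun y => φ (k * y - om * t)) x + f (φ (k * x - om * t))

/-- The data of a reaction-diffusion system together with a candidate wave train. -/
structure Data (n : ℕ) where
  D : Matrix (Fin n) (Fin n) ℝ
  f : (Fin n → ℝ) → (Fin n → ℝ)
  k₀ : ℝ
  ω₀ : ℝ
  φ₀ : ℝ → Fin n → ℝ

variable {n : ℕ}

/-- The standing assumptions on the system (`D` symmetric and positive definite, `f` smooth) and
the existence hypothesis (H1): `φ₀` is a nonconstant wave train with wavenumber `k₀ ≠ 0`. -/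
structure Data.H1 (P : Data n) : Prop where
  posDef : P.D.PosDef
  smooth : ContDiff ℝ ∞ P.f
  k₀_ne_zero : P.k₀ ≠ 0
  waveTrain : IsWaveTrain P.D P.f P.k₀ P.ω₀ P.φ₀
  nonconstant : ¬ ∃ c, ∀ ζ, P.φ₀ ζ = c

/-- The diffusion matrix, acting on `ℂⁿ`. -/
def Data.DC (P : Data n) : Matrix (Fin n) (Fin n) ℂ := P.D.map Complex.ofReal

/-- The Jacobian matrix `f'(φ₀(ζ))`, acting on `ℂⁿ`. -/
def Data.jac (P : Data n) (ζ : ℝ) : Matrix (Fin n) (Fin n) ℂ :=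
  (LinearMap.toMatrix' (fderiv ℝ P.f (P.φ₀ ζ)).toLinearMap).map Complex.ofReal

/-- The derivative `φ₀'` of the wave train, as a `ℂⁿ`-valued function. -/
def Data.dφ₀ (P : Data n) (ζ : ℝ) : Fin n → ℂ := toC (deriv P.φ₀ ζ)

/-! ### The linearization, its Bloch operators, and their spectra -/

/-- The differential expression `ℒ₀ u = k₀² D u'' + ω₀ u' + f'(φ₀) u`. -/
def Data.L0 (P : Data n) (u : ℝ → Fin n → ℂ) (ζ : ℝ) : Fin n → ℂ :=
  ((P.k₀ : ℂ) ^ 2) • (P.DC *ᵥ iteratedDeriv 2 u ζ) + (P.ω₀ : ℂ) • deriv u ζ + P.jac ζ *ᵥ u ζ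

/-- `lam` is in the resolvent set of `ℒ₀`, acting on `C_ub(ℝ, ℂⁿ)` with domain `C_ub²(ℝ, ℂⁿ)`:
the map `lam - ℒ₀` is a bijection from the domain to the space, with bounded inverse. -/
def Data.L0Resolvent (P : Data n) (lam : ℂ) : Prop :=
  ∃ C : ℝ, ∀ h : ℝ → Fin n → ℂ, IsCub 0 h →
    ∃ u : ℝ → Fin n → ℂ,
      (IsCub 2 u ∧ (∀ ζ, lam • u ζ - P.L0 u ζ = h ζ)) ∧ supNorm u ≤ C * supNorm h ∧
      ∀ w : ℝ → Fin n → ℂ, IsCub 2 w → (∀ ζ, lam • w ζ - P.L0 w ζ = h ζ) → w = u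

/-- The graph of the Bloch operator
`ℒ(ξ) u = k₀² D (∂ + iξ)² u + ω₀ (∂ + iξ) u + f'(φ₀) u` on `L²_per(0,1)`, with domain
`H²_per(0,1)`: the statement `P.Bloch ξ u h` means `u ∈ H²_per(0,1)` and `ℒ(ξ) u = h`. -/
def Data.Bloch (P : Data n) (ξ : ℝ) (u h : ℝ → Fin n → ℂ) : Prop :=
  IsL2per h ∧ ∃ u₁ u₂ : ℝ → Fin n → ℂ, IsH2per u u₁ u₂ ∧
    ∀ᵐ ζ : ℝ, h ζ =
      ((P.k₀ : ℂ) ^ 2) • (P.DC *ᵥ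
          (u₂ ζ + (2 * Complex.I * (ξ : ℂ)) • u₁ ζ + ((Complex.I * (ξ : ℂ)) ^ 2) • u ζ))
        + (P.ω₀ : ℂ) • (u₁ ζ + (Complex.I * (ξ : ℂ)) • u ζ)
        + P.jac ζ *ᵥ u ζ

/-- The graph of the Hilbert space adjoint of an operator on `L²_per(0,1)` given by its graph. -/
def adjointGraph (A : (ℝ → Fin n → ℂ) → (ℝ → Fin n → ℂ) → Prop) (v h : ℝ → Fin n → ℂ) : Prop :=
  IsL2per v ∧ IsL2per h ∧ ∀ u w, A u w → innerL2 v w = innerL2 h u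

/-- `lam` is in the resolvent set of an operator `A` on `L²_per(0,1)` given by its graph: the map
`lam - A` is a bijection from the domain to the space, with bounded inverse. -/
def InResolvent (A : (ℝ → Fin n → ℂ) → (ℝ → Fin n → ℂ) → Prop) (lam : ℂ) : Prop :=
  ∃ C : NNReal, ∀ h : ℝ → Fin n → ℂ, IsL2per h →
    ∃ u : ℝ → Fin n → ℂ,
      A u (fun ζ => lam • u ζ - h ζ) ∧ eLpNorm u 2 cell ≤ C * eLpNorm h 2 cell ∧
      ∀ w : ℝ → Fin n → ℂ, A w (fun ζ => lam • w ζ - h ζ) → w =ᵐ[volume] u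

/-- `μ` is an (algebraically) simple eigenvalue, with eigenfunction `Φ`, of an operator `A` on
`L²_per(0,1)` given by its graph: the kernel of `A - μ` is spanned by `Φ ≠ 0`, and there is no
generalized eigenfunction `u` with `(A - μ) u = Φ`. -/
structure IsSimpleEigenvalue (A : (ℝ → Fin n → ℂ) → (ℝ → Fin n → ℂ) → Prop) (μ : ℂ)
    (Φ : ℝ → Fin n → ℂ) : Prop where
  eigen : A Φ (fun ζ => μ • Φ ζ)
  ne_zero : ¬ Φ =ᵐ[volume] 0
  geometric : ∀ u, A u (fun ζ => μ • u ζ) → ∃ c : ℂ, u =ᵐ[volume] fun ζ => c • Φ ζ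
  algebraic : ¬ ∃ u, A u (fun ζ => μ • u ζ + Φ ζ)

/-- Hypothesis (D1): the spectrum of `ℒ₀` lies in the open left half plane together with `0`. -/
def Data.D1 (P : Data n) : Prop := ∀ lam : ℂ, ¬ P.L0Resolvent lam → lam.re < 0 ∨ lam = 0

/-- Hypothesis (D2): for some `θ > 0` the spectrum of `ℒ(ξ)` has real part at most `-θ ξ²`. -/
def Data.D2 (P : Data n) : Prop :=
  ∃ θ : ℝ, 0 < θ ∧ ∀ ξ ∈ Ico (-Real.pi) Real.pi, ∀ lam : ℂ,
    ¬ InResolvent (P.Bloch ξ) lam → lam.re ≤ -θ * ξ ^ 2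

/-- Hypothesis (D3): `0` is a simple eigenvalue of `ℒ(0)`. -/
def Data.D3 (P : Data n) : Prop := ∃ Φ, IsSimpleEigenvalue (P.Bloch 0) 0 Φ

/-! ### Critical spectral curve and continuation in the wavenumber -/

/-- The critical curve: `lamc` is an analytic curve of simple eigenvalues of `ℒ(ξ)` for
`|ξ| < ξ₀`, with eigenfunctions `Φ ξ` starting at `Φ 0 = φ₀'`, and adjoint eigenfunctions `Ψ ξ`,
subject to the normalizations `⟨Ψ 0, Φ ξ⟩ = 1` and `⟨Ψ ξ, Φ ξ⟩ = 1`. Both families of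
eigenfunctions are smooth, and `Φ` is analytic in `ξ`. -/
structure Data.IsCriticalCurve (P : Data n) (ξ₀ : ℝ) (lamc : ℝ → ℂ)
    (Φ Ψ : ℝ → ℝ → Fin n → ℂ) : Prop where
  ξ₀_mem : ξ₀ ∈ Ioo 0 Real.pi
  analytic : AnalyticOnNhd ℝ lamc (Ioo (-ξ₀) ξ₀)
  eigen : ∀ ξ ∈ Ioo (-ξ₀) ξ₀, IsSimpleEigenvalue (P.Bloch ξ) (lamc ξ) (Φ ξ)
  Φ_zero : Φ 0 = P.dφ₀
  Φ_smooth : ContDiffOn ℝ ∞ (fun p : ℝ × ℝ => Φ p.1 p.2) (Ioo (-ξ₀) ξ₀ ×ˢ univ)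
  Φ_analytic : ∀ ζ, AnalyticOnNhd ℝ (fun ξ => Φ ξ ζ) (Ioo (-ξ₀) ξ₀)
  Φ_normalized : ∀ ξ ∈ Ioo (-ξ₀) ξ₀, innerL2 (Ψ 0) (Φ ξ) = 1
  adjoint_eigen : ∀ ξ ∈ Ioo (-ξ₀) ξ₀,
    IsSimpleEigenvalue (adjointGraph (P.Bloch ξ)) (star (lamc ξ)) (Ψ ξ)
  Ψ_smooth : ContDiffOn ℝ ∞ (fun p : ℝ × ℝ => Ψ p.1 p.2) (Ioo (-ξ₀) ξ₀ ×ˢ univ)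
  Ψ_normalized : ∀ ξ ∈ Ioo (-ξ₀) ξ₀, innerL2 (Ψ ξ) (Φ ξ) = 1

/-- The partial derivative `∂ₖ φ(ζ; k₀)` of a family of profiles, where `φ k` is the profile with
wavenumber `k`. -/
def dk (φ : ℝ → ℝ → Fin n → ℝ) (k₀ ζ : ℝ) : Fin n → ℝ := deriv (fun k => φ k ζ) k₀

/-- A smooth continuation of the wave train in the wavenumber, with profiles `φ k` and frequencies
`ω k` for `|k - k₀| < r₀`, gauged by `⟨Ψ₀, ∂ₖ φ(·; k₀)⟩ = 0`. -/
structure Data.IsFamily (P : Data n) (Ψ₀ : ℝ → Fin n → ℂ) (r₀ : ℝ) (φ : ℝ → ℝ → Fin n → ℝ)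
    (om : ℝ → ℝ) : Prop where
  r₀_mem : r₀ ∈ Ioo (0 : ℝ) (1 / 2)
  φ_smooth : ContDiffOn ℝ ∞ (fun p : ℝ × ℝ => φ p.1 p.2) (Ioo (P.k₀ - r₀) (P.k₀ + r₀) ×ˢ univ)
  ω_smooth : ContDiffOn ℝ ∞ om (Ioo (P.k₀ - r₀) (P.k₀ + r₀))
  waveTrain : ∀ k ∈ Ioo (P.k₀ - r₀) (P.k₀ + r₀), IsWaveTrain P.D P.f k (om k) (φ k)
  ω_eq : om P.k₀ = P.ω₀
  φ_eq : φ P.k₀ = P.φ₀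
  gauge : innerL2 Ψ₀ (fun ζ => toC (dk φ P.k₀ ζ)) = 0

/-- The coefficient `a = ω₀ - k₀ ω'(k₀)`. -/
def Data.coeffA (P : Data n) (om : ℝ → ℝ) : ℝ := P.ω₀ - P.k₀ * deriv om P.k₀

/-- The coefficient `d = k₀² ⟨Ψ₀, D φ₀' + 2 k₀ D ∂_ζ ∂ₖ φ(·; k₀)⟩`. (The inner product is real,
because the adjoint eigenfunction `Ψ₀` is real-valued; the real part only fixes the type.) -/
def Data.coeffD (P : Data n) (Ψ₀ : ℝ → Fin n → ℂ) (φ : ℝ → ℝ → Fin n → ℝ) : ℝ :=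
  P.k₀ ^ 2 * (innerL2 Ψ₀ (fun ζ =>
    toC (P.D *ᵥ deriv P.φ₀ ζ + (2 * P.k₀) • (P.D *ᵥ deriv (dk φ P.k₀) ζ)))).re

/-! ### The propagators -/

/-- The low-frequency cut-off: smooth, `[0,1]`-valued, equal to `1` for `|ξ| < ξ₀ / 2`, and
supported in a compact subset of `(-ξ₀, ξ₀)`. -/
structure IsFreqCutoff (ξ₀ : ℝ) (ρ : ℝ → ℝ) : Prop where
  smooth : ContDiff ℝ ∞ ρ
  mem : ∀ ξ, ρ ξ ∈ Icc (0 : ℝ) 1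
  eq_one : ∀ ξ, |ξ| < ξ₀ / 2 → ρ ξ = 1
  support : tsupport ρ ⊆ Ioo (-ξ₀) ξ₀

/-- The temporal cut-off: smooth, `[0,1]`-valued, vanishing on `[0,1]` (and extended by zero to
negative times) and equal to `1` on `[2,∞)`. -/
structure IsTimeCutoff (χ : ℝ → ℝ) : Prop where
  smooth : ContDiff ℝ ∞ χ
  mem : ∀ t, χ t ∈ Icc (0 : ℝ) 1
  eq_zero : ∀ t ≤ 1, χ t = 0
  eq_one : ∀ t, 2 ≤ t → χ t = 1

/-- The kernel `G_p⁰(ζ, ζ', t) = (2π)⁻¹ ∫ ρ(ξ) e^{iξ(ζ-ζ')} e^{λ_c(ξ) t} Ψ_ξ(ζ')^* dξ`, a row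
vector. -/
def kernelGp (ρ : ℝ → ℝ) (lamc : ℝ → ℂ) (Ψ : ℝ → ℝ → Fin n → ℂ) (ζ ζ' t : ℝ) : Fin n → ℂ :=
  ((2 * Real.pi : ℝ) : ℂ)⁻¹ • ∫ ξ : ℝ,
    ((ρ ξ : ℂ) * Complex.exp (Complex.I * ξ * (ζ - ζ')) * Complex.exp (lamc ξ * t)) • star (Ψ ξ ζ')

/-- The principal part `S_p⁰(t) w (ζ) = χ(t) ∫ G_p⁰(ζ, ζ', t) w(ζ') dζ'` of the semigroup. -/
def Sp (ρ χ : ℝ → ℝ) (lamc : ℝ → ℂ) (Ψ : ℝ → ℝ → Fin n → ℂ) (w : ℝ → Fin n → ℂ) (t ζ : ℝ) : ℂ :=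
  (χ t : ℂ) * ∫ ζ' : ℝ, kernelGp ρ lamc Ψ ζ ζ' t ⬝ᵥ w ζ'

/-- The product `g v` of a vector-valued function and a real-valued function. -/
def modulate (g : ℝ → Fin n → ℂ) (v : ℝ → ℝ) (ζ : ℝ) : Fin n → ℂ := (v ζ : ℂ) • g ζ

/-- The semigroup `e^{(d ∂² + a ∂) t}` on `C_ub(ℝ)` for `d > 0`, i.e. the solution operator of
`∂ₜ u = d u_ζζ + a u_ζ`. -/
def convHeat (d a t : ℝ) (v : ℝ → ℝ) (ζ : ℝ) : ℝ :=
  if t = 0 then v ζ else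
    (Real.sqrt (4 * Real.pi * d * t))⁻¹ *
      ∫ y : ℝ, Real.exp (-(ζ + a * t - y) ^ 2 / (4 * d * t)) * v y

/-- Spatial derivative `∂_ζ` of a function of `(t, ζ)`. -/
def dζ (U : ℝ → ℝ → ℂ) (t ζ : ℝ) : ℂ := deriv (fun z => U t z) ζ

/-- The derivative `∂ₜ - a ∂_ζ` of a function of `(t, ζ)`. -/
def dtr (a : ℝ) (U : ℝ → ℝ → ℂ) (t ζ : ℝ) : ℂ :=
  deriv (fun s => U s ζ) t - (a : ℂ) * deriv (fun z => U t z) ζ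

end WaveTrain

end

noncomputable section

namespace WaveTrain

/-! The critical curve has the form `λ_c(ξ) = iaξ + ξ²ν(ξ)` with `ν(0) = -d` and `Re ν ≤ -θ`. To see
this, insert the trial function `φ₀' + iξk₀ ∂ₖφ` in `ℒ(ξ)`. The `ζ`- and `k`-derivatives of the
profile equation leave `iaξ` times the trial function plus an explicit residual of order `ξ²`;
pairing with the adjoint eigenfunction at the same `ξ` gives an exact identity for `λ_c`
(`bloch_trial`, `dispersion_identity`). The gauge condition identifies `ν(0)`, and the spectral
bound gives `d ≥ θ > 0`.

The factor `e^{iaξt}` only translates `ζ` to `y = ζ + at`. Hence `∂ₜ - a∂_ζ` becomes `∂ₜ` at fixed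
`y` and multiplies the symbol by `ξ²ν`, while `∂_ζ` multiplies it by `iξ`. At time `t = s²`, `s ≥
1`, rescaling the frequency by `s` and integrating by parts four times bounds the kernel of a symbol
with a factor `ξ^p` by a multiple of `s^{-p-1}(1 + (z/s)²)^{-2}`. The frequency cut-off lives in
`|ξ| < 2π`, so by Poisson summation the kernel acts on periodic functions through `ξ = 0` only. For
`p ≥ 1` it annihilates them, `v(x)` may be replaced by `v(x) - v(y) = O(‖v'‖|x - y|)`, and the
result is of size `s^{1-p}‖v'‖` (`exists_norm_oscOp_pow_le`). With `p = 2m + l` this is the first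
estimate; derivatives that fall on `χ` live on `[1,2]` and are harmless.

In the second estimate only the term with all derivatives on `χ` has `p = 0`. The symbol `ρΨ_ξ^*φ₀'`
has mean `⟨Ψ₀, φ₀'⟩ = 1` at `ξ = 0`. It is split into a part vanishing at `ξ = 0`, a mean-zero
oscillation removed by integration by parts, and `ρ` alone. The last is compared with the heat
kernel of equal mass by deforming `ν` to `-d` in the exponent and dropping `ρ`; each replacement
gains the missing factor `1/s` (`exists_norm_oscOp_mean_one_sub_heat_le`). -/

/-- The derivatives of `B` up to order `k` are bounded by `M * exp (-c * x ^ 2)`. The rate `c` may be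
negative. -/
def GaussBdd (k : ℕ) (c M : ℝ) (B : ℝ → ℂ) : Prop :=
  ContDiff ℝ k B ∧ ∀ j ≤ k, ∀ x, ‖iteratedDeriv j B x‖ ≤ M * Real.exp (-c * x ^ 2)

/-! ### Calculus of amplitudes with Gaussian bounds -/

namespace GaussBdd

variable {k : ℕ} {c c' M M' : ℝ} {A B : ℝ → ℂ}

lemma nonneg (h : GaussBdd k c M B) : 0 ≤ M := by
  have := (norm_nonneg _).trans (h.2 0 (Nat.zero_le _) 0)
  simpa using this

lemma norm_le (h : GaussBdd k c M B) (x : ℝ) : ‖B x‖ ≤ M * Real.exp (-c * x ^ 2) := by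
  simpa using h.2 0 (Nat.zero_le _) x

lemma mono (h : GaussBdd k c M B) (hc : c' ≤ c) (hM : M ≤ M') : GaussBdd k c' M' B := by
  refine ⟨h.1, fun j hj x => (h.2 j hj x).trans ?_⟩
  have := h.nonneg
  gcongr
  nlinarith [sq_nonneg x]

lemma of_le {k' : ℕ} (h : GaussBdd k c M B) (hk : k' ≤ k) : GaussBdd k' c M B :=
  ⟨h.1.of_le (by exact_mod_cast hk), fun j hj x => h.2 j (hj.trans hk) x⟩

/-- Leibniz rule: the Gaussian rates add, and the binomial coefficients sum to at most `2 ^ k`. -/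
lemma mul (hA : GaussBdd k c M A) (hB : GaussBdd k c' M' B) :
    GaussBdd k (c + c') (2 ^ k * M * M') (fun x => A x * B x) := by
  have hM := hA.nonneg
  have hM' := hB.nonneg
  refine ⟨hA.1.mul hB.1, fun j hj x => ?_⟩
  have h1 := norm_iteratedFDeriv_mul_le hA.1 hB.1 x (n := j) (by exact_mod_cast hj)
  simp only [norm_iteratedFDeriv_eq_norm_iteratedDeriv] at h1
  refine h1.trans ?_
  calc _ ≤ ∑ i ∈ Finset.range (j + 1), (j.choose i : ℝ) *
        ((M * Real.exp (-c * x ^ 2)) * (M' * Real.exp (-c' * x ^ 2))) := by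
        refine Finset.sum_le_sum fun i hi => ?_
        rw [mul_assoc]
        have hi' : i ≤ j := Nat.lt_succ_iff.1 (Finset.mem_range.1 hi)
        gcongr
        · exact hA.2 i (hi'.trans hj) x
        · exact hB.2 _ ((Nat.sub_le _ _).trans hj) x
    _ = 2 ^ j * M * M' * Real.exp (-(c + c') * x ^ 2) := by
        rw [← Finset.sum_mul]
        have : (∑ i ∈ Finset.range (j + 1), (j.choose i : ℝ)) = 2 ^ j := by
          exact_mod_cast Nat.sum_range_choose j
        rw [this, show -(c + c') * x ^ 2 = -c * x ^ 2 + -c' * x ^ 2 by ring, Real.exp_add]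
        ring
    _ ≤ _ := by
        gcongr
        norm_num

lemma add (hA : GaussBdd k c M A) (hB : GaussBdd k c M' B) :
    GaussBdd k c (M + M') (fun x => A x + B x) := by
  refine ⟨hA.1.add hB.1, fun j hj x => ?_⟩
  have hj' : (j : WithTop ℕ∞) ≤ k := by exact_mod_cast hj
  have : iteratedDeriv j (fun x => A x + B x) x = iteratedDeriv j A x + iteratedDeriv j B x :=
    iteratedDeriv_fun_add (hA.1.of_le hj').contDiffAt (hB.1.of_le hj').contDiffAt
  rw [this, add_mul]
  exact (norm_add_le _ _).trans (add_le_add (hA.2 j hj x) (hB.2 j hj x))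

lemma const_mul (a : ℂ) (hA : GaussBdd k c M A) :
    GaussBdd k c (‖a‖ * M) (fun x => a * A x) := by
  refine ⟨contDiff_const.mul hA.1, fun j hj x => ?_⟩
  rw [iteratedDeriv_const_mul_field, norm_mul, mul_assoc]
  gcongr
  exact hA.2 j hj x

lemma const (k : ℕ) (a : ℂ) : GaussBdd k 0 ‖a‖ (fun _ => a) := by
  refine ⟨contDiff_const, fun j _ x => ?_⟩
  rw [iteratedDeriv_const]
  split_ifs <;> simp

lemma deriv (h : GaussBdd (k + 1) c M B) : GaussBdd k c M (deriv B) := by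
  refine ⟨?_, fun j hj x => ?_⟩
  · have := h.1
    push_cast at this
    exact (contDiff_succ_iff_deriv.1 this).2.2
  · rw [← iteratedDeriv_succ']
    exact h.2 _ (by omega) x

/-- The induction step on the number of derivatives: it allows product formulas for `B'` to be used
instead of formulas for higher derivatives of `B`. -/
lemma of_deriv (h0 : ∀ x, ‖B x‖ ≤ M * Real.exp (-c * x ^ 2)) (hd : Differentiable ℝ B)
    (h : GaussBdd k c M (_root_.deriv B)) : GaussBdd (k + 1) c M B := by
  refine ⟨?_, fun j hj x => ?_⟩
  · push_cast
    exact contDiff_succ_iff_deriv.2 ⟨hd, by simp, h.1⟩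
  · rcases j with _ | j
    · simpa using h0 x
    · rw [iteratedDeriv_succ']
      exact h.2 _ (by omega) x

/-- Rescaling by a factor `s ≥ 1`. -/
lemma comp_div {s : ℝ} (hs : 1 ≤ s) (h : GaussBdd k 0 M B) :
    GaussBdd k 0 M (fun x => B (x / s)) := by
  have e : (fun x => B (x / s)) = fun x => B (s⁻¹ * x) := by
    funext x; rw [div_eq_inv_mul]
  rw [e]
  refine ⟨h.1.comp (contDiff_const.mul contDiff_id), fun j hj x => ?_⟩
  rw [iteratedDeriv_comp_const_smul (h.1.of_le (by exact_mod_cast hj)), norm_smul]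
  have h1 : ‖(s⁻¹) ^ j‖ ≤ 1 := by
    rw [norm_pow]
    refine pow_le_one₀ (norm_nonneg _) ?_
    rw [norm_inv, Real.norm_of_nonneg (by linarith)]
    exact inv_le_one_of_one_le₀ hs
  have h2 := h.2 j hj (s⁻¹ * x)
  simp only [neg_zero, zero_mul, Real.exp_zero, mul_one] at h2 ⊢
  calc _ ≤ 1 * M := by gcongr
    _ = M := one_mul _

lemma abs_le_exp {ε : ℝ} (hε : 0 < ε) (x : ℝ) : |x| ≤ (1 + 1 / ε) * Real.exp (ε * x ^ 2) := by
  have h1 : ε * x ^ 2 ≤ Real.exp (ε * x ^ 2) := by linarith [Real.add_one_le_exp (ε * x ^ 2)]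
  have h2 : 1 ≤ Real.exp (ε * x ^ 2) := Real.one_le_exp (by positivity)
  have h3 : |x| ≤ 1 + x ^ 2 := by
    have : x ^ 2 = |x| ^ 2 := (sq_abs x).symm
    nlinarith [sq_nonneg (|x| - 1 / 2)]
  have h4 : x ^ 2 ≤ 1 / ε * Real.exp (ε * x ^ 2) := by
    rw [one_div, ← div_eq_inv_mul, le_div_iff₀ hε]; linarith
  linarith

/-- Rescaling a function that vanishes at the origin gains a factor `s⁻¹`. -/
lemma comp_div_of_eq_zero {s ε : ℝ} (hs : 1 ≤ s) (hε : 0 < ε) (h : GaussBdd (k + 1) 0 M B)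
    (h0 : B 0 = 0) : GaussBdd (k + 1) (-ε) ((1 + 1 / ε) * M * s⁻¹) (fun x => B (x / s)) := by
  have hs0 : 0 < s := by linarith
  have hM := h.nonneg
  have hd : Differentiable ℝ B := h.1.differentiable (by simp)
  have hB' : ∀ x, ‖_root_.deriv B x‖ ≤ M := fun x => by simpa using h.deriv.norm_le x
  have hlip : ∀ x, ‖B x‖ ≤ M * |x| := fun x => by
    have := Convex.norm_image_sub_le_of_norm_deriv_le (s := univ) (f := B) (C := M) (x := 0) (y := x)
      (fun x _ => hd x) (fun x _ => hB' x) convex_univ (mem_univ _) (mem_univ _)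
    simpa [h0] using this
  refine of_deriv (fun x => ?_) (hd.comp (differentiable_id.div_const s)) ?_
  · refine (hlip _).trans ?_
    have := abs_le_exp hε x
    rw [abs_div, abs_of_pos hs0, neg_neg, div_eq_mul_inv]
    calc M * (|x| * s⁻¹) ≤ M * ((1 + 1 / ε) * Real.exp (ε * x ^ 2) * s⁻¹) := by gcongr
      _ = _ := by ring
  · have e : _root_.deriv (fun x => B (x / s)) = fun x => ((s⁻¹ : ℝ) : ℂ) * _root_.deriv B (x / s) := by
      funext x
      have := (hd (x / s)).hasDerivAt.scomp x ((hasDerivAt_id x).div_const s)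
      rw [show (fun x => B (x / s)) = B ∘ fun x => id x / s from rfl, this.deriv]
      simp
    rw [e]
    refine ((h.deriv.comp_div hs).const_mul _).mono (by linarith) ?_
    rw [Complex.norm_real, Real.norm_of_nonneg (by positivity)]
    have : 0 ≤ 1 / ε * M * s⁻¹ := by positivity
    nlinarith

lemma id_bdd (k : ℕ) {ε : ℝ} (hε : 0 < ε) : GaussBdd k (-ε) (1 + 1 / ε) (fun x : ℝ => (x : ℂ)) := by
  have h1 : 1 ≤ 1 + 1 / ε := by have := one_div_pos.2 hε; linarith
  refine GaussBdd.of_le (k := k + 1) ?_ (Nat.le_succ k)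
  have hder : ∀ x : ℝ, HasDerivAt (fun x : ℝ => (x : ℂ)) 1 x := fun x =>
    Complex.ofRealCLM.hasDerivAt
  refine of_deriv (fun x => ?_) (fun x => (hder x).differentiableAt) ?_
  · simpa using abs_le_exp hε x
  · rw [show _root_.deriv (fun x : ℝ => (x : ℂ)) = fun _ => (1 : ℂ) from funext fun x => (hder x).deriv]
    exact (const k 1).mono (by linarith) (by simpa using hε.le)

/-- Polynomial growth costs an arbitrarily small Gaussian rate; in the induction each of the two
factors receives half of it. -/
lemma exists_pow_bdd (p k : ℕ) {ε : ℝ} (hε : 0 < ε) :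
    ∃ C, GaussBdd k (-ε) C (fun x : ℝ => (x : ℂ) ^ p) := by
  induction p generalizing ε with
  | zero => exact ⟨_, by simpa using (const k 1).mono (by linarith) le_rfl⟩
  | succ p ih =>
    obtain ⟨C, hC⟩ := ih (half_pos hε)
    refine ⟨2 ^ k * C * (1 + 1 / (ε / 2)), ?_⟩
    simp only [pow_succ]
    exact (hC.mul (id_bdd k (half_pos hε))).mono (by linarith) le_rfl

/-- Exponentials of functions with controlled derivatives and quadratically decaying real part. -/
lemma exists_exp (k : ℕ) (H : ℝ) : ∃ C, ∀ (θ ε : ℝ) (P : ℝ → ℂ), 0 ≤ ε → GaussBdd k (-ε) H P →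
    (∀ x, (P x).re ≤ -θ * x ^ 2) → GaussBdd k (θ - k * ε) C (fun x => Complex.exp (P x)) := by
  induction k with
  | zero =>
    refine ⟨1, fun θ ε P _ hP hre => ⟨?_, fun j hj x => ?_⟩⟩
    · exact Complex.contDiff_exp.comp hP.1
    · obtain rfl : j = 0 := by omega
      simpa [Complex.norm_exp] using hre x
  | succ k ih =>
    obtain ⟨C, hC⟩ := ih
    -- Each derivative of `exp P` brings out a factor `P'`, which costs `ε` of the rate and
    -- multiplies the constant by `2 ^ k * H`. The entry `1` serves `exp P` itself.
    refine ⟨max 1 (max C (2 ^ k * H * C)), fun θ ε P hε hP hre => ?_⟩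
    have hd : Differentiable ℝ P := hP.1.differentiable (by simp)
    have hE := hC θ ε P hε (hP.of_le (Nat.le_succ k)) hre
    refine of_deriv (fun x => ?_) (hd.cexp) ?_
    · rw [Complex.norm_exp]
      calc _ ≤ 1 * Real.exp (-(θ - (k + 1 : ℕ) * ε) * x ^ 2) := by
            rw [one_mul, Real.exp_le_exp]
            have h1 : 0 ≤ ((k + 1 : ℕ) : ℝ) * ε * x ^ 2 := by positivity
            nlinarith [hre x]
        _ ≤ _ := by gcongr; exact le_max_left _ _
    · have e : _root_.deriv (fun x => Complex.exp (P x)) =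
          fun x => _root_.deriv P x * Complex.exp (P x) := by
        funext x
        rw [(hd x).hasDerivAt.cexp.deriv, mul_comm]
      rw [e]
      refine (hP.deriv.mul hE).mono (le_of_eq ?_) ((le_max_right _ _).trans (le_max_right _ _))
      push_cast; ring

lemma integrable_iteratedDeriv (hc : 0 < c) (h : GaussBdd k c M B) {j : ℕ} (hj : j ≤ k) :
    Integrable (iteratedDeriv j B) := by
  refine Integrable.mono' ((integrable_exp_neg_mul_sq hc).const_mul M) ?_
    (Filter.Eventually.of_forall fun x => h.2 j hj x)
  exact (h.1.continuous_iteratedDeriv j (by exact_mod_cast hj)).aestronglyMeasurable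

lemma integrable (hc : 0 < c) (h : GaussBdd k c M B) : Integrable B := by
  simpa using h.integrable_iteratedDeriv hc (Nat.zero_le k)

lemma integral_norm_le (hc : 0 < c) (h : GaussBdd k c M B) {j : ℕ} (hj : j ≤ k) :
    ∫ x, ‖iteratedDeriv j B x‖ ≤ M * Real.sqrt (Real.pi / c) := by
  rw [← integral_gaussian, ← integral_const_mul]
  exact integral_mono (h.integrable_iteratedDeriv hc hj).norm
    ((integrable_exp_neg_mul_sq hc).const_mul M) (fun x => h.2 j hj x)

/-! ### Decay of oscillatory integrals -/

open FourierTransform in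
lemma integral_exp_eq_fourier (B : ℝ → ℂ) (w : ℝ) :
    ∫ x : ℝ, B x * Complex.exp (Complex.I * x * w) = 𝓕 B (-(w / (2 * Real.pi))) := by
  rw [Real.fourier_eq']
  refine integral_congr_ae (Filter.Eventually.of_forall fun x => ?_)
  simp only [smul_eq_mul, RCLike.inner_apply, conj_trivial]
  rw [mul_comm]
  congr 2
  have : (Real.pi : ℂ) ≠ 0 := by exact_mod_cast Real.pi_ne_zero
  push_cast
  field_simp

/-- Four derivatives give decay of order four for the oscillatory integral. -/
lemma norm_oscillatory_le (hc : 0 < c) (h : GaussBdd 4 c M B) (w : ℝ) :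
    ‖∫ x : ℝ, B x * Complex.exp (Complex.I * x * w)‖
      ≤ 4 * Real.sqrt (Real.pi / c) * M * ((1 + w ^ 2)⁻¹) ^ 2 := by
  have h0 : ‖∫ x : ℝ, B x * Complex.exp (Complex.I * x * w)‖ ≤ M * Real.sqrt (Real.pi / c) := by
    refine (norm_integral_le_integral_norm _).trans ?_
    refine le_trans (le_of_eq ?_) (h.integral_norm_le hc (Nat.zero_le 4))
    congr with x
    rw [norm_mul, show Complex.I * x * w = ((x * w : ℝ) : ℂ) * Complex.I by push_cast; ring,
      Complex.norm_exp_ofReal_mul_I]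
    simp
  have h4 : w ^ 4 * ‖∫ x : ℝ, B x * Complex.exp (Complex.I * x * w)‖
      ≤ M * Real.sqrt (Real.pi / c) := by
    have e := congrFun (Real.fourier_iteratedDeriv (N := 4) (n := 4) h.1
      (fun j hj => h.integrable_iteratedDeriv hc (by exact_mod_cast hj)) le_rfl)
      (-(w / (2 * Real.pi)))
    rw [← integral_exp_eq_fourier, ← integral_exp_eq_fourier] at e
    have e2 : ‖(2 * Real.pi * Complex.I * ((-(w / (2 * Real.pi)) : ℝ) : ℂ)) ^ 4‖ = w ^ 4 := by
      have : 2 * Real.pi * Complex.I * ((-(w / (2 * Real.pi)) : ℝ) : ℂ) = -Complex.I * w := by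
        have : (Real.pi : ℂ) ≠ 0 := by exact_mod_cast Real.pi_ne_zero
        push_cast
        field_simp
      rw [this, norm_pow, norm_mul]
      simp only [norm_neg, Complex.norm_I, one_mul, Complex.norm_real, Real.norm_eq_abs]
      exact Even.pow_abs (by decide) w
    have e3 := congrArg norm e
    rw [norm_smul, e2] at e3
    rw [← e3]
    refine (norm_integral_le_integral_norm _).trans ?_
    refine le_trans (le_of_eq ?_) (h.integral_norm_le hc (le_refl 4))
    congr with x
    rw [norm_mul, show Complex.I * x * w = ((x * w : ℝ) : ℂ) * Complex.I by push_cast; ring,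
      Complex.norm_exp_ofReal_mul_I, mul_one]
  set N := ‖∫ x : ℝ, B x * Complex.exp (Complex.I * x * w)‖
  have hN : 0 ≤ N := norm_nonneg _
  rw [inv_pow, ← div_eq_mul_inv, le_div_iff₀ (by positivity)]
  -- Both bounds, for `w ^ 0` and `w ^ 4`, enter with weight `2`; this is the origin of the constant
  -- `4`.
  have h5 : (1 + w ^ 2) ^ 2 ≤ 2 + 2 * w ^ 4 := by nlinarith [sq_nonneg (w ^ 2 - 1)]
  calc N * (1 + w ^ 2) ^ 2 ≤ N * (2 + 2 * w ^ 4) := by gcongr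
    _ ≤ _ := by linarith

/-- The decay estimate for kernels with a diffusive phase: if the amplitude is `B (s ξ)`, the kernel
lives on the spatial scale `s`. -/
lemma exists_kernel_bound {θ N : ℝ} (hθ : 0 < θ) : ∃ C, 0 ≤ C ∧ ∀ (ν B : ℝ → ℂ) (M s z : ℝ), 1 ≤ s →
    GaussBdd 4 0 N ν → (∀ ξ, (ν ξ).re ≤ -θ) → GaussBdd 4 (-(θ / 8)) M B →
    ‖∫ ξ : ℝ, B (s * ξ) * Complex.exp (Complex.I * ξ * z) *
        Complex.exp ((ξ : ℂ) ^ 2 * ν ξ * (s ^ 2 : ℝ))‖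
      ≤ C * M * s⁻¹ * ((1 + (z / s) ^ 2)⁻¹) ^ 2 := by
  -- Budget for the rate `θ`: the four derivatives of the exponential cost `4 · θ/8`, the growth of
  -- `B` costs `θ/8`, and `3θ/8 ≥ θ/4` remains.
  obtain ⟨C₂, hC₂⟩ := exists_pow_bdd 2 4 (ε := θ / 8) (by positivity)
  obtain ⟨C₁, hC₁⟩ := exists_exp 4 (2 ^ 4 * C₂ * N)
  refine ⟨|4 * Real.sqrt (Real.pi / (θ / 4)) * (2 ^ 4 * C₁)|, abs_nonneg _,
    fun ν B M s z hs hν hre hB => ?_⟩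
  have hs0 : 0 < s := by linarith
  have hP : GaussBdd 4 (-(θ / 8)) (2 ^ 4 * C₂ * N) (fun x : ℝ => (x : ℂ) ^ 2 * ν (x / s)) :=
    (hC₂.mul (hν.comp_div hs)).mono (by linarith) le_rfl
  have hE := hC₁ θ (θ / 8) _ (by positivity) hP (fun x => by
    rw [← Complex.ofReal_pow, Complex.re_ofReal_mul]
    nlinarith [hre (x / s), sq_nonneg x])
  have hBE := ((hB.mul hE).mono (c' := θ / 4) (by push_cast; linarith) le_rfl).norm_oscillatory_le
    (by positivity) (z / s)
  -- The substitution `x = sξ` brings the Gaussian to unit width and moves the scale into `z / s`;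
  -- the Jacobian is the factor `s⁻¹`.
  have e : ∫ ξ : ℝ, B (s * ξ) * Complex.exp (Complex.I * ξ * z) *
        Complex.exp ((ξ : ℂ) ^ 2 * ν ξ * (s ^ 2 : ℝ)) =
      (s⁻¹ : ℝ) • ∫ x : ℝ, B x * Complex.exp ((x : ℂ) ^ 2 * ν (x / s)) *
        Complex.exp (Complex.I * x * (z / s : ℝ)) := by
    have := Measure.integral_comp_mul_left (fun x : ℝ => B x * Complex.exp ((x : ℂ) ^ 2 * ν (x / s)) *
        Complex.exp (Complex.I * x * (z / s : ℝ))) s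
    rw [abs_of_pos (by positivity)] at this
    rw [← this]
    congr with ξ
    have hsc : (s : ℂ) ≠ 0 := by exact_mod_cast hs0.ne'
    have e₁ : Complex.I * ((s * ξ : ℝ) : ℂ) * ((z / s : ℝ) : ℂ) = Complex.I * ξ * z := by
      push_cast; field_simp
    have e₂ : ((s * ξ : ℝ) : ℂ) ^ 2 * ν ξ = (ξ : ℂ) ^ 2 * ν ξ * (s ^ 2 : ℝ) := by
      push_cast; ring
    rw [mul_div_cancel_left₀ ξ hs0.ne', e₁, e₂]
    ring
  rw [e, norm_smul, Real.norm_of_nonneg (by positivity)]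
  calc _ ≤ s⁻¹ * (4 * Real.sqrt (Real.pi / (θ / 4)) * (2 ^ 4 * M * C₁) *
        ((1 + (z / s) ^ 2)⁻¹) ^ 2) := by gcongr
    _ = (4 * Real.sqrt (Real.pi / (θ / 4)) * (2 ^ 4 * C₁)) * (M * s⁻¹ *
        ((1 + (z / s) ^ 2)⁻¹) ^ 2) := by ring
    _ ≤ |4 * Real.sqrt (Real.pi / (θ / 4)) * (2 ^ 4 * C₁)| * (M * s⁻¹ *
        ((1 + (z / s) ^ 2)⁻¹) ^ 2) := by
        have := hB.nonneg
        gcongr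
        exact le_abs_self _
    _ = _ := by ring

end GaussBdd

/-! ### Periodic functions and Lorentzian weights -/

/-- The weight `(1 + z²)⁻¹`. -/
def lorentz (z : ℝ) : ℝ := (1 + z ^ 2)⁻¹

lemma lorentz_pos (z : ℝ) : 0 < lorentz z := by unfold lorentz; positivity

lemma lorentz_le_one (z : ℝ) : lorentz z ≤ 1 :=
  inv_le_one_of_one_le₀ (by nlinarith [sq_nonneg z])

lemma continuous_lorentz : Continuous lorentz := by
  unfold lorentz
  exact Continuous.inv₀ (by fun_prop) fun x => by positivity

/-- This is why fourth-order decay is needed: one factor `lorentz` absorbs the linear growth of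
`v(x) - v(y)`, and the other one is still integrable. -/
lemma abs_mul_lorentz_sq_le (z : ℝ) : |z| * lorentz z ^ 2 ≤ lorentz z := by
  have h : |z| * lorentz z ≤ 1 := by
    unfold lorentz
    rw [← div_eq_mul_inv, div_le_one (by positivity)]
    nlinarith [sq_abs z, sq_nonneg (|z| - 1 / 2), abs_nonneg z]
  calc |z| * lorentz z ^ 2 = |z| * lorentz z * lorentz z := by ring
    _ ≤ 1 * lorentz z := by gcongr; exact (lorentz_pos z).le
    _ = _ := one_mul _

/-- On scales `s ≥ 1` the weight varies by a bounded factor over a unit cell, so lattice sums can be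
compared with integrals. -/
lemma lorentz_le_shift {s : ℝ} (hs : 1 ≤ s) (z : ℝ) {r : ℝ} (hr : r ∈ Ioc (0 : ℝ) 1) :
    lorentz (z / s) ≤ 3 * lorentz ((z - r) / s) := by
  have hs0 : 0 < s := by linarith
  unfold lorentz
  rw [← div_eq_mul_inv, le_div_iff₀ (by positivity), inv_mul_le_iff₀ (by positivity)]
  have h1 : (r / s) ^ 2 ≤ 1 := by
    have h2 : r / s ≤ 1 := (div_le_one hs0).2 (hr.2.trans hs)
    have h3 : 0 ≤ r / s := div_nonneg hr.1.le hs0.le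
    nlinarith
  rw [sub_div]
  nlinarith [sq_nonneg (z / s + r / s), sq_nonneg (z / s)]

lemma lintegral_eq_tsum_Ioc (f : ℝ → ENNReal) :
    ∫⁻ x, f x = ∑' n : ℤ, ∫⁻ x in Ioc (0 : ℝ) 1, f (x + n) := by
  have h := lintegral_iUnion (μ := (volume : Measure ℝ)) (fun n : ℤ => measurableSet_Ioc)
    (pairwise_disjoint_Ioc_intCast ℝ) f
  rw [iUnion_Ioc_intCast, Measure.restrict_univ] at h
  rw [h]
  congr with n
  have h2 := (measurePreserving_add_right volume (n : ℝ)).setLIntegral_comp_preimage_emb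
    (measurableEmbedding_addRight _) f (Ioc (n : ℝ) (n + 1))
  rw [← h2, preimage_add_const_Ioc]
  simp

lemma lintegral_lorentz_div {s : ℝ} (hs : 0 < s) (y : ℝ) :
    ∫⁻ x : ℝ, ENNReal.ofReal (lorentz ((y - x) / s)) = ENNReal.ofReal (Real.pi * s) := by
  have hi : Integrable (fun x : ℝ => lorentz ((y - x) / s)) :=
    (integrable_inv_one_add_sq.comp_div hs.ne').comp_sub_left y
  rw [← ofReal_integral_eq_lintegral_ofReal hi
    (Filter.Eventually.of_forall fun x => (lorentz_pos _).le)]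
  congr 1
  rw [integral_sub_left_eq_self (fun x => lorentz (x / s)) volume y,
    Measure.integral_comp_div lorentz s]
  unfold lorentz
  rw [integral_univ_inv_one_add_sq, abs_of_pos hs, smul_eq_mul, mul_comm]

/-- Each term is at most three times the average over an adjacent unit cell, and the cells tile the
line. -/
lemma tsum_lorentz_le {s : ℝ} (hs : 1 ≤ s) (y : ℝ) :
    ∑' n : ℤ, ENNReal.ofReal (lorentz ((y - n) / s)) ≤ ENNReal.ofReal (3 * Real.pi * s) := by
  have hs0 : 0 < s := by linarith
  calc ∑' n : ℤ, ENNReal.ofReal (lorentz ((y - n) / s))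
      ≤ ∑' n : ℤ, ∫⁻ r in Ioc (0 : ℝ) 1, 3 * ENNReal.ofReal (lorentz ((y - (r + n)) / s)) := by
        refine ENNReal.tsum_le_tsum fun n => ?_
        calc ENNReal.ofReal (lorentz ((y - n) / s))
            = ∫⁻ r in Ioc (0 : ℝ) 1, ENNReal.ofReal (lorentz ((y - n) / s)) := by simp
          _ ≤ _ := by
            refine setLIntegral_mono' measurableSet_Ioc fun r hr => ?_
            have := lorentz_le_shift hs (y - n) hr
            rw [show (3 : ENNReal) = ENNReal.ofReal 3 by simp, ← ENNReal.ofReal_mul (by norm_num)]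
            refine ENNReal.ofReal_le_ofReal ?_
            rwa [show y - (r + n) = y - n - r by ring]
    _ = ∫⁻ x : ℝ, 3 * ENNReal.ofReal (lorentz ((y - x) / s)) :=
        (lintegral_eq_tsum_Ioc fun x => 3 * ENNReal.ofReal (lorentz ((y - x) / s))).symm
    _ = 3 * ENNReal.ofReal (Real.pi * s) := by
        rw [lintegral_const_mul' _ _ (by simp), lintegral_lorentz_div hs0]
    _ = _ := by
        rw [show (3 : ENNReal) = ENNReal.ofReal 3 by simp, ← ENNReal.ofReal_mul (by norm_num),
          mul_assoc]

/-- `1`-periodic functions that are integrable over a period. -/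
structure IsL1per (g : ℝ → ℂ) : Prop where
  periodic : Function.Periodic g 1
  integrableOn : IntegrableOn g (Ioc (0 : ℝ) 1)

namespace IsL1per

variable {g : ℝ → ℂ}

lemma add_int (hg : IsL1per g) (x : ℝ) (n : ℤ) : g (x + n) = g x := by
  simpa using hg.periodic.int_mul n x

lemma of_continuous (hg : Continuous g) (hp : Function.Periodic g 1) : IsL1per g :=
  ⟨hp, (hg.integrableOn_Icc (a := 0) (b := 1)).mono_set Ioc_subset_Icc_self⟩

lemma aestronglyMeasurable (hg : IsL1per g) : AEStronglyMeasurable g := by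
  rw [← Measure.restrict_univ (μ := (volume : Measure ℝ)), ← iUnion_Ioc_intCast ℝ,
    aestronglyMeasurable_iUnion_iff]
  intro n
  have hi : IntervalIntegrable g volume 0 (0 + 1) := by
    rw [zero_add, intervalIntegrable_iff_integrableOn_Ioc_of_le zero_le_one]
    exact hg.integrableOn
  have := hg.periodic.intervalIntegrable one_ne_zero hi n (n + 1)
  rw [intervalIntegrable_iff_integrableOn_Ioc_of_le (by linarith)] at this
  exact this.aestronglyMeasurable

/-- Folding the line onto one period takes `g` out of the lattice sum of the weight, whose bound is
uniform. Hence integrability over a single cell suffices. -/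
lemma lintegral_lorentz_le (hg : IsL1per g) {s : ℝ} (hs : 1 ≤ s) (y : ℝ) :
    ∫⁻ x : ℝ, ENNReal.ofReal (lorentz ((y - x) / s) * ‖g x‖)
      ≤ ENNReal.ofReal (3 * Real.pi * s * ∫ x in Ioc (0 : ℝ) 1, ‖g x‖) := by
  rw [lintegral_eq_tsum_Ioc, ← lintegral_tsum]
  · have hpt : ∀ x : ℝ, ∑' n : ℤ, ENNReal.ofReal (lorentz ((y - (x + n)) / s) * ‖g (x + n)‖)
        ≤ ENNReal.ofReal (3 * Real.pi * s) * ENNReal.ofReal ‖g x‖ := fun x => by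
      have : ∀ n : ℤ, ENNReal.ofReal (lorentz ((y - (x + n)) / s) * ‖g (x + n)‖) =
          ENNReal.ofReal (lorentz ((y - x - n) / s)) * ENNReal.ofReal ‖g x‖ := fun n => by
        rw [hg.add_int, ENNReal.ofReal_mul (lorentz_pos _).le, sub_sub]
      simp only [this]
      rw [ENNReal.tsum_mul_right]
      gcongr
      exact tsum_lorentz_le hs (y - x)
    refine (lintegral_mono hpt).trans (le_of_eq ?_)
    rw [lintegral_const_mul' _ _ (by simp), ← ofReal_integral_eq_lintegral_ofReal
      hg.integrableOn.norm (Filter.Eventually.of_forall fun x => norm_nonneg _),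
      ← ENNReal.ofReal_mul (by have := Real.pi_pos; positivity)]
  · intro n
    simp only [hg.add_int]
    refine AEMeasurable.ennreal_ofReal (AEMeasurable.mul ?_ hg.integrableOn.norm.aemeasurable)
    exact (continuous_lorentz.comp (by fun_prop)).measurable.aemeasurable

lemma integrable_lorentz (hg : IsL1per g) {s : ℝ} (hs : 1 ≤ s) (y : ℝ) :
    Integrable (fun x : ℝ => lorentz ((y - x) / s) * ‖g x‖) := by
  refine ⟨?_, ?_⟩
  · exact ((continuous_lorentz.comp (by fun_prop)).aestronglyMeasurable).mul
      hg.aestronglyMeasurable.norm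
  · rw [hasFiniteIntegral_iff_norm]
    refine lt_of_le_of_lt (le_of_eq ?_) ((hg.lintegral_lorentz_le hs y).trans_lt ENNReal.ofReal_lt_top)
    congr with x
    rw [Real.norm_of_nonneg (mul_nonneg (lorentz_pos _).le (norm_nonneg _))]

lemma integral_lorentz_le (hg : IsL1per g) {s : ℝ} (hs : 1 ≤ s) (y : ℝ) :
    ∫ x : ℝ, lorentz ((y - x) / s) * ‖g x‖ ≤ 3 * Real.pi * s * ∫ x in Ioc (0 : ℝ) 1, ‖g x‖ := by
  rw [integral_eq_lintegral_of_nonneg_ae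
    (Filter.Eventually.of_forall fun x => mul_nonneg (lorentz_pos _).le (norm_nonneg _))
    (hg.integrable_lorentz hs y).1]
  refine ENNReal.toReal_le_of_le_ofReal ?_ (hg.lintegral_lorentz_le hs y)
  have : 0 ≤ ∫ x in Ioc (0 : ℝ) 1, ‖g x‖ := integral_nonneg fun _ => norm_nonneg _
  have := Real.pi_pos
  positivity

end IsL1per

/-! ### Periodic symbols and oscillatory kernels -/

/-- A slice is a composition with a translation and an inclusion of norm at most one. -/
lemma norm_iteratedDeriv_slice_le {E : Type*} [NormedAddCommGroup E] [NormedSpace ℝ E]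
    {F : ℝ × E → ℂ} (hF : ContDiff ℝ ∞ F) (j : ℕ) (e : E) (ξ : ℝ) :
    ‖iteratedDeriv j (fun ξ => F (ξ, e)) ξ‖ ≤ ‖iteratedFDeriv ℝ j F (ξ, e)‖ := by
  have h1 : (fun ξ => F (ξ, e)) = (fun p => F (p + (0, e))) ∘ ContinuousLinearMap.inl ℝ ℝ E := by
    funext ξ; simp
  have h2 : ContDiff ℝ ∞ (fun p => F (p + (0, e))) := hF.comp (contDiff_id.add contDiff_const)
  rw [← norm_iteratedFDeriv_eq_norm_iteratedDeriv, h1,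
    (ContinuousLinearMap.inl ℝ ℝ E).iteratedFDeriv_comp_right h2 ξ
      (by exact_mod_cast le_top), iteratedFDeriv_comp_add_right]
  refine (ContinuousMultilinearMap.norm_compContinuousLinearMap_le _ _).trans ?_
  have h3 : ‖ContinuousLinearMap.inl ℝ ℝ E‖ ≤ 1 :=
    ContinuousLinearMap.opNorm_le_bound _ zero_le_one fun x => by simp [Prod.norm_def]
  have h4 : ∏ _i : Fin j, ‖ContinuousLinearMap.inl ℝ ℝ E‖ ≤ 1 :=
    Finset.prod_le_one (fun _ _ => norm_nonneg _) (fun _ _ => h3)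
  refine (mul_le_mul_of_nonneg_left h4 (norm_nonneg _)).trans (le_of_eq ?_)
  simp

/-- Uniform bounds for the slices of a smooth function with bounded support in the first
variable, when the parameter ranges over a compact set. -/
lemma exists_gaussBdd_slice {E : Type*} [NormedAddCommGroup E] [NormedSpace ℝ E]
    {F : ℝ × E → ℂ} (hF : ContDiff ℝ ∞ F) {R : ℝ} (hR : ∀ ξ e, R ≤ |ξ| → F (ξ, e) = 0)
    {K : Set E} (hK : IsCompact K) (k : ℕ) :
    ∃ M, ∀ e ∈ K, GaussBdd k 1 M (fun ξ => F (ξ, e)) := by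
  have hbd : ∀ j : ℕ, ∃ M, ∀ p ∈ Icc (-R) R ×ˢ K, ‖iteratedFDeriv ℝ j F p‖ ≤ M := fun j =>
    (isCompact_Icc.prod hK).exists_bound_of_continuousOn
      (hF.continuous_iteratedFDeriv (m := j) (by exact_mod_cast le_top)).continuousOn
  choose M hM using hbd
  -- The factor `exp (R ^ 2)` compensates the Gaussian weight on `|ξ| ≤ R`; outside, the slice
  -- vanishes near `ξ`.
  refine ⟨(∑ j ∈ Finset.range (k + 1), |M j|) * Real.exp (R ^ 2), fun e he => ⟨?_, fun j hj ξ => ?_⟩⟩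
  · exact (hF.comp (contDiff_id.prodMk contDiff_const)).of_le (by exact_mod_cast le_top)
  · have hnn : 0 ≤ ∑ j ∈ Finset.range (k + 1), |M j| := Finset.sum_nonneg fun _ _ => abs_nonneg _
    by_cases hξ : |ξ| ≤ R
    · refine (norm_iteratedDeriv_slice_le hF j e ξ).trans ?_
      have h1 := hM j (ξ, e) ⟨abs_le.1 hξ, he⟩
      have h2 : |M j| ≤ ∑ j ∈ Finset.range (k + 1), |M j| :=
        Finset.single_le_sum (f := fun j => |M j|) (fun _ _ => abs_nonneg _)
          (Finset.mem_range.2 (Nat.lt_succ_of_le hj))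
      have h3 : 1 ≤ Real.exp (R ^ 2) * Real.exp (-1 * ξ ^ 2) := by
        rw [← Real.exp_add]
        refine Real.one_le_exp ?_
        have := sq_le_sq' (abs_le.1 hξ).1 (abs_le.1 hξ).2
        linarith
      calc _ ≤ (∑ j ∈ Finset.range (k + 1), |M j|) * 1 := by
            rw [mul_one]; exact h1.trans ((le_abs_self _).trans h2)
        _ ≤ _ := by rw [mul_assoc]; gcongr
    · have h1 : (fun ξ => F (ξ, e)) =ᶠ[nhds ξ] fun _ => 0 := by
        have : {ξ : ℝ | R < |ξ|} ∈ nhds ξ :=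
          (isOpen_lt continuous_const continuous_abs).mem_nhds (not_le.1 hξ)
        filter_upwards [this] with η hη using hR η e (le_of_lt hη)
      rw [h1.iteratedDeriv_eq, iteratedDeriv_const]
      simp only [ite_self, norm_zero]
      positivity

/-- A symbol: a smooth function `b ξ x`, supported in `|ξ| ≤ R` and `1`-periodic in `x`. -/
structure IsSymb (R : ℝ) (b : ℝ → ℝ → ℂ) : Prop where
  smooth : ContDiff ℝ ∞ (fun p : ℝ × ℝ => b p.1 p.2)
  support : ∀ ξ x, R ≤ |ξ| → b ξ x = 0
  periodic : ∀ ξ, Function.Periodic (b ξ) 1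

/-- The oscillatory integral `∫ b(ξ, x) e^{iξz} dξ`. -/
def osc (b : ℝ → ℝ → ℂ) (z x : ℝ) : ℂ := ∫ ξ : ℝ, b ξ x * Complex.exp (Complex.I * ξ * z)

namespace IsSymb

variable {R : ℝ} {b b' : ℝ → ℝ → ℂ}

lemma mul_left (hb : IsSymb R b) {B : ℝ → ℂ} (hB : ContDiff ℝ ∞ B) :
    IsSymb R (fun ξ x => B ξ * b ξ x) :=
  ⟨(hB.comp contDiff_fst).mul hb.smooth, fun ξ x h => by simp [hb.support ξ x h],
    fun ξ x => by simp [hb.periodic ξ x]⟩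

lemma sub (hb : IsSymb R b) (hb' : IsSymb R b') : IsSymb R (fun ξ x => b ξ x - b' ξ x) :=
  ⟨hb.smooth.sub hb'.smooth, fun ξ x h => by simp [hb.support ξ x h, hb'.support ξ x h],
    fun ξ x => by simp [hb.periodic ξ x, hb'.periodic ξ x]⟩

lemma mul_right (hb : IsSymb R b) {q : ℝ → ℂ} (hq : ContDiff ℝ ∞ q) (hp : Function.Periodic q 1) :
    IsSymb R (fun ξ x => b ξ x * q x) :=
  ⟨hb.smooth.mul (hq.comp contDiff_snd), fun ξ x h => by simp [hb.support ξ x h],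
    fun ξ x => by simp [hb.periodic ξ x, hp x]⟩

lemma sum {ι : Type*} (s : Finset ι) {b : ι → ℝ → ℝ → ℂ} (hb : ∀ i ∈ s, IsSymb R (b i)) :
    IsSymb R (fun ξ x => ∑ i ∈ s, b i ξ x) :=
  ⟨ContDiff.sum fun i hi => (hb i hi).smooth,
    fun ξ x h => Finset.sum_eq_zero fun i hi => (hb i hi).support ξ x h,
    fun ξ x => Finset.sum_congr rfl fun i hi => (hb i hi).periodic ξ x⟩

lemma of_smooth {B : ℝ → ℂ} (hB : ContDiff ℝ ∞ B) (h : ∀ ξ, R ≤ |ξ| → B ξ = 0) :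
    IsSymb R (fun ξ _ => B ξ) :=
  ⟨hB.comp contDiff_fst, fun ξ _ hξ => h ξ hξ, fun _ _ => rfl⟩

/-- Periodicity confines `x` to a compact cell, which makes all bounds uniform in `x`. -/
lemma apply_fract (hb : IsSymb R b) (ξ x : ℝ) : b ξ x = b ξ (Int.fract x) := by
  have := (hb.periodic ξ).int_mul ⌊x⌋ (Int.fract x)
  rw [mul_one, Int.fract_add_floor] at this
  exact this

lemma exists_gaussBdd (hb : IsSymb R b) (k : ℕ) : ∃ M, ∀ x, GaussBdd k 1 M (fun ξ => b ξ x) := by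
  obtain ⟨M, hM⟩ := exists_gaussBdd_slice hb.smooth hb.support (isCompact_Icc (a := (0 : ℝ)) (b := 1)) k
  refine ⟨M, fun x => ?_⟩
  have := hM (Int.fract x) ⟨Int.fract_nonneg x, (Int.fract_lt_one x).le⟩
  simpa only [hb.apply_fract _ x] using this

/-- Decay of the kernel of an evolving symbol, locally uniformly in time. -/
lemma exists_osc_bound_time (hb : IsSymb R b) {μ : ℝ → ℂ} (hμ : ContDiff ℝ ∞ μ) (T : ℝ) :
    ∃ C, ∀ t ∈ Icc (-T) T, ∀ z x,
      ‖osc (fun ξ x => Complex.exp (μ ξ * t) * b ξ x) z x‖ ≤ C * lorentz z ^ 2 := by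
  obtain ⟨M, hM⟩ := exists_gaussBdd_slice
    (F := fun p : ℝ × (ℝ × ℝ) => Complex.exp (μ p.1 * (p.2.2 : ℝ)) * b p.1 p.2.1)
    (R := R) (ContDiff.mul
      (Complex.contDiff_exp.comp ((hμ.comp contDiff_fst).mul
        (Complex.ofRealCLM.contDiff.comp contDiff_snd.snd)))
      (hb.smooth.comp (contDiff_fst.prodMk contDiff_snd.fst)))
    (fun ξ e h => by simp [hb.support ξ e.1 h])
    ((isCompact_Icc (a := (0 : ℝ)) (b := 1)).prod (isCompact_Icc (a := -T) (b := T))) 4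
  refine ⟨4 * Real.sqrt (Real.pi / 1) * M, fun t ht z x => ?_⟩
  have := (hM (Int.fract x, t)
    ⟨⟨Int.fract_nonneg x, (Int.fract_lt_one x).le⟩, ht⟩).norm_oscillatory_le one_pos z
  unfold osc lorentz
  simpa only [hb.apply_fract _ x] using this

lemma exists_osc_bound (hb : IsSymb R b) : ∃ C, ∀ z x, ‖osc b z x‖ ≤ C * lorentz z ^ 2 := by
  obtain ⟨C, hC⟩ := hb.exists_osc_bound_time (μ := 0) contDiff_const 0
  refine ⟨C, fun z x => ?_⟩
  simpa using hC 0 (by simp) z x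

lemma continuous_osc (hb : IsSymb R b) : Continuous (fun p : ℝ × ℝ => osc b p.1 p.2) := by
  obtain ⟨M, hM⟩ := hb.exists_gaussBdd 0
  refine continuous_of_dominated (bound := fun ξ => M * Real.exp (-1 * ξ ^ 2)) ?_ ?_ ?_ ?_
  · intro p
    have := hb.smooth.continuous
    have h1 : Continuous fun ξ : ℝ => b ξ p.2 := this.comp (f := fun ξ : ℝ => (ξ, p.2)) (by fun_prop)
    exact (h1.mul (by fun_prop)).aestronglyMeasurable
  · intro p
    refine Filter.Eventually.of_forall fun ξ => ?_
    rw [norm_mul, show Complex.I * ξ * p.1 = ((ξ * p.1 : ℝ) : ℂ) * Complex.I by push_cast; ring,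
      Complex.norm_exp_ofReal_mul_I, mul_one]
    exact (hM p.2).norm_le ξ
  · exact (integrable_exp_neg_mul_sq one_pos).const_mul M
  · refine Filter.Eventually.of_forall fun ξ => ?_
    have := hb.smooth.continuous
    have h1 : Continuous fun p : ℝ × ℝ => b ξ p.2 :=
      this.comp (f := fun p : ℝ × ℝ => (ξ, p.2)) (by fun_prop)
    exact h1.mul (by fun_prop)

lemma osc_periodic (hb : IsSymb R b) (z x : ℝ) (n : ℤ) : osc b z (x + n) = osc b z x := by
  unfold osc
  congr with ξ
  have := (hb.periodic ξ).int_mul n x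
  rw [mul_one] at this
  rw [this]

lemma aestronglyMeasurable_osc (hb : IsSymb R b) (y : ℝ) :
    AEStronglyMeasurable (fun x => osc b (y - x) x) :=
  (hb.continuous_osc.comp (f := fun x : ℝ => (y - x, x)) (by fun_prop)).aestronglyMeasurable

lemma integrable_osc_mul (hb : IsSymb R b) {h : ℝ → ℂ} (hh : IsL1per h) (y : ℝ) :
    Integrable (fun x => osc b (y - x) x * h x) := by
  obtain ⟨C, hC⟩ := hb.exists_osc_bound
  have hC0 : 0 ≤ C := by
    have := (norm_nonneg _).trans (hC 0 0)
    simpa [lorentz] using this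
  refine Integrable.mono' ((hh.integrable_lorentz le_rfl y).const_mul C)
    ((hb.aestronglyMeasurable_osc y).mul hh.aestronglyMeasurable)
    (Filter.Eventually.of_forall fun x => ?_)
  rw [norm_mul, div_one, ← mul_assoc]
  gcongr
  refine (hC _ _).trans ?_
  gcongr
  rw [sq]
  exact mul_le_of_le_one_left (lorentz_pos _).le (lorentz_le_one _)

open FourierTransform in
/-- Poisson summation for symbols supported in the first Brillouin zone. -/
lemma tsum_osc (hb : IsSymb R b) (hR : R ≤ 2 * Real.pi) (u x : ℝ) :
    ∑' n : ℤ, osc b (u - n) x = 2 * Real.pi * b 0 x := by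
  have hpi : (Real.pi : ℂ) ≠ 0 := by exact_mod_cast Real.pi_ne_zero
  -- The scaling by `2π` turns the dual lattice into `ℤ`, and the modulation by `u` translates the
  -- Fourier side, so that `𝓕 F n` is the kernel at `u - n`.
  set F : ℝ → ℂ := fun η => b (2 * Real.pi * η) x * Complex.exp (2 * Real.pi * Complex.I * η * u)
  have hFc : Continuous F := by
    have := hb.smooth.continuous
    have h1 : Continuous fun η : ℝ => b (2 * Real.pi * η) x :=
      this.comp (f := fun η : ℝ => (2 * Real.pi * η, x)) (by fun_prop)
    exact h1.mul (by fun_prop)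
  have hFT : ∀ n : ℤ, 𝓕 F n = (2 * Real.pi : ℂ)⁻¹ * osc b (u - n) x := fun n => by
    rw [Real.fourier_eq']
    have h1 := Measure.integral_comp_mul_left
      (fun ξ : ℝ => b ξ x * Complex.exp (Complex.I * ξ * (u - n : ℝ))) (2 * Real.pi)
    rw [abs_of_pos (by have := Real.pi_pos; positivity)] at h1
    unfold osc
    have h2 : (((2 * Real.pi)⁻¹ : ℝ) : ℂ) = (2 * Real.pi : ℂ)⁻¹ := by push_cast; rfl
    rw [← h2, ← Complex.real_smul, ← h1]
    congr with η
    simp only [F, smul_eq_mul, RCLike.inner_apply, conj_trivial]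
    rw [mul_left_comm, ← Complex.exp_add]
    congr 2
    push_cast; ring
  have hsum : Summable fun n : ℤ => osc b (u - n) x := by
    obtain ⟨C, hC⟩ := hb.exists_osc_bound
    have hW : Summable fun n : ℤ => lorentz (u - n) := by
      have h1 := (tsum_lorentz_le (le_refl (1 : ℝ)) u).trans_lt ENNReal.ofReal_lt_top
      have h2 := ENNReal.summable_toReal h1.ne
      refine h2.congr fun n => ?_
      rw [div_one, ENNReal.toReal_ofReal (lorentz_pos _).le]
    refine Summable.of_norm_bounded (hW.mul_left C) fun n => (hC _ _).trans ?_
    have hC0 : 0 ≤ C := by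
      have := (norm_nonneg _).trans (hC 0 0)
      simpa [lorentz] using this
    gcongr
    rw [sq]
    exact mul_le_of_le_one_left (lorentz_pos _).le (lorentz_le_one _)
  -- The decay rate `2` is arbitrary: `F` vanishes for `|η| ≥ 1`, where `2π|η| ≥ R`.
  have hP := Real.tsum_eq_tsum_fourier_of_rpow_decay_of_summable hFc (b := 2) (by norm_num)
    (by
      refine Filter.EventuallyEq.trans_isBigO (f₂ := fun _ => 0) ?_ (Asymptotics.isBigO_zero _ _)
      filter_upwards [(isCompact_Icc (a := (-1 : ℝ)) (b := 1)).compl_mem_cocompact] with η hη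
      have h1 : 1 ≤ |η| := by
        by_contra hcon
        exact hη (abs_le.1 (not_le.1 hcon).le)
      simp only [F]
      rw [hb.support _ x, zero_mul]
      rw [abs_mul, abs_of_pos (by have := Real.pi_pos; positivity)]
      nlinarith [Real.pi_pos])
    (by simpa only [hFT] using hsum.mul_left _) 0
  -- The nonzero frequencies `2πn` miss the support, also in the borderline case `R = 2π`, since
  -- symbols vanish at `|ξ| = R`.
  have hL : ∑' n : ℤ, F (0 + n) = b 0 x := by
    rw [tsum_eq_single 0]
    · simp [F]
    · intro n hn
      simp only [F]
      rw [hb.support _ x, zero_mul]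
      have h1 : (1 : ℝ) ≤ |((n : ℤ) : ℝ)| := by exact_mod_cast Int.one_le_abs hn
      rw [zero_add, abs_mul, abs_of_pos (by have := Real.pi_pos; positivity)]
      nlinarith [Real.pi_pos]
  rw [hL] at hP
  have hRt : ∀ n : ℤ, 𝓕 F n * fourier n ((0 : ℝ) : UnitAddCircle) =
      (2 * Real.pi : ℂ)⁻¹ * osc b (u - n) x := fun n => by
    rw [hFT]; simp
  simp only [hRt] at hP
  rw [tsum_mul_left] at hP
  rw [hP]
  field_simp

/-- The action of an oscillatory kernel on a periodic function only sees the zero frequency. -/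
lemma integral_osc_mul_periodic (hb : IsSymb R b) (hR : R ≤ 2 * Real.pi) {h : ℝ → ℂ}
    (hh : IsL1per h) (y : ℝ) :
    ∫ x, osc b (y - x) x * h x = 2 * Real.pi * ∫ x in Ioc (0 : ℝ) 1, b 0 x * h x := by
  have hi := hb.integrable_osc_mul hh y
  -- The integral is folded onto one period. Absolute summability allows the sum over cells to be
  -- taken inside, where `h` factors out and Poisson summation applies.
  have h1 := hi.hasSum_intervalIntegral_comp_add_int
  have h2 := hi.norm.hasSum_intervalIntegral_comp_add_int.summable
  simp only [intervalIntegral.integral_of_le zero_le_one] at h1 h2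
  have hint : ∀ n : ℤ, IntegrableOn
      (fun x => osc b (y - (x + n)) (x + n) * h (x + n)) (Ioc (0 : ℝ) 1) := fun n =>
    (hi.comp_add_right (n : ℝ)).integrableOn
  have h3 := hasSum_integral_of_summable_integral_norm hint h2
  rw [h1.unique h3, ← integral_const_mul]
  congr with x
  have : ∀ n : ℤ, osc b (y - (x + n)) (x + n) * h (x + n) = osc b (y - x - n) x * h x := fun n => by
    rw [hb.osc_periodic, hh.add_int, sub_sub]
  simp only [this]
  rw [tsum_mul_right, hb.tsum_osc hR, mul_assoc]

end IsSymb

/-! ### The evolution operator of a symbol -/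

/-- The symbol `e^{μ(ξ) t} b(ξ, x)`. -/
def evo (μ : ℝ → ℂ) (t : ℝ) (b : ℝ → ℝ → ℂ) (ξ x : ℝ) : ℂ := Complex.exp (μ ξ * t) * b ξ x

/-- The operator with kernel `∫ e^{iξ(y - x)} e^{μ(ξ) t} b(ξ, x) dξ`. -/
def oscOp (μ : ℝ → ℂ) (b : ℝ → ℝ → ℂ) (w : ℝ → ℂ) (t y : ℝ) : ℂ :=
  ∫ x, osc (evo μ t b) (y - x) x * w x

/-- Functions that are integrable against every translate of the Lorentzian weight. -/
structure LorentzIntegrable (w : ℝ → ℂ) : Prop where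
  aestronglyMeasurable : AEStronglyMeasurable w
  integrable : ∀ y, Integrable (fun x => lorentz (y - x) * ‖w x‖)

lemma IsL1per.lorentzIntegrable_mul {h v : ℝ → ℂ} (hh : IsL1per h) (hv : Continuous v) {M : ℝ}
    (hM : ∀ x, ‖v x‖ ≤ M) : LorentzIntegrable (fun x => h x * v x) := by
  have hmeas := hh.aestronglyMeasurable.mul hv.aestronglyMeasurable
  refine ⟨hmeas, fun y => ?_⟩
  refine Integrable.mono' ((hh.integrable_lorentz le_rfl y).mul_const M) ?_
    (Filter.Eventually.of_forall fun x => ?_)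
  · exact ((continuous_lorentz.comp (by fun_prop)).aestronglyMeasurable).mul hmeas.norm
  · rw [Real.norm_of_nonneg (mul_nonneg (lorentz_pos _).le (norm_nonneg _)), norm_mul, div_one,
      ← mul_assoc]
    gcongr
    · exact mul_nonneg (lorentz_pos _).le (norm_nonneg _)
    · exact hM x

/-- The real-linear map `ℝ² → ℂ` with given partial derivatives. -/
def partialsL : (ℂ × ℂ) →L[ℝ] (ℝ × ℝ →L[ℝ] ℂ) :=
  (ContinuousLinearMap.smulRightL ℝ (ℝ × ℝ) ℂ (ContinuousLinearMap.fst ℝ ℝ ℝ)).coprod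
    (ContinuousLinearMap.smulRightL ℝ (ℝ × ℝ) ℂ (ContinuousLinearMap.snd ℝ ℝ ℝ))

@[simp] lemma partialsL_apply (c : ℂ × ℂ) (p : ℝ × ℝ) :
    partialsL c p = p.1 * c.1 + p.2 * c.2 := by
  simp [partialsL]

lemma norm_partialsL_le (c : ℂ × ℂ) : ‖partialsL c‖ ≤ ‖c.1‖ + ‖c.2‖ := by
  refine ContinuousLinearMap.opNorm_le_bound _ (by positivity) fun p => ?_
  rw [partialsL_apply, add_mul]
  refine (norm_add_le _ _).trans (add_le_add ?_ ?_)
  · rw [norm_mul, Complex.norm_real, mul_comm]; gcongr; exact norm_fst_le p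
  · rw [norm_mul, Complex.norm_real, mul_comm]; gcongr; exact norm_snd_le p

lemma integral_partialsL {f g : ℝ → ℂ} (hf : Integrable f) (hg : Integrable g) :
    ∫ x, partialsL (f x, g x) = partialsL (∫ x, f x, ∫ x, g x) := by
  rw [partialsL.integral_comp_comm (hf.prodMk hg)]
  congr 1
  exact integral_pair hf hg

namespace IsSymb

variable {R : ℝ} {b : ℝ → ℝ → ℂ} {μ : ℝ → ℂ}

lemma evo (hb : IsSymb R b) (hμ : ContDiff ℝ ∞ μ) (t : ℝ) : IsSymb R (evo μ t b) :=
  hb.mul_left (Complex.contDiff_exp.comp (hμ.mul contDiff_const))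

lemma mul_I (hb : IsSymb R b) : IsSymb R (fun ξ x => Complex.I * ξ * b ξ x) :=
  hb.mul_left (contDiff_const.mul Complex.ofRealCLM.contDiff)

lemma integrable_integrand (hb : IsSymb R b) (z x : ℝ) :
    Integrable (fun ξ : ℝ => b ξ x * Complex.exp (Complex.I * ξ * z)) := by
  obtain ⟨M, hM⟩ := hb.exists_gaussBdd 0
  refine (((hM x).integrable one_pos).mul_bdd (c := 1) ?_ ?_)
  · exact (by fun_prop : Continuous fun ξ : ℝ => Complex.exp (Complex.I * ξ * z)).aestronglyMeasurable
  · refine Filter.Eventually.of_forall fun ξ => ?_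
    rw [show Complex.I * ξ * z = ((ξ * z : ℝ) : ℂ) * Complex.I by push_cast; ring,
      Complex.norm_exp_ofReal_mul_I]

/-- The kernel is differentiable in time and space. -/
lemma hasFDerivAt_osc (hb : IsSymb R b) (hμ : ContDiff ℝ ∞ μ) (x : ℝ) (p : ℝ × ℝ) :
    HasFDerivAt (fun p : ℝ × ℝ => osc (WaveTrain.evo μ p.1 b) (p.2 - x) x)
      (partialsL (osc (WaveTrain.evo μ p.1 fun ξ x => μ ξ * b ξ x) (p.2 - x) x,
        osc (WaveTrain.evo μ p.1 fun ξ x => Complex.I * ξ * b ξ x) (p.2 - x) x)) p := by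
  have hbc : Continuous fun ξ => b ξ x :=
    hb.smooth.continuous.comp (f := fun ξ : ℝ => (ξ, x)) (by fun_prop)
  have hμc := hμ.continuous
  have i1 := ((hb.mul_left hμ).evo hμ p.1).integrable_integrand (p.2 - x) x
  have i2 := (hb.mul_I.evo hμ p.1).integrable_integrand (p.2 - x) x
  unfold osc
  rw [← integral_partialsL i1 i2]
  -- On the unit ball around `p` the time is at most `|p.1| + 1` in modulus. Compact support in `ξ`
  -- makes the bound integrable without any sign condition on `μ`.
  set bound : ℝ → ℝ := fun ξ =>
    (‖μ ξ‖ + |ξ|) * (Real.exp (‖μ ξ‖ * (|p.1| + 1)) * ‖b ξ x‖)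
  refine hasFDerivAt_integral_of_dominated_of_fderiv_le (s := Metric.ball p 1) (bound := bound)
    (F' := fun (p : ℝ × ℝ) (ξ : ℝ) => partialsL
      (WaveTrain.evo μ p.1 (fun ξ x => μ ξ * b ξ x) ξ x *
        Complex.exp (Complex.I * ξ * (p.2 - x : ℝ)),
      WaveTrain.evo μ p.1 (fun ξ x => Complex.I * ξ * b ξ x) ξ x *
        Complex.exp (Complex.I * ξ * (p.2 - x : ℝ))))
    (Metric.ball_mem_nhds p one_pos) ?_ ?_ ?_ ?_ ?_ ?_
  · exact Filter.Eventually.of_forall fun q =>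
      ((hb.evo hμ q.1).integrable_integrand (q.2 - x) x).1
  · exact (hb.evo hμ p.1).integrable_integrand (p.2 - x) x
  · exact partialsL.continuous.comp_aestronglyMeasurable (i1.1.prodMk i2.1)
  · refine Filter.Eventually.of_forall fun ξ q hq => (norm_partialsL_le _).trans ?_
    have he : ‖Complex.exp (Complex.I * ξ * (q.2 - x : ℝ))‖ = 1 := by
      rw [show Complex.I * ξ * (q.2 - x : ℝ) = ((ξ * (q.2 - x) : ℝ) : ℂ) * Complex.I by
        push_cast; ring, Complex.norm_exp_ofReal_mul_I]
    have hq1 : |q.1| ≤ |p.1| + 1 := by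
      have h1 : |q.1 - p.1| ≤ ‖q - p‖ := norm_fst_le (q - p)
      have h2 : ‖q - p‖ < 1 := by rwa [← dist_eq_norm]
      have := abs_sub_abs_le_abs_sub q.1 p.1
      linarith
    have hexp : ‖Complex.exp (μ ξ * q.1)‖ ≤ Real.exp (‖μ ξ‖ * (|p.1| + 1)) := by
      rw [Complex.norm_exp, Real.exp_le_exp]
      refine (Complex.re_le_norm _).trans ?_
      rw [norm_mul, Complex.norm_real]
      gcongr
      exact hq1
    simp only [WaveTrain.evo, norm_mul, he, mul_one, Complex.norm_I, one_mul, Complex.norm_real,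
      Real.norm_eq_abs, bound]
    calc _ = (‖μ ξ‖ + |ξ|) * (‖Complex.exp (μ ξ * q.1)‖ * ‖b ξ x‖) := by ring
      _ ≤ _ := by gcongr
  · have hcb : Continuous bound := by fun_prop
    refine hcb.integrable_of_hasCompactSupport (HasCompactSupport.intro (isCompact_Icc (a := -R) (b := R))
      fun ξ hξ => ?_)
    have : R ≤ |ξ| := by
      by_contra hcon
      exact hξ (abs_le.1 (not_le.1 hcon).le)
    simp [bound, hb.support ξ x this]
  · refine Filter.Eventually.of_forall fun ξ q _ => ?_
    have h1 : HasFDerivAt (fun q : ℝ × ℝ => (q.1 : ℂ))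
        (Complex.ofRealCLM.comp (ContinuousLinearMap.fst ℝ ℝ ℝ)) q :=
      (Complex.ofRealCLM.comp (ContinuousLinearMap.fst ℝ ℝ ℝ)).hasFDerivAt
    have h2 : HasFDerivAt (fun q : ℝ × ℝ => ((q.2 - x : ℝ) : ℂ))
        (Complex.ofRealCLM.comp (ContinuousLinearMap.snd ℝ ℝ ℝ)) q := by
      have := (Complex.ofRealCLM.comp (ContinuousLinearMap.snd ℝ ℝ ℝ)).hasFDerivAt (x := q)
      simpa using this.sub_const (x : ℂ)
    have h3 := (((h1.const_mul (μ ξ)).cexp).mul_const (b ξ x)).mul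
      ((h2.const_mul (Complex.I * ξ)).cexp)
    refine h3.congr_fderiv ?_
    ext <;> simp [WaveTrain.evo] <;> ring

lemma lorentz_le_three_mul {z z' : ℝ} (h : |z - z'| ≤ 1) : lorentz z' ≤ 3 * lorentz z := by
  unfold lorentz
  rw [← div_eq_mul_inv, le_div_iff₀ (by positivity), inv_mul_le_iff₀ (by positivity)]
  have h1 : (z - z') ^ 2 ≤ 1 := by rw [← sq_abs]; nlinarith [abs_nonneg (z - z')]
  nlinarith [sq_nonneg (z - 2 * z')]

/-- The majorant, uniform over a neighbourhood of `p`, that differentiation under the integral over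
`x` requires. -/
lemma exists_osc_bound_ball (hb : IsSymb R b) (hμ : ContDiff ℝ ∞ μ) (p : ℝ × ℝ) :
    ∃ C, 0 ≤ C ∧ ∀ q ∈ Metric.ball p 1, ∀ x,
      ‖osc (WaveTrain.evo μ q.1 b) (q.2 - x) x‖ ≤ C * lorentz (p.2 - x) := by
  obtain ⟨C, hC⟩ := hb.exists_osc_bound_time hμ (|p.1| + 1)
  refine ⟨3 * |C|, by positivity, fun q hq x => ?_⟩
  have h2 : ‖q - p‖ < 1 := by rwa [← dist_eq_norm]
  have h1 : |q.1 - p.1| ≤ ‖q - p‖ := norm_fst_le (q - p)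
  have h1' : |q.2 - p.2| ≤ ‖q - p‖ := norm_snd_le (q - p)
  have hq1 : |q.1| ≤ |p.1| + 1 := by
    have := abs_sub_abs_le_abs_sub q.1 p.1
    linarith
  refine (hC q.1 (abs_le.1 hq1) (q.2 - x) x).trans ?_
  have h3 : lorentz (q.2 - x) ≤ 3 * lorentz (p.2 - x) :=
    lorentz_le_three_mul (by rw [sub_sub_sub_cancel_right, abs_sub_comm]; linarith)
  calc C * lorentz (q.2 - x) ^ 2 ≤ |C| * lorentz (q.2 - x) ^ 2 := by
        gcongr; exact le_abs_self _
    _ ≤ |C| * lorentz (q.2 - x) := by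
        gcongr
        rw [sq]
        exact mul_le_of_le_one_left (lorentz_pos _).le (lorentz_le_one _)
    _ ≤ |C| * (3 * lorentz (p.2 - x)) := by gcongr
    _ = _ := by ring

lemma integrable_osc_evo (hb : IsSymb R b) (hμ : ContDiff ℝ ∞ μ) {w : ℝ → ℂ}
    (hw : LorentzIntegrable w) (p : ℝ × ℝ) :
    Integrable (fun x => osc (WaveTrain.evo μ p.1 b) (p.2 - x) x * w x) := by
  obtain ⟨C, hC0, hC⟩ := hb.exists_osc_bound_ball hμ p
  refine Integrable.mono' ((hw.integrable p.2).const_mul C)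
    (((hb.evo hμ p.1).aestronglyMeasurable_osc p.2).mul hw.aestronglyMeasurable)
    (Filter.Eventually.of_forall fun x => ?_)
  rw [norm_mul, ← mul_assoc]
  gcongr
  exact hC p (Metric.mem_ball_self one_pos) x

/-- Differentiation of the evolution operator in time and space. -/
lemma hasFDerivAt_oscOp (hb : IsSymb R b) (hμ : ContDiff ℝ ∞ μ) {w : ℝ → ℂ}
    (hw : LorentzIntegrable w) (p : ℝ × ℝ) :
    HasFDerivAt (fun p : ℝ × ℝ => oscOp μ b w p.1 p.2)
      (partialsL (oscOp μ (fun ξ x => μ ξ * b ξ x) w p.1 p.2,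
        oscOp μ (fun ξ x => Complex.I * ξ * b ξ x) w p.1 p.2)) p := by
  have hb1 := hb.mul_left hμ
  have hb2 := hb.mul_I
  have i1 := hb1.integrable_osc_evo hμ hw p
  have i2 := hb2.integrable_osc_evo hμ hw p
  unfold oscOp
  rw [← integral_partialsL i1 i2]
  obtain ⟨C1, hC10, hC1⟩ := hb1.exists_osc_bound_ball hμ p
  obtain ⟨C2, hC20, hC2⟩ := hb2.exists_osc_bound_ball hμ p
  refine hasFDerivAt_integral_of_dominated_of_fderiv_le (s := Metric.ball p 1)
    (bound := fun x => (C1 + C2) * (lorentz (p.2 - x) * ‖w x‖))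
    (F' := fun (p : ℝ × ℝ) (x : ℝ) => partialsL
      (osc (WaveTrain.evo μ p.1 fun ξ x => μ ξ * b ξ x) (p.2 - x) x * w x,
        osc (WaveTrain.evo μ p.1 fun ξ x => Complex.I * ξ * b ξ x) (p.2 - x) x * w x))
    (Metric.ball_mem_nhds p one_pos) ?_ ?_ ?_ ?_ ?_ ?_
  · exact Filter.Eventually.of_forall fun q => (hb.integrable_osc_evo hμ hw q).1
  · exact hb.integrable_osc_evo hμ hw p
  · exact partialsL.continuous.comp_aestronglyMeasurable (i1.1.prodMk i2.1)
  · refine Filter.Eventually.of_forall fun x q hq => (norm_partialsL_le _).trans ?_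
    rw [norm_mul, norm_mul, ← add_mul, ← mul_assoc]
    gcongr
    rw [add_mul]
    exact add_le_add (hC1 q hq x) (hC2 q hq x)
  · exact (hw.integrable p.2).const_mul _
  · refine Filter.Eventually.of_forall fun x q _ => ?_
    refine ((hb.hasFDerivAt_osc hμ x q).mul_const (w x)).congr_fderiv ?_
    ext <;> simp <;> ring

/-- Both partial derivatives are operators of the same kind, with symbols `μ b` and `iξ b`, so the
induction runs over all symbols at once. -/
lemma contDiff_oscOp (hb : IsSymb R b) (hμ : ContDiff ℝ ∞ μ) {w : ℝ → ℂ}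
    (hw : LorentzIntegrable w) : ContDiff ℝ ∞ (fun p : ℝ × ℝ => oscOp μ b w p.1 p.2) := by
  refine contDiff_infty.2 fun k => ?_
  induction k generalizing b with
  | zero =>
    exact contDiff_zero.2 (continuous_iff_continuousAt.2 fun p =>
      (hb.hasFDerivAt_oscOp hμ hw p).continuousAt)
  | succ k ih =>
    push_cast
    refine contDiff_succ_iff_hasFDerivAt.2 ⟨_, ?_, fun p => hb.hasFDerivAt_oscOp hμ hw p⟩
    exact partialsL.contDiff.comp ((ih (hb.mul_left hμ)).prodMk (ih hb.mul_I))

end IsSymb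

/-! ### Derivatives in a moving frame -/

lemma dζ_moving (a : ℝ) (G : ℝ → ℝ → ℂ) :
    dζ (fun t ζ => G t (ζ + a * t)) = fun t ζ => dζ G t (ζ + a * t) := by
  funext t ζ
  simp only [dζ]
  rw [deriv_comp_add_const]

/-- Differentiating in time along the moving frame means differentiating in the direction `(1, a)`;
subtracting `a` times the spatial derivative leaves the direction `(1, 0)`. -/
lemma dtr_moving (a : ℝ) {G : ℝ → ℝ → ℂ} (hG : Differentiable ℝ (fun p : ℝ × ℝ => G p.1 p.2)) :
    dtr a (fun t ζ => G t (ζ + a * t)) = fun t ζ => deriv (fun s => G s (ζ + a * t)) t := by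
  funext t ζ
  simp only [dtr]
  rw [deriv_comp_add_const (f := G t)]
  set L := fderiv ℝ (fun p : ℝ × ℝ => G p.1 p.2) (t, ζ + a * t) with hL
  have h0 := (hG (t, ζ + a * t)).hasFDerivAt
  have h1 : HasDerivAt (fun s => G s (ζ + a * s)) (L (1, a)) t := by
    have hc : HasDerivAt (fun s : ℝ => (s, ζ + a * s)) (1, a) t :=
      (hasDerivAt_id t).prodMk (by simpa using ((hasDerivAt_id t).const_mul a).const_add ζ)
    exact h0.comp_hasDerivAt t hc
  have h2 : HasDerivAt (fun s => G s (ζ + a * t)) (L (1, 0)) t := by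
    have hc : HasDerivAt (fun s : ℝ => (s, ζ + a * t)) (1, 0) t :=
      (hasDerivAt_id t).prodMk (hasDerivAt_const _ _)
    exact h0.comp_hasDerivAt t hc
  have h3 : HasDerivAt (fun z => G t z) (L (0, 1)) (ζ + a * t) := by
    have hc : HasDerivAt (fun z : ℝ => (t, z)) (0, 1) (ζ + a * t) :=
      (hasDerivAt_const _ _).prodMk (hasDerivAt_id _)
    exact h0.comp_hasDerivAt (ζ + a * t) hc
  rw [h1.deriv, h2.deriv, h3.deriv]
  have : ((1 : ℝ), a) = (1, 0) + a • ((0 : ℝ), (1 : ℝ)) := by simp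
  rw [this, map_add, map_smul]
  simp

lemma iterate_dtr_moving (a : ℝ) (m : ℕ) {G : ℝ → ℝ → ℂ}
    (hG : ContDiff ℝ ∞ (fun p : ℝ × ℝ => G p.1 p.2)) :
    (dtr a)^[m] (fun t ζ => G t (ζ + a * t)) =
      fun t ζ => iteratedDeriv m (fun s => G s (ζ + a * t)) t := by
  induction m generalizing G with
  | zero => simp
  | succ m ih =>
    rw [Function.iterate_succ_apply, dtr_moving a (hG.differentiable (by simp))]
    have hG' : ContDiff ℝ ∞ (fun p : ℝ × ℝ => deriv (fun s => G s p.2) p.1) := by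
      have : (fun p : ℝ × ℝ => deriv (fun s => G s p.2) p.1) =
          fun p => fderiv ℝ (fun p : ℝ × ℝ => G p.1 p.2) p (1, 0) := by
        funext p
        have h0 := (hG.differentiable (by simp) p).hasFDerivAt
        have hc : HasDerivAt (fun s : ℝ => (s, p.2)) (1, 0) p.1 :=
          (hasDerivAt_id _).prodMk (hasDerivAt_const _ _)
        exact (h0.comp_hasDerivAt p.1 hc).deriv
      rw [this]
      exact (hG.fderiv_right (m := ∞) (by simp)).clm_apply contDiff_const
    rw [ih (G := fun t y => deriv (fun s => G s y) t) hG']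
    funext t ζ
    rw [iteratedDeriv_succ']

lemma iteratedDeriv_ofReal_comp {χ : ℝ → ℝ} (hχ : ContDiff ℝ ∞ χ) (m : ℕ) :
    iteratedDeriv m (fun t => (χ t : ℂ)) = fun t => ((iteratedDeriv m χ t : ℝ) : ℂ) := by
  induction m generalizing χ with
  | zero => simp
  | succ m ih =>
    have h1 : deriv (fun t => (χ t : ℂ)) = fun t => ((deriv χ t : ℝ) : ℂ) := by
      funext t
      exact (hχ.differentiable (by simp) t).hasDerivAt.ofReal_comp.deriv
    rw [iteratedDeriv_succ', h1, ih (contDiff_infty_iff_deriv.1 hχ).2, iteratedDeriv_succ']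

/-! ### Derivatives of the cut-off evolution as Fourier multipliers -/

section SumOp

variable {ι : Type*} [Fintype ι] {R : ℝ} {b : ι → ℝ → ℝ → ℂ} {μ : ℝ → ℂ} {w : ι → ℝ → ℂ}

/-- Finite sums of evolution operators, with a common Fourier multiplier `B`. -/
def sumOp (μ : ℝ → ℂ) (b : ι → ℝ → ℝ → ℂ) (w : ι → ℝ → ℂ) (B : ℝ → ℂ) (t y : ℝ) : ℂ :=
  ∑ i, oscOp μ (fun ξ x => B ξ * b i ξ x) (w i) t y

lemma contDiff_sumOp (hb : ∀ i, IsSymb R (b i)) (hμ : ContDiff ℝ ∞ μ)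
    (hw : ∀ i, LorentzIntegrable (w i)) {B : ℝ → ℂ} (hB : ContDiff ℝ ∞ B) :
    ContDiff ℝ ∞ (fun p : ℝ × ℝ => sumOp μ b w B p.1 p.2) :=
  ContDiff.sum fun i _ => ((hb i).mul_left hB).contDiff_oscOp hμ (hw i)

lemma hasDerivAt_sumOp_time (hb : ∀ i, IsSymb R (b i)) (hμ : ContDiff ℝ ∞ μ)
    (hw : ∀ i, LorentzIntegrable (w i)) {B : ℝ → ℂ} (hB : ContDiff ℝ ∞ B) (t y : ℝ) :
    HasDerivAt (fun s => sumOp μ b w B s y) (sumOp μ b w (fun ξ => μ ξ * B ξ) t y) t := by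
  refine HasDerivAt.fun_sum fun i _ => ?_
  have h := (((hb i).mul_left hB).hasFDerivAt_oscOp hμ (hw i) (t, y)).comp_hasDerivAt t
    ((hasDerivAt_id t).prodMk (hasDerivAt_const t y))
  refine (h.congr_deriv ?_)
  simp [mul_assoc]

lemma hasDerivAt_sumOp_space (hb : ∀ i, IsSymb R (b i)) (hμ : ContDiff ℝ ∞ μ)
    (hw : ∀ i, LorentzIntegrable (w i)) {B : ℝ → ℂ} (hB : ContDiff ℝ ∞ B) (t y : ℝ) :
    HasDerivAt (fun z => sumOp μ b w B t z) (sumOp μ b w (fun ξ => Complex.I * ξ * B ξ) t y) y := by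
  refine HasDerivAt.fun_sum fun i _ => ?_
  have h := (((hb i).mul_left hB).hasFDerivAt_oscOp hμ (hw i) (t, y)).comp_hasDerivAt y
    ((hasDerivAt_const y t).prodMk (hasDerivAt_id y))
  refine (h.congr_deriv ?_)
  simp [mul_assoc]

lemma iteratedDeriv_sumOp (hb : ∀ i, IsSymb R (b i)) (hμ : ContDiff ℝ ∞ μ)
    (hw : ∀ i, LorentzIntegrable (w i)) {B : ℝ → ℂ} (hB : ContDiff ℝ ∞ B) (j : ℕ) (y : ℝ) :
    iteratedDeriv j (fun s => sumOp μ b w B s y) =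
      fun t => sumOp μ b w (fun ξ => μ ξ ^ j * B ξ) t y := by
  induction j generalizing B with
  | zero => simp
  | succ j ih =>
    have h1 : deriv (fun s => sumOp μ b w B s y) = fun t => sumOp μ b w (fun ξ => μ ξ * B ξ) t y :=
      funext fun t => (hasDerivAt_sumOp_time hb hμ hw hB t y).deriv
    rw [iteratedDeriv_succ', h1, ih (hμ.mul hB)]
    simp only [pow_succ, mul_assoc]

lemma iterate_dζ_sumOp (hb : ∀ i, IsSymb R (b i)) (hμ : ContDiff ℝ ∞ μ)
    (hw : ∀ i, LorentzIntegrable (w i)) {B : ℝ → ℂ} (hB : ContDiff ℝ ∞ B) (l : ℕ) (a : ℝ)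
    (χ : ℝ → ℂ) :
    dζ^[l] (fun t ζ => χ t * sumOp μ b w B t (ζ + a * t)) =
      fun t ζ => χ t * sumOp μ b w (fun ξ => (Complex.I * ξ) ^ l * B ξ) t (ζ + a * t) := by
  induction l generalizing B with
  | zero => simp
  | succ l ih =>
    rw [Function.iterate_succ_apply, dζ_moving a (fun t y => χ t * sumOp μ b w B t y)]
    have h1 : dζ (fun t y => χ t * sumOp μ b w B t y) =
        fun t y => χ t * sumOp μ b w (fun ξ => Complex.I * ξ * B ξ) t y := by
      funext t y
      exact ((hasDerivAt_sumOp_space hb hμ hw hB t y).const_mul (χ t)).deriv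
    have hB' : ContDiff ℝ ∞ (fun ξ : ℝ => Complex.I * ξ * B ξ) :=
      (contDiff_const.mul Complex.ofRealCLM.contDiff).mul hB
    rw [h1, ih hB']
    simp only [pow_succ, mul_assoc]

/-- Leibniz formula for the derivatives `(∂ₜ - a ∂_ζ)^m ∂_ζ^l` of the cut-off evolution. -/
lemma iterate_dtr_dζ_sumOp (hb : ∀ i, IsSymb R (b i)) (hμ : ContDiff ℝ ∞ μ)
    (hw : ∀ i, LorentzIntegrable (w i)) {χ : ℝ → ℝ} (hχ : ContDiff ℝ ∞ χ) (l m : ℕ) (a : ℝ)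
    (t ζ : ℝ) :
    (dtr a)^[m] (dζ^[l] (fun t ζ => (χ t : ℂ) * sumOp μ b w (fun _ => 1) t (ζ + a * t))) t ζ =
      ∑ j ∈ Finset.range (m + 1), (m.choose j : ℂ) * ((iteratedDeriv j χ t : ℝ) : ℂ) *
        sumOp μ b w (fun ξ => μ ξ ^ (m - j) * (Complex.I * ξ) ^ l) t (ζ + a * t) := by
  have hl : ContDiff ℝ ∞ (fun ξ : ℝ => (Complex.I * (ξ : ℂ)) ^ l) :=
    (contDiff_const.mul Complex.ofRealCLM.contDiff).pow l
  have hχc : ContDiff ℝ ∞ (fun t => (χ t : ℂ)) := Complex.ofRealCLM.contDiff.comp hχ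
  have hV := contDiff_sumOp hb hμ hw hl
  have hG : ContDiff ℝ ∞ (fun p : ℝ × ℝ =>
      (χ p.1 : ℂ) * sumOp μ b w (fun ξ => (Complex.I * ξ) ^ l) p.1 p.2) :=
    (hχc.comp contDiff_fst).mul hV
  have e₁ := iterate_dζ_sumOp hb hμ hw contDiff_const l a (fun t => (χ t : ℂ)) (B := fun _ => 1)
  simp only [mul_one] at e₁
  have e₂ := iterate_dtr_moving a m hG (G := fun t y => (χ t : ℂ) *
    sumOp μ b w (fun ξ => (Complex.I * ξ) ^ l) t y)
  have hs : ContDiff ℝ ∞ (fun s => sumOp μ b w (fun ξ => (Complex.I * ξ) ^ l) s (ζ + a * t)) :=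
    ContDiff.comp (f := fun s : ℝ => (s, ζ + a * t)) hV (contDiff_id.prodMk contDiff_const)
  rw [e₁, e₂]
  have hm : (m : WithTop ℕ∞) ≤ ∞ := by exact_mod_cast le_top
  have e₃ := iteratedDeriv_fun_mul (n := m) (x := t) (hχc.of_le hm).contDiffAt
    (hs.of_le hm).contDiffAt
  simp only [e₃, iteratedDeriv_ofReal_comp hχ, iteratedDeriv_sumOp hb hμ hw hl]

end SumOp

/-! ### Functions in `C_ub^1` -/

namespace IsCub

variable {v : ℝ → ℝ}

lemma contDiff_one (hv : IsCub 1 v) : ContDiff ℝ 1 v := by simpa using hv.1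

lemma differentiable (hv : IsCub 1 v) : Differentiable ℝ v :=
  hv.contDiff_one.differentiable (by simp)

lemma continuous_deriv (hv : IsCub 1 v) : Continuous (deriv v) :=
  hv.contDiff_one.continuous_deriv (by simp)

lemma continuous_ofReal (hv : IsCub 1 v) : Continuous (fun x => (v x : ℂ)) :=
  Complex.continuous_ofReal.comp hv.differentiable.continuous

lemma exists_bound (hv : IsCub 1 v) : ∃ M, ∀ x, ‖(v x : ℂ)‖ ≤ M := by
  obtain ⟨M, hM⟩ := (hv.2 0 (Nat.zero_le _)).2
  exact ⟨M, fun x => by simpa using hM x⟩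

lemma norm_deriv_le (hv : IsCub 1 v) (x : ℝ) : ‖deriv v x‖ ≤ supNorm (deriv v) := by
  obtain ⟨M, hM⟩ := (hv.2 1 le_rfl).2
  rw [iteratedDeriv_one] at hM
  exact le_ciSup (f := fun x => ‖deriv v x‖) ⟨M, by rintro _ ⟨x, rfl⟩; exact hM x⟩ x

lemma supNorm_nonneg (hv : IsCub 1 v) : 0 ≤ supNorm (deriv v) :=
  (norm_nonneg _).trans (hv.norm_deriv_le 0)

lemma norm_sub_le (hv : IsCub 1 v) (x y : ℝ) :
    ‖(v x : ℂ) - v y‖ ≤ supNorm (deriv v) * |y - x| := by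
  have := Convex.norm_image_sub_le_of_norm_deriv_le (s := univ) (x := y) (y := x)
    (fun x _ => hv.differentiable x) (fun x _ => hv.norm_deriv_le x) convex_univ
    (mem_univ _) (mem_univ _)
  rw [← Complex.ofReal_sub, Complex.norm_real, abs_sub_comm]
  exact this

end IsCub

lemma IsL1per.one : IsL1per (fun _ => 1) := .of_continuous continuous_const fun _ => rfl

/-! ### Kernel estimates -/

/-- A kernel on the spatial scale `s` acting on a function with linear growth. -/
lemma IsL1per.norm_integral_kernel_le {h : ℝ → ℂ} (hh : IsL1per h) {k : ℝ → ℝ → ℂ} {A L s y : ℝ}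
    {u : ℝ → ℂ} (hs : 1 ≤ s) (hk : ∀ z x, ‖k z x‖ ≤ A * lorentz (z / s) ^ 2)
    (hu : ∀ x, ‖u x‖ ≤ L * |y - x|) :
    ‖∫ x, k (y - x) x * (h x * u x)‖
      ≤ A * L * s ^ 2 * (3 * Real.pi * ∫ x in Ioc (0 : ℝ) 1, ‖h x‖) := by
  have hs0 : 0 < s := by linarith
  have hA : 0 ≤ A := by
    have := (norm_nonneg _).trans (hk 0 0)
    simpa [lorentz] using this
  have hL : 0 ≤ L := by
    have := (norm_nonneg _).trans (hu (y - 1))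
    simpa using this
  calc _ ≤ ∫ x, A * L * s * (lorentz ((y - x) / s) * ‖h x‖) := by
        refine norm_integral_le_of_norm_le ((hh.integrable_lorentz hs y).const_mul _)
          (Filter.Eventually.of_forall fun x => ?_)
        rw [norm_mul, norm_mul]
        -- One factor `s` arises here from the linear growth of `u`, the second one from the
        -- integral of the weight.
        have h1 := abs_mul_lorentz_sq_le ((y - x) / s)
        rw [abs_div, abs_of_pos hs0, div_mul_eq_mul_div, div_le_iff₀ hs0] at h1
        calc ‖k (y - x) x‖ * (‖h x‖ * ‖u x‖)
            ≤ A * lorentz ((y - x) / s) ^ 2 * (‖h x‖ * (L * |y - x|)) := by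
              gcongr
              · exact hk _ _
              · exact hu x
          _ = A * L * ‖h x‖ * (|y - x| * lorentz ((y - x) / s) ^ 2) := by ring
          _ ≤ A * L * ‖h x‖ * (lorentz ((y - x) / s) * s) := by gcongr
          _ = _ := by ring
    _ ≤ A * L * s * (3 * Real.pi * s * ∫ x in Ioc (0 : ℝ) 1, ‖h x‖) := by
        rw [integral_const_mul]
        gcongr
        exact hh.integral_lorentz_le hs y
    _ = _ := by ring

/-- A kernel on the spatial scale `s` acting on a bounded function. -/
lemma IsL1per.norm_integral_kernel_le_of_bdd {h : ℝ → ℂ} (hh : IsL1per h) {k : ℝ → ℝ → ℂ}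
    {A L s y : ℝ} {u : ℝ → ℂ} (hs : 1 ≤ s) (hk : ∀ z x, ‖k z x‖ ≤ A * lorentz (z / s) ^ 2)
    (hu : ∀ x, ‖u x‖ ≤ L) :
    ‖∫ x, k (y - x) x * (h x * u x)‖
      ≤ A * L * s * (3 * Real.pi * ∫ x in Ioc (0 : ℝ) 1, ‖h x‖) := by
  have hA : 0 ≤ A := by
    have := (norm_nonneg _).trans (hk 0 0)
    simpa [lorentz] using this
  have hL : 0 ≤ L := (norm_nonneg _).trans (hu 0)
  calc _ ≤ ∫ x, A * L * (lorentz ((y - x) / s) * ‖h x‖) := by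
        refine norm_integral_le_of_norm_le ((hh.integrable_lorentz hs y).const_mul _)
          (Filter.Eventually.of_forall fun x => ?_)
        rw [norm_mul, norm_mul]
        have hlz := lorentz_pos ((y - x) / s)
        calc ‖k (y - x) x‖ * (‖h x‖ * ‖u x‖)
            ≤ A * lorentz ((y - x) / s) ^ 2 * (‖h x‖ * L) := by
              gcongr
              · exact hk _ _
              · exact hu x
          _ ≤ A * lorentz ((y - x) / s) * (‖h x‖ * L) := by
              gcongr
              rw [sq]
              exact mul_le_of_le_one_left hlz.le (lorentz_le_one _)
          _ = _ := by ring
    _ ≤ A * L * (3 * Real.pi * s * ∫ x in Ioc (0 : ℝ) 1, ‖h x‖) := by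
        rw [integral_const_mul]
        gcongr
        exact hh.integral_lorentz_le hs y
    _ = _ := by ring

/-! ### Estimates for diffusive dispersion relations -/

/-- The standing assumptions on the reduced dispersion relation `μ(ξ) = ξ² ν(ξ)`. -/
structure IsDiffusive (θ N : ℝ) (ν : ℝ → ℂ) : Prop where
  pos : 0 < θ
  smooth : ContDiff ℝ ∞ ν
  bdd : GaussBdd 4 0 N ν
  re_le : ∀ ξ, (ν ξ).re ≤ -θ

/-- The reduced dispersion relation `ξ² ν(ξ)`. -/
def disp (ν : ℝ → ℂ) (ξ : ℝ) : ℂ := (ξ : ℂ) ^ 2 * ν ξ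

namespace IsDiffusive

variable {θ N R : ℝ} {ν : ℝ → ℂ} {b : ℝ → ℝ → ℂ}

lemma smooth_disp (hν : IsDiffusive θ N ν) : ContDiff ℝ ∞ (disp ν) :=
  (Complex.ofRealCLM.contDiff.pow 2).mul hν.smooth

/-- The kernel bound with the amplitude given in the original frequency and its size measured after
rescaling: any smallness of `B (x / s)` passes to the kernel. -/
lemma exists_amplitude_bound (hν : IsDiffusive θ N ν) : ∃ C, 0 ≤ C ∧ ∀ (B : ℝ → ℂ) (M s z : ℝ),
    1 ≤ s → GaussBdd 4 (-(θ / 8)) M (fun x => B (x / s)) →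
    ‖∫ ξ : ℝ, Complex.exp (disp ν ξ * (s ^ 2 : ℝ)) * B ξ * Complex.exp (Complex.I * ξ * z)‖
      ≤ C * M * s⁻¹ * lorentz (z / s) ^ 2 := by
  obtain ⟨C, hC0, hC⟩ := GaussBdd.exists_kernel_bound (N := N) hν.pos
  refine ⟨C, hC0, fun B M s z hs hB => ?_⟩
  have := hC ν _ M s z hs hν.bdd hν.re_le hB
  unfold lorentz
  refine le_trans (le_of_eq ?_) this
  congr 2 with ξ
  have hs0 : s ≠ 0 := by linarith
  rw [mul_div_cancel_left₀ ξ hs0, disp]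
  ring

/-- With `ξ = x / s`, the factor `ξ ^ p` contributes `s⁻¹ ^ p`; the remaining `s⁻¹` is the Jacobian.
-/
lemma exists_osc_bound_pow (hν : IsDiffusive θ N ν) (hb : IsSymb R b) (p : ℕ) :
    ∃ C, 0 ≤ C ∧ ∀ s z x, 1 ≤ s → ‖osc (evo (disp ν) (s ^ 2) fun ξ x => (ξ : ℂ) ^ p * b ξ x) z x‖
      ≤ C * s⁻¹ ^ (p + 1) * lorentz (z / s) ^ 2 := by
  obtain ⟨C, hC0, hC⟩ := hν.exists_amplitude_bound
  obtain ⟨M, hM⟩ := hb.exists_gaussBdd 4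
  have hθ8 : 0 < θ / 8 := by have := hν.pos; linarith
  obtain ⟨Cp, hCp⟩ := GaussBdd.exists_pow_bdd p 4 hθ8
  have hCp0 := hCp.nonneg
  have hM0 := (hM 0).nonneg
  refine ⟨C * (2 ^ 4 * Cp * M), by positivity, fun s z x hs => ?_⟩
  have hs0 : 0 < s := by linarith
  have h1 : GaussBdd 4 (-(θ / 8)) (2 ^ 4 * (s⁻¹ ^ p * Cp) * M)
      (fun x' : ℝ => (((x' / s : ℝ) : ℂ)) ^ p * b (x' / s) x) := by
    have h2 := (hCp.const_mul (((s⁻¹ ^ p : ℝ)) : ℂ)).mul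
      (((hM x).mono zero_le_one le_rfl).comp_div hs)
    rw [Complex.norm_real, Real.norm_of_nonneg (by positivity), add_zero] at h2
    convert h2 using 2 with x'
    push_cast
    rw [div_pow, inv_pow]
    field_simp
  refine (hC (fun ξ : ℝ => (ξ : ℂ) ^ p * b ξ x) _ s z hs h1).trans (le_of_eq ?_)
  rw [pow_succ]
  ring

/-- A zero of the symbol at `ξ = 0` gains the same `s⁻¹` as an explicit factor `ξ`, by the mean
value inequality. -/
lemma exists_osc_bound_vanish (hν : IsDiffusive θ N ν) (hb : IsSymb R b) (h0 : ∀ x, b 0 x = 0) :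
    ∃ C, 0 ≤ C ∧ ∀ s z x, 1 ≤ s → ‖osc (evo (disp ν) (s ^ 2) b) z x‖
      ≤ C * s⁻¹ ^ 2 * lorentz (z / s) ^ 2 := by
  obtain ⟨C, hC0, hC⟩ := hν.exists_amplitude_bound
  obtain ⟨M, hM⟩ := hb.exists_gaussBdd 4
  have hθ8 : 0 < θ / 8 := by have := hν.pos; linarith
  have hM0 := (hM 0).nonneg
  refine ⟨C * ((1 + 1 / (θ / 8)) * M), by positivity, fun s z x hs => ?_⟩
  have h1 := GaussBdd.comp_div_of_eq_zero (k := 3) hs hθ8 ((hM x).mono zero_le_one le_rfl) (h0 x)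
  refine (hC (fun ξ : ℝ => b ξ x) _ s z hs h1).trans (le_of_eq ?_)
  ring

/-- If the symbol vanishes at frequency zero, the operator is controlled by the Lipschitz constant. -/
lemma norm_oscOp_le (hν : IsDiffusive θ N ν) (hb : IsSymb R b) (hR : R ≤ 2 * Real.pi)
    (h0 : ∀ x, b 0 x = 0) {h : ℝ → ℂ} (hh : IsL1per h) {v : ℝ → ℝ} (hv : IsCub 1 v) {A s : ℝ}
    (hs : 1 ≤ s) (hA : ∀ z x, ‖osc (evo (disp ν) (s ^ 2) b) z x‖ ≤ A * lorentz (z / s) ^ 2) (y : ℝ) :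
    ‖oscOp (disp ν) b (fun x => h x * v x) (s ^ 2) y‖
      ≤ A * supNorm (deriv v) * s ^ 2 * (3 * Real.pi * ∫ x in Ioc (0 : ℝ) 1, ‖h x‖) := by
  have hbe := hb.evo hν.smooth_disp (s ^ 2)
  obtain ⟨M, hM⟩ := hv.exists_bound
  have hw := hh.lorentzIntegrable_mul hv.continuous_ofReal hM
  have hi := hb.integrable_osc_evo hν.smooth_disp hw (s ^ 2, y)
  have hi2 := hbe.integrable_osc_mul hh y
  -- By Poisson summation the kernel annihilates the periodic function `h`, so the constant `v y`
  -- may be subtracted from `v x`.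
  have hz : ∫ x, osc (evo (disp ν) (s ^ 2) b) (y - x) x * h x = 0 := by
    rw [hbe.integral_osc_mul_periodic hR hh y]
    simp [evo, h0]
  have e : oscOp (disp ν) b (fun x => h x * v x) (s ^ 2) y =
      ∫ x, osc (evo (disp ν) (s ^ 2) b) (y - x) x * (h x * ((v x : ℂ) - v y)) := by
    unfold oscOp
    rw [← sub_zero (∫ x, _), ← zero_mul (v y : ℂ), ← hz, ← integral_mul_const,
      ← integral_sub hi (hi2.mul_const _)]
    congr with x
    ring
  rw [e]
  exact hh.norm_integral_kernel_le hs hA (fun x => hv.norm_sub_le x y)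

/-- The operator with symbol `ξ^p b`, `p ≥ 1`, decays like `s^(1-p)` at time `s²`. -/
lemma exists_norm_oscOp_pow_le (hν : IsDiffusive θ N ν) (hb : IsSymb R b) (hR : R ≤ 2 * Real.pi)
    {h : ℝ → ℂ} (hh : IsL1per h) {p : ℕ} (hp : 1 ≤ p) :
    ∃ C, 0 ≤ C ∧ ∀ v : ℝ → ℝ, IsCub 1 v → ∀ s y, 1 ≤ s →
      ‖oscOp (disp ν) (fun ξ x => (ξ : ℂ) ^ p * b ξ x) (fun x => h x * v x) (s ^ 2) y‖
        ≤ C * s⁻¹ ^ (p - 1) * supNorm (deriv v) := by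
  obtain ⟨C, hC0, hC⟩ := hν.exists_osc_bound_pow hb p
  have hpi := Real.pi_pos
  have hnn : 0 ≤ ∫ x in Ioc (0 : ℝ) 1, ‖h x‖ := integral_nonneg fun _ => norm_nonneg _
  refine ⟨C * (3 * Real.pi * ∫ x in Ioc (0 : ℝ) 1, ‖h x‖), by positivity, fun v hv s y hs => ?_⟩
  have hs0 : s ≠ 0 := by linarith
  refine (hν.norm_oscOp_le (hb.mul_left (B := fun ξ : ℝ => (ξ : ℂ) ^ p)
    (Complex.ofRealCLM.contDiff.pow p)) hR
    (fun x => by simp [Nat.one_le_iff_ne_zero.1 hp]) hh hv hs (fun z x => hC s z x hs) y).trans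
    (le_of_eq ?_)
  obtain ⟨q, rfl⟩ := Nat.exists_eq_add_of_le' hp
  have e : s⁻¹ ^ (q + 1 + 1) * s ^ 2 = s⁻¹ ^ q := by
    rw [add_assoc, pow_add, mul_assoc, ← mul_pow, inv_mul_cancel₀ hs0, one_pow, mul_one]
  rw [Nat.add_sub_cancel, ← e]
  ring

end IsDiffusive

/-! ### Comparison with the heat semigroup -/

/-- The heat semigroup `e^{d t ∂²}`. -/
def heat (d t : ℝ) (v : ℝ → ℝ) (y : ℝ) : ℝ :=
  (Real.sqrt (4 * Real.pi * d * t))⁻¹ * ∫ x : ℝ, Real.exp (-(y - x) ^ 2 / (4 * d * t)) * v x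

/-- For `ν = -d` without cut-off the integral is the Fourier transform of a Gaussian: `2π` times the
heat kernel, because `√(π/(dt)) = 2π/√(4πdt)`. -/
lemma osc_gaussian {d t : ℝ} (hd : 0 < d) (ht : 0 < t) (z x : ℝ) :
    osc (evo (disp fun _ => -(d : ℂ)) t fun _ _ => 1) z x =
      ((2 * Real.pi * (Real.sqrt (4 * Real.pi * d * t))⁻¹ * Real.exp (-z ^ 2 / (4 * d * t)) : ℝ) : ℂ) := by
  have hpi := Real.pi_pos
  have h1 := fourierIntegral_gaussian (b := ((d * t : ℝ) : ℂ))
    (by rw [Complex.ofReal_re]; positivity) (z : ℂ)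
  have h2 : ((Real.pi : ℂ) / ((d * t : ℝ) : ℂ)) ^ (1 / 2 : ℂ) =
      ((Real.sqrt (Real.pi / (d * t)) : ℝ) : ℂ) := by
    rw [Real.sqrt_eq_rpow, Complex.ofReal_cpow (by positivity)]
    push_cast
    rfl
  have h3 : Real.sqrt (Real.pi / (d * t)) = 2 * Real.pi * (Real.sqrt (4 * Real.pi * d * t))⁻¹ := by
    rw [← div_eq_mul_inv, eq_div_iff (by positivity), ← Real.sqrt_mul (by positivity)]
    rw [show Real.pi / (d * t) * (4 * Real.pi * d * t) = (2 * Real.pi) ^ 2 by field_simp; ring]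
    exact Real.sqrt_sq (by positivity)
  rw [h2, h3] at h1
  unfold osc
  rw [Complex.ofReal_mul, Complex.ofReal_exp]
  convert h1 using 1
  · congr with ξ
    rw [evo, disp, mul_one, mul_comm]
    congr 2 <;> push_cast <;> ring
  · congr 2
    push_cast
    ring

lemma integrable_gaussian_shift {d t : ℝ} (hd : 0 < d) (ht : 0 < t) (y : ℝ) :
    Integrable (fun x : ℝ => Real.exp (-(y - x) ^ 2 / (4 * d * t))) := by
  have h := (integrable_exp_neg_mul_sq (b := (4 * d * t)⁻¹) (by positivity)).comp_sub_left y
  refine h.congr (Filter.Eventually.of_forall fun x => ?_)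
  simp only
  congr 1
  rw [div_eq_mul_inv]
  ring

lemma integral_gaussian_shift (d t y : ℝ) :
    ∫ x : ℝ, Real.exp (-(y - x) ^ 2 / (4 * d * t)) = Real.sqrt (4 * Real.pi * d * t) := by
  rw [integral_sub_left_eq_self (fun x => Real.exp (-x ^ 2 / (4 * d * t))) volume y]
  have h := integral_gaussian (4 * d * t)⁻¹
  rw [div_inv_eq_mul] at h
  rw [show 4 * Real.pi * d * t = Real.pi * (4 * d * t) by ring, ← h]
  congr with x
  congr 1
  rw [div_eq_mul_inv]
  ring

lemma isDiffusive_const {d : ℝ} (hd : 0 < d) : IsDiffusive d d (fun _ => -(d : ℂ)) where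
  pos := hd
  smooth := contDiff_const
  bdd := by
    have := GaussBdd.const 4 (-(d : ℂ))
    rwa [norm_neg, Complex.norm_real, Real.norm_of_nonneg hd.le] at this
  re_le := fun ξ => by simp

namespace IsDiffusive

variable {θ N R d : ℝ} {ν ρ : ℝ → ℂ}

/-- The amplitude `ρ - 1` vanishes at `ξ = 0`, which gains one factor `s⁻¹`. It has no compact
support, but boundedness suffices beside the Gaussian. -/
lemma exists_heat_cutoff_bound (hd : 0 < d) (hρ : ContDiff ℝ ∞ ρ) (hsupp : ∀ ξ, R ≤ |ξ| → ρ ξ = 0)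
    (h0 : ρ 0 = 1) : ∃ C, 0 ≤ C ∧ ∀ s z x, 1 ≤ s →
      ‖osc (evo (disp fun _ => -(d : ℂ)) (s ^ 2) fun ξ _ => ρ ξ) z x
        - osc (evo (disp fun _ => -(d : ℂ)) (s ^ 2) fun _ _ => 1) z x‖
      ≤ C * s⁻¹ ^ 2 * lorentz (z / s) ^ 2 := by
  have hν := isDiffusive_const hd
  obtain ⟨C, hC0, hC⟩ := hν.exists_amplitude_bound
  have hb : IsSymb R (fun ξ _ => ρ ξ) := IsSymb.of_smooth hρ hsupp
  obtain ⟨M, hM⟩ := hb.exists_gaussBdd 4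
  have hM0 := (hM 0).nonneg
  refine ⟨C * ((1 + 1 / (d / 8)) * (M + 1)), by positivity, fun s z x hs => ?_⟩
  have hs0 : 0 < s := by linarith
  have hB : GaussBdd 4 0 (M + 1) (fun ξ => ρ ξ + -1) := by
    have := ((hM 0).mono (c' := 0) zero_le_one le_rfl).add (GaussBdd.const 4 (-1))
    simpa using this
  have h1 := GaussBdd.comp_div_of_eq_zero (k := 3) hs (by positivity : 0 < d / 8) hB (by simp [h0])
  have i1 := (hb.evo hν.smooth_disp (s ^ 2)).integrable_integrand z x
  have i2 : Integrable (fun ξ : ℝ => evo (disp fun _ => -(d : ℂ)) (s ^ 2) (fun _ _ => 1) ξ x *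
      Complex.exp (Complex.I * ξ * z)) := by
    refine Integrable.mono' (integrable_exp_neg_mul_sq (b := d * s ^ 2) (by positivity)) ?_
      (Filter.Eventually.of_forall fun ξ => ?_)
    · exact (by unfold evo disp; fun_prop : Continuous _).aestronglyMeasurable
    · rw [norm_mul, show Complex.I * ξ * z = ((ξ * z : ℝ) : ℂ) * Complex.I by push_cast; ring,
        Complex.norm_exp_ofReal_mul_I, mul_one, evo, mul_one, Complex.norm_exp, Real.exp_le_exp,
        disp]
      rw [show (ξ : ℂ) ^ 2 * -(d : ℂ) * ((s ^ 2 : ℝ) : ℂ) = ((-(d * s ^ 2) * ξ ^ 2 : ℝ) : ℂ) by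
        push_cast; ring, Complex.ofReal_re]
  unfold osc
  rw [← integral_sub i1 i2]
  refine le_trans (le_of_eq ?_) ((hC (fun ξ : ℝ => ρ ξ + -1) _ s z hs h1).trans (le_of_eq ?_))
  · congr 2 with ξ
    simp only [evo]
    ring
  · ring

/-- Mean value inequality along the segment from `-d` to `ν` in the exponent. Differentiation brings
down `ξ²s²(ν(ξ) + d)`, which is `x²(ν(x/s) + d)` in the rescaled frequency; since `ν + d` vanishes
at zero, it is of size `s⁻¹`. -/
lemma exists_interpolation_bound (hν : IsDiffusive θ N ν) (hd : 0 < d) (hν0 : ν 0 = -d)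
    (hρ : ContDiff ℝ ∞ ρ) (hsupp : ∀ ξ, R ≤ |ξ| → ρ ξ = 0) : ∃ C, 0 ≤ C ∧ ∀ s z x, 1 ≤ s →
      ‖osc (evo (disp ν) (s ^ 2) fun ξ _ => ρ ξ) z x
        - osc (evo (disp fun _ => -(d : ℂ)) (s ^ 2) fun ξ _ => ρ ξ) z x‖
      ≤ C * s⁻¹ ^ 2 * lorentz (z / s) ^ 2 := by
  -- The decay rate common to the whole segment. The rate `θ'/8` allowed for the amplitude is shared
  -- equally by `x²` and `ν + d`.
  set θ' := min θ d
  have hθ' : 0 < θ' := lt_min hν.pos hd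
  have hθ16 : 0 < θ' / 16 := by positivity
  obtain ⟨C, hC0, hC⟩ := GaussBdd.exists_kernel_bound (N := N + d) hθ'
  have hb : IsSymb R (fun ξ _ => ρ ξ) := IsSymb.of_smooth hρ hsupp
  obtain ⟨M, hM⟩ := hb.exists_gaussBdd 4
  obtain ⟨C₂, hC₂⟩ := GaussBdd.exists_pow_bdd 2 4 hθ16
  have hM0 := (hM 0).nonneg
  have hC₂0 := hC₂.nonneg
  have hN0 := hν.bdd.nonneg
  refine ⟨C * (2 ^ 4 * (2 ^ 4 * C₂ * ((1 + 1 / (θ' / 16)) * (N + d))) * M), by positivity,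
    fun s z x hs => ?_⟩
  have hs0 : 0 < s := by linarith
  have hsum : GaussBdd 4 0 (N + d) (fun ξ => ν ξ + d) := by
    have := hν.bdd.add (GaussBdd.const 4 (d : ℂ))
    rwa [Complex.norm_real, Real.norm_of_nonneg hd.le] at this
  -- The symbol `b` below already contains the heat factor, so `exp (κ σ) b` is the heat evolution
  -- at `σ = 0` and the evolution of `ν` at `σ = 1`.
  set κ : ℝ → ℂ := fun ξ => (ξ : ℂ) ^ 2 * (ν ξ + d) * (s ^ 2 : ℝ)
  have hκ : ContDiff ℝ ∞ κ :=
    ((Complex.ofRealCLM.contDiff.pow 2).mul (hν.smooth.add contDiff_const)).mul contDiff_const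
  set b : ℝ → ℝ → ℂ := evo (disp fun _ => -(d : ℂ)) (s ^ 2) fun ξ _ => ρ ξ
  have hb' : IsSymb R b := hb.evo (isDiffusive_const hd).smooth_disp _
  have hamp : GaussBdd 4 (-(θ' / 8))
      (2 ^ 4 * (2 ^ 4 * C₂ * ((1 + 1 / (θ' / 16)) * (N + d) * s⁻¹)) * M)
      (fun x : ℝ => (x : ℂ) ^ 2 * (ν (x / s) + d) * ρ (x / s)) := by
    have h1 := GaussBdd.comp_div_of_eq_zero (k := 3) hs hθ16 hsum (by simp [hν0])
    exact ((hC₂.mul h1).mul (((hM 0).mono zero_le_one le_rfl).comp_div hs)).mono (by linarith) le_rfl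
  have hder : ∀ σ : ℝ, HasDerivAt (fun σ : ℝ => osc (evo κ σ b) z x)
      (osc (evo κ σ fun ξ x => κ ξ * b ξ x) z x) σ := fun σ => by
    have h := (hb'.hasFDerivAt_osc hκ x (σ, z + x)).comp_hasDerivAt σ
      ((hasDerivAt_id σ).prodMk (hasDerivAt_const σ (z + x)))
    simp only [add_sub_cancel_right] at h
    have e : ((fun p : ℝ × ℝ => osc (evo κ p.1 b) (p.2 - x) x) ∘ fun σ => (id σ, z + x)) =
        fun σ : ℝ => osc (evo κ σ b) z x := by
      funext σ; simp
    rw [e] at h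
    exact h.congr_deriv (by simp)
  have hbd : ∀ σ ∈ Ico (0 : ℝ) 1, ‖osc (evo κ σ fun ξ x => κ ξ * b ξ x) z x‖ ≤
      C * (2 ^ 4 * (2 ^ 4 * C₂ * ((1 + 1 / (θ' / 16)) * (N + d))) * M) * s⁻¹ ^ 2 *
        lorentz (z / s) ^ 2 := fun σ hσ => by
    set νσ : ℝ → ℂ := fun ξ => σ * ν ξ + ((-(1 - σ) * d : ℝ) : ℂ)
    have hνσ : GaussBdd 4 0 (N + d) νσ := by
      refine ((hν.bdd.const_mul (σ : ℂ)).add (GaussBdd.const 4 _)).mono le_rfl ?_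
      rw [Complex.norm_real, Complex.norm_real, Real.norm_of_nonneg hσ.1, Real.norm_eq_abs, abs_mul,
        abs_neg, abs_of_nonneg (by linarith [hσ.2] : 0 ≤ 1 - σ), abs_of_pos hd]
      nlinarith [hσ.1, hσ.2]
    have hre : ∀ ξ, (νσ ξ).re ≤ -θ' := fun ξ => by
      simp only [νσ, Complex.add_re, Complex.re_ofReal_mul, Complex.ofReal_re]
      have h1 : θ' ≤ θ := min_le_left _ _
      have h2 : θ' ≤ d := min_le_right _ _
      nlinarith [hν.re_le ξ, hσ.1, hσ.2]
    have h1 := hC νσ _ _ s z hs hνσ hre hamp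
    refine le_trans (le_of_eq ?_) (h1.trans (le_of_eq ?_))
    · unfold osc
      congr 2 with ξ
      rw [mul_div_cancel_left₀ ξ hs0.ne']
      have : (ξ : ℂ) ^ 2 * νσ ξ * ((s ^ 2 : ℝ) : ℂ) =
          κ ξ * σ + disp (fun _ => -(d : ℂ)) ξ * ((s ^ 2 : ℝ) : ℂ) := by
        simp only [νσ, κ, disp]
        push_cast
        ring
      rw [this, Complex.exp_add]
      simp only [evo, b, κ]
      push_cast
      ring
    · unfold lorentz; ring
  have hmv := norm_image_sub_le_of_norm_deriv_le_segment_01'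
    (fun σ _ => (hder σ).hasDerivWithinAt) hbd
  refine le_trans (le_of_eq ?_) hmv
  congr 2
  · unfold osc
    congr with ξ
    simp only [evo, b, κ, disp]
    rw [← mul_assoc (Complex.exp _), ← Complex.exp_add]
    congr 3
    push_cast
    ring
  · unfold osc
    congr with ξ
    simp [evo, b]

/-- The principal kernel and the heat kernel agree to first order. -/
lemma exists_norm_oscOp_sub_heat_le (hν : IsDiffusive θ N ν) (hd : 0 < d) (hν0 : ν 0 = -d)
    (hρ : ContDiff ℝ ∞ ρ) (hR : R ≤ 2 * Real.pi) (hsupp : ∀ ξ, R ≤ |ξ| → ρ ξ = 0) (h0 : ρ 0 = 1) :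
    ∃ C, 0 ≤ C ∧ ∀ v : ℝ → ℝ, IsCub 1 v → ∀ s y, 1 ≤ s →
      ‖oscOp (disp ν) (fun ξ _ => ρ ξ) (fun x => (v x : ℂ)) (s ^ 2) y
        - ((2 * Real.pi * heat d (s ^ 2) v y : ℝ) : ℂ)‖ ≤ C * supNorm (deriv v) := by
  obtain ⟨C₁, hC₁0, hC₁⟩ := hν.exists_interpolation_bound hd hν0 hρ hsupp
  obtain ⟨C₂, hC₂0, hC₂⟩ := exists_heat_cutoff_bound hd hρ hsupp h0
  have hpi := Real.pi_pos
  refine ⟨(C₁ + C₂) * (3 * Real.pi), by positivity, fun v hv s y hs => ?_⟩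
  have hs0 : 0 < s := by linarith
  have ht : 0 < s ^ 2 := by positivity
  have hb : IsSymb R (fun ξ _ => ρ ξ) := IsSymb.of_smooth hρ hsupp
  have hbe := hb.evo hν.smooth_disp (s ^ 2)
  -- Both kernels have mass `2π`, so `k` has mass zero and acts on `v x - v y`; its size `s⁻¹ ^ 2`
  -- cancels the `s ^ 2` from the integration.
  set k : ℝ → ℝ → ℂ := fun z x => osc (evo (disp ν) (s ^ 2) fun ξ _ => ρ ξ) z x -
    osc (evo (disp fun _ => -(d : ℂ)) (s ^ 2) fun _ _ => 1) z x
  have hk : ∀ z x, ‖k z x‖ ≤ (C₁ + C₂) * s⁻¹ ^ 2 * lorentz (z / s) ^ 2 := fun z x => by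
    have h1 := hC₁ s z x hs
    have h2 := hC₂ s z x hs
    calc ‖k z x‖ ≤ _ + _ := norm_sub_le_norm_sub_add_norm_sub _
          (osc (evo (disp fun _ => -(d : ℂ)) (s ^ 2) fun ξ _ => ρ ξ) z x) _
      _ ≤ _ := by linarith
  obtain ⟨M, hM⟩ := hv.exists_bound
  have hw : LorentzIntegrable (fun x => (v x : ℂ)) := by
    simpa using IsL1per.one.lorentzIntegrable_mul hv.continuous_ofReal hM
  have hi := hb.integrable_osc_evo hν.smooth_disp hw (s ^ 2, y)
  have hi1 := hbe.integrable_osc_mul IsL1per.one y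
  have hz : ∫ x, osc (evo (disp ν) (s ^ 2) fun ξ _ => ρ ξ) (y - x) x * 1 = 2 * Real.pi := by
    rw [hbe.integral_osc_mul_periodic hR IsL1per.one y]
    simp [evo, disp, h0]
  set S := (Real.sqrt (4 * Real.pi * d * s ^ 2))⁻¹
  have hS : S * Real.sqrt (4 * Real.pi * d * s ^ 2) = 1 := inv_mul_cancel₀ (by positivity)
  have hg : Integrable (fun x =>
      osc (evo (disp fun _ => -(d : ℂ)) (s ^ 2) fun _ _ => 1) (y - x) x) := by
    simp only [osc_gaussian hd ht]
    exact ((integrable_gaussian_shift hd ht y).const_mul (2 * Real.pi * S)).ofReal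
  have hgv : Integrable (fun x =>
      osc (evo (disp fun _ => -(d : ℂ)) (s ^ 2) fun _ _ => 1) (y - x) x * v x) :=
    hg.mul_bdd hv.continuous_ofReal.aestronglyMeasurable (Filter.Eventually.of_forall hM)
  have hg1 : ∫ x, osc (evo (disp fun _ => -(d : ℂ)) (s ^ 2) fun _ _ => 1) (y - x) x =
      2 * Real.pi := by
    simp only [osc_gaussian hd ht]
    rw [integral_complex_ofReal, integral_const_mul, integral_gaussian_shift, mul_assoc, hS]
    simp
  have hheat : ((2 * Real.pi * heat d (s ^ 2) v y : ℝ) : ℂ) =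
      ∫ x, osc (evo (disp fun _ => -(d : ℂ)) (s ^ 2) fun _ _ => 1) (y - x) x * v x := by
    simp only [osc_gaussian hd ht, ← Complex.ofReal_mul]
    rw [integral_complex_ofReal, heat, ← mul_assoc, ← integral_const_mul]
    congr 2 with x
    ring
  have e : oscOp (disp ν) (fun ξ _ => ρ ξ) (fun x => (v x : ℂ)) (s ^ 2) y
      - ((2 * Real.pi * heat d (s ^ 2) v y : ℝ) : ℂ) =
      ∫ x, k (y - x) x * ((fun _ => 1) x * ((v x : ℂ) - v y)) := by
    have h1 : ∫ x, k (y - x) x * v y = 0 := by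
      rw [integral_mul_const]
      simp only [mul_one] at hz hi1
      simp only [k]
      rw [integral_sub hi1 hg, hz, hg1]
      ring
    have hik : Integrable fun x => k (y - x) x * v x := by
      simp only [k, sub_mul]
      exact hi.sub hgv
    have hik1 : Integrable fun x => k (y - x) x * v y := by
      simp only [mul_one] at hi1
      exact (hi1.sub hg).mul_const _
    have h2 : ∫ x, k (y - x) x * v x = oscOp (disp ν) (fun ξ _ => ρ ξ) (fun x => (v x : ℂ)) (s ^ 2) y
      - ((2 * Real.pi * heat d (s ^ 2) v y : ℝ) : ℂ) := by
      rw [hheat]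
      simp only [oscOp, k, sub_mul]
      exact integral_sub hi hgv
    rw [← h2, ← sub_zero (∫ x, k (y - x) x * v x), ← h1, ← integral_sub hik hik1]
    congr with x
    ring
  rw [e]
  refine (IsL1per.one.norm_integral_kernel_le hs hk (fun x => hv.norm_sub_le x y)).trans (le_of_eq ?_)
  simp
  field_simp

end IsDiffusive

/-! ### Averaging of periodic coefficients -/

/-- A smooth periodic function with mean zero has a periodic primitive. -/
lemma exists_periodic_primitive {q : ℝ → ℂ} (hq : Continuous q) (hp : Function.Periodic q 1)
    (hmean : ∫ x in Ioc (0 : ℝ) 1, q x = 0) :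
    ∃ Q : ℝ → ℂ, (∀ x, HasDerivAt Q (q x) x) ∧ Function.Periodic Q 1 := by
  refine ⟨fun x => ∫ y in (0 : ℝ)..x, q y, fun x => ?_, fun x => ?_⟩
  · exact intervalIntegral.integral_hasDerivAt_right (hq.intervalIntegrable _ _)
      hq.aestronglyMeasurable.stronglyMeasurableAtFilter hq.continuousAt
  · simp only
    rw [← intervalIntegral.integral_add_adjacent_intervals (hq.intervalIntegrable 0 x)
      (hq.intervalIntegrable x (x + 1)), hp.intervalIntegral_add_eq x 0, zero_add,
      intervalIntegral.integral_of_le zero_le_one, hmean, add_zero]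

namespace IsDiffusive

variable {θ N R d : ℝ} {ν ρ : ℝ → ℂ}

/-- Oscillating coefficients with mean zero gain a derivative. -/
lemma exists_norm_oscOp_mean_zero_le (hν : IsDiffusive θ N ν) (hρ : ContDiff ℝ ∞ ρ)
    (hR : R ≤ 2 * Real.pi) (hsupp : ∀ ξ, R ≤ |ξ| → ρ ξ = 0) {q : ℝ → ℂ} (hq : Continuous q)
    (hp : Function.Periodic q 1) (hmean : ∫ x in Ioc (0 : ℝ) 1, q x = 0) :
    ∃ C, 0 ≤ C ∧ ∀ v : ℝ → ℝ, IsCub 1 v → ∀ s y, 1 ≤ s →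
      ‖oscOp (disp ν) (fun ξ _ => ρ ξ) (fun x => q x * v x) (s ^ 2) y‖
        ≤ C * supNorm (deriv v) := by
  obtain ⟨Q, hQd, hQp⟩ := exists_periodic_primitive hq hp hmean
  have hQc : Continuous Q := continuous_iff_continuousAt.2 fun x => (hQd x).continuousAt
  have hQ : IsL1per Q := .of_continuous hQc hQp
  have hq1 : IsL1per q := .of_continuous hq hp
  have hb : IsSymb R (fun ξ _ => ρ ξ) := IsSymb.of_smooth hρ hsupp
  obtain ⟨C₀, hC₀0, hC₀⟩ := hν.exists_osc_bound_pow hb 0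
  obtain ⟨C₁, hC₁0, hC₁⟩ := hν.exists_norm_oscOp_pow_le (b := fun ξ _ => Complex.I * ρ ξ)
    (hb.mul_left contDiff_const) hR hQ le_rfl
  have hpi := Real.pi_pos
  have hnn : 0 ≤ ∫ x in Ioc (0 : ℝ) 1, ‖Q x‖ := integral_nonneg fun _ => norm_nonneg _
  refine ⟨C₁ + C₀ * (3 * Real.pi * ∫ x in Ioc (0 : ℝ) 1, ‖Q x‖), by positivity,
    fun v hv s y hs => ?_⟩
  have hs0 : s ≠ 0 := by linarith
  have hμ := hν.smooth_disp
  obtain ⟨M, hM⟩ := hv.exists_bound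
  have hv'c : Continuous (fun x => ((deriv v x : ℝ) : ℂ)) :=
    Complex.continuous_ofReal.comp hv.continuous_deriv
  have hv'b : ∀ x, ‖((deriv v x : ℝ) : ℂ)‖ ≤ supNorm (deriv v) := fun x => by
    rw [Complex.norm_real]; exact hv.norm_deriv_le x
  -- The symbol `ρ` does not depend on `x`, so the second argument of `osc` is irrelevant and is set
  -- to zero.
  set k : ℝ → ℂ := fun z => osc (evo (disp ν) (s ^ 2) fun ξ _ => ρ ξ) z 0
  set k' : ℝ → ℂ := fun z => osc (evo (disp ν) (s ^ 2) fun ξ _ => Complex.I * ξ * ρ ξ) z 0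
  have hk : ∀ x, HasDerivAt (fun x => k (y - x)) (-k' (y - x)) x := fun x => by
    have h1 := (hb.hasFDerivAt_osc hμ 0 (s ^ 2, y - x)).comp_hasDerivAt x
      ((hasDerivAt_const x (s ^ 2)).prodMk ((hasDerivAt_id x).const_sub y))
    have e : ((fun p : ℝ × ℝ => osc (evo (disp ν) p.1 fun ξ _ => ρ ξ) (p.2 - 0) 0) ∘
        fun x => (s ^ 2, y - id x)) = fun x => k (y - x) := by
      funext x; simp [k]
    rw [e] at h1
    exact h1.congr_deriv (by simp [k'])
  have hvd : ∀ x, HasDerivAt (fun x => (v x : ℂ)) ((deriv v x : ℝ) : ℂ) x := fun x =>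
    (hv.differentiable x).hasDerivAt.ofReal_comp
  have iqv := hb.integrable_osc_evo hμ (hq1.lorentzIntegrable_mul hv.continuous_ofReal hM) (s ^ 2, y)
  have iQv := hb.integrable_osc_evo hμ (hQ.lorentzIntegrable_mul hv.continuous_ofReal hM) (s ^ 2, y)
  have iQv' := hb.integrable_osc_evo hμ (hQ.lorentzIntegrable_mul hv'c hv'b) (s ^ 2, y)
  have ik'Qv := hb.mul_I.integrable_osc_evo hμ
    (hQ.lorentzIntegrable_mul hv.continuous_ofReal hM) (s ^ 2, y)
  -- After integration by parts the derivative falls either on the kernel, producing a symbol with a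
  -- factor `ξ`, or on `v`, producing the bounded function `v'`.
  have hparts := integral_mul_deriv_eq_deriv_mul_of_integrable
    (u := fun x => k (y - x) * v x) (v := Q)
    (u' := fun x => -k' (y - x) * v x + k (y - x) * ((deriv v x : ℝ) : ℂ)) (v' := q)
    (fun x _ => (hk x).mul (hvd x)) (fun x _ => hQd x)
    (iqv.congr (Filter.Eventually.of_forall fun x => by
      change k (y - x) * (q x * v x) = k (y - x) * v x * q x
      ring))
    ((iQv'.sub ik'Qv).congr (Filter.Eventually.of_forall fun x => by
      change k (y - x) * (Q x * ((deriv v x : ℝ) : ℂ)) - k' (y - x) * (Q x * v x) =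
        (-k' (y - x) * v x + k (y - x) * ((deriv v x : ℝ) : ℂ)) * Q x
      ring))
    (iQv.congr (Filter.Eventually.of_forall fun x => by
      change k (y - x) * (Q x * v x) = k (y - x) * v x * Q x
      ring))
  have e : oscOp (disp ν) (fun ξ _ => ρ ξ) (fun x => q x * v x) (s ^ 2) y =
      oscOp (disp ν) (fun ξ _ => (ξ : ℂ) ^ 1 * (Complex.I * ρ ξ)) (fun x => Q x * v x) (s ^ 2) y
      - ∫ x, k (y - x) * (Q x * ((deriv v x : ℝ) : ℂ)) := by
    have h1 : oscOp (disp ν) (fun ξ _ => ρ ξ) (fun x => q x * v x) (s ^ 2) y =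
        ∫ x, k (y - x) * v x * q x := by
      unfold oscOp
      congr with x
      change k (y - x) * (q x * v x) = k (y - x) * v x * q x
      ring
    have h2 : oscOp (disp ν) (fun ξ _ => (ξ : ℂ) ^ 1 * (Complex.I * ρ ξ))
        (fun x => Q x * v x) (s ^ 2) y = ∫ x, k' (y - x) * (Q x * v x) := by
      simp only [oscOp, k', osc, evo]
      congr with x
      congr 2 with ξ
      ring
    have i1 : Integrable (fun x => k' (y - x) * (Q x * v x)) := ik'Qv
    have i2 : Integrable (fun x => k (y - x) * (Q x * ((deriv v x : ℝ) : ℂ))) := iQv'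
    rw [h1, hparts, h2, ← integral_sub i1 i2, ← integral_neg]
    congr with x
    ring
  rw [e, add_mul]
  refine (norm_sub_le _ _).trans (add_le_add ?_ ?_)
  · simpa using hC₁ v hv s y hs
  · refine (hQ.norm_integral_kernel_le_of_bdd (k := fun z _ => k z) (A := C₀ * s⁻¹) hs
      (fun z x => ?_) hv'b).trans (le_of_eq ?_)
    · simpa using hC₀ s z 0 hs
    · field_simp

/-- The leading-order asymptotics of an operator whose symbol has mean one at frequency zero. -/
lemma exists_norm_oscOp_mean_one_sub_heat_le (hν : IsDiffusive θ N ν) (hd : 0 < d) (hν0 : ν 0 = -d)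
    (hρ : ContDiff ℝ ∞ ρ) (hR : R ≤ 2 * Real.pi) (hsupp : ∀ ξ, R ≤ |ξ| → ρ ξ = 0) (h0 : ρ 0 = 1)
    {b : ℝ → ℝ → ℂ} (hb : IsSymb R b) (hmean : ∫ x in Ioc (0 : ℝ) 1, b 0 x = 1) :
    ∃ C, 0 ≤ C ∧ ∀ v : ℝ → ℝ, IsCub 1 v → ∀ s y, 1 ≤ s →
      ‖oscOp (disp ν) b (fun x => (v x : ℂ)) (s ^ 2) y
        - ((2 * Real.pi * heat d (s ^ 2) v y : ℝ) : ℂ)‖ ≤ C * supNorm (deriv v) := by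
  have hb0 : ContDiff ℝ ∞ (b 0) :=
    ContDiff.comp (f := fun x : ℝ => ((0 : ℝ), x)) hb.smooth (contDiff_const.prodMk contDiff_id)
  have hρs : IsSymb R (fun ξ _ => ρ ξ) := IsSymb.of_smooth hρ hsupp
  -- The splitting `b = (b - ρ b(0,·)) + ρ (b(0,·) - 1) + ρ`: a symbol vanishing at `ξ = 0`, a
  -- mean-zero oscillation, and the plain cut-off.
  have hb₁ : IsSymb R (fun ξ x => b ξ x - ρ ξ * b 0 x) := hb.sub (hρs.mul_right hb0 (hb.periodic 0))
  have hb₁0 : ∀ x, b 0 x - ρ 0 * b 0 x = 0 := fun x => by simp [h0]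
  set q : ℝ → ℂ := fun x => b 0 x - 1
  have hqc : Continuous q := hb0.continuous.sub continuous_const
  have hqp : Function.Periodic q 1 := fun x => by simp [q, hb.periodic 0 x]
  have hqm : ∫ x in Ioc (0 : ℝ) 1, q x = 0 := by
    simp only [q]
    rw [integral_sub (IsL1per.of_continuous hb0.continuous (hb.periodic 0)).integrableOn
      IsL1per.one.integrableOn, hmean]
    simp
  obtain ⟨C₁, hC₁0, hC₁⟩ := hν.exists_osc_bound_vanish hb₁ hb₁0
  obtain ⟨C₂, hC₂0, hC₂⟩ := hν.exists_norm_oscOp_mean_zero_le hρ hR hsupp hqc hqp hqm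
  obtain ⟨C₃, hC₃0, hC₃⟩ := hν.exists_norm_oscOp_sub_heat_le hd hν0 hρ hR hsupp h0
  have hpi := Real.pi_pos
  refine ⟨C₁ * (3 * Real.pi) + C₂ + C₃, by positivity, fun v hv s y hs => ?_⟩
  have hs0 : s ≠ 0 := by linarith
  have hμ := hν.smooth_disp
  obtain ⟨M, hM⟩ := hv.exists_bound
  have hw := IsL1per.one.lorentzIntegrable_mul hv.continuous_ofReal hM
  simp only [one_mul] at hw
  have hqv := (IsL1per.of_continuous hqc hqp).lorentzIntegrable_mul hv.continuous_ofReal hM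
  have h1 := hν.norm_oscOp_le hb₁ hR hb₁0 IsL1per.one hv hs (fun z x => hC₁ s z x hs) y
  have e : oscOp (disp ν) b (fun x => (v x : ℂ)) (s ^ 2) y =
      oscOp (disp ν) (fun ξ x => b ξ x - ρ ξ * b 0 x) (fun x => 1 * (v x : ℂ)) (s ^ 2) y +
      oscOp (disp ν) (fun ξ _ => ρ ξ) (fun x => q x * v x) (s ^ 2) y +
      oscOp (disp ν) (fun ξ _ => ρ ξ) (fun x => (v x : ℂ)) (s ^ 2) y := by
    have i1 := hb₁.integrable_osc_evo hμ hw (s ^ 2, y)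
    have i2 := hρs.integrable_osc_evo hμ hqv (s ^ 2, y)
    have i3 := hρs.integrable_osc_evo hμ hw (s ^ 2, y)
    simp only [one_mul]
    unfold oscOp
    have e₁ := integral_add i1 i2
    have e₂ := integral_add (i1.add i2) i3
    simp only [Pi.add_apply] at e₂
    rw [e₁] at e₂
    refine Eq.trans ?_ e₂
    congr with x
    have hosc : osc (evo (disp ν) (s ^ 2) fun ξ x => b ξ x - ρ ξ * b 0 x) (y - x) x =
        osc (evo (disp ν) (s ^ 2) b) (y - x) x -
          osc (evo (disp ν) (s ^ 2) fun ξ _ => ρ ξ) (y - x) x * b 0 x := by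
      unfold osc
      rw [← integral_mul_const, ← integral_sub ((hb.evo hμ _).integrable_integrand _ _)
        (((hρs.evo hμ _).integrable_integrand _ _).mul_const _)]
      congr with ξ
      simp only [evo]
      ring
    simp only [hosc, q]
    ring
  rw [e, add_sub_assoc, add_mul, add_mul]
  refine (norm_add_le _ _).trans (add_le_add ((norm_add_le _ _).trans (add_le_add ?_ ?_)) ?_)
  · refine h1.trans (le_of_eq ?_)
    simp
    field_simp
  · exact hC₂ v hv s y hs
  · exact hC₃ v hv s y hs

end IsDiffusive

lemma two_le_infty : (2 : WithTop ℕ∞) ≤ ∞ := by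
  have h : ∀ m : ℕ, (m : WithTop ℕ∞) ≤ ∞ := fun m => by exact_mod_cast le_top
  exact h 2

/-! ### Mixed partial derivatives -/

section Mixed

variable {E : Type*} [NormedAddCommGroup E] [NormedSpace ℝ E] {F : ℝ → ℝ → E} {I : Set ℝ}

lemma hasDerivAt_fst_of_contDiffOn (hI : IsOpen I)
    (hF : ContDiffOn ℝ ∞ (fun p : ℝ × ℝ => F p.1 p.2) (I ×ˢ univ)) {k : ℝ} (hk : k ∈ I) (z : ℝ) :
    HasDerivAt (fun k => F k z) (fderiv ℝ (fun p : ℝ × ℝ => F p.1 p.2) (k, z) (1, 0)) k := by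
  have hd := ((hF.contDiffAt (x := (k, z)) ((hI.prod isOpen_univ).mem_nhds
    ⟨hk, mem_univ z⟩)).differentiableAt (by simp)).hasFDerivAt
  exact hd.comp_hasDerivAt k ((hasDerivAt_id k).prodMk (hasDerivAt_const k z))

lemma hasDerivAt_snd_of_contDiffOn (hI : IsOpen I)
    (hF : ContDiffOn ℝ ∞ (fun p : ℝ × ℝ => F p.1 p.2) (I ×ˢ univ)) {k : ℝ} (hk : k ∈ I) (z : ℝ) :
    HasDerivAt (F k) (fderiv ℝ (fun p : ℝ × ℝ => F p.1 p.2) (k, z) (0, 1)) z := by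
  have hd := ((hF.contDiffAt (x := (k, z)) ((hI.prod isOpen_univ).mem_nhds
    ⟨hk, mem_univ z⟩)).differentiableAt (by simp)).hasFDerivAt
  exact hd.comp_hasDerivAt z ((hasDerivAt_const z k).prodMk (hasDerivAt_id z))

lemma contDiffOn_fderiv_apply (hI : IsOpen I)
    (hF : ContDiffOn ℝ ∞ (fun p : ℝ × ℝ => F p.1 p.2) (I ×ˢ univ)) (e : ℝ × ℝ) :
    ContDiffOn ℝ ∞ (fun p : ℝ × ℝ => fderiv ℝ (fun p : ℝ × ℝ => F p.1 p.2) p e) (I ×ˢ univ) :=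
  (hF.fderiv_of_isOpen (hI.prod isOpen_univ) (by simp)).clm_apply contDiffOn_const

lemma contDiffOn_deriv_snd (hI : IsOpen I)
    (hF : ContDiffOn ℝ ∞ (fun p : ℝ × ℝ => F p.1 p.2) (I ×ˢ univ)) :
    ContDiffOn ℝ ∞ (fun p : ℝ × ℝ => deriv (F p.1) p.2) (I ×ˢ univ) :=
  (contDiffOn_fderiv_apply hI hF (0, 1)).congr fun p hp =>
    (hasDerivAt_snd_of_contDiffOn hI hF hp.1 p.2).deriv

lemma contDiff_slice (hI : IsOpen I)
    (hF : ContDiffOn ℝ ∞ (fun p : ℝ × ℝ => F p.1 p.2) (I ×ˢ univ)) {k : ℝ} (hk : k ∈ I) :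
    ContDiff ℝ ∞ (F k) :=
  contDiff_iff_contDiffAt.2 fun z => ContDiffAt.comp (f := fun z : ℝ => (k, z)) z
    (hF.contDiffAt ((hI.prod isOpen_univ).mem_nhds ⟨hk, mem_univ z⟩))
    (contDiffAt_const.prodMk contDiffAt_id)

lemma contDiff_deriv_fst (hI : IsOpen I)
    (hF : ContDiffOn ℝ ∞ (fun p : ℝ × ℝ => F p.1 p.2) (I ×ˢ univ)) {k : ℝ} (hk : k ∈ I) :
    ContDiff ℝ ∞ (fun z => deriv (fun k => F k z) k) := by
  have h := contDiff_slice (F := fun k z => fderiv ℝ (fun p : ℝ × ℝ => F p.1 p.2) (k, z) (1, 0)) hI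
    (contDiffOn_fderiv_apply hI hF (1, 0)) hk
  convert h using 2 with z
  exact (hasDerivAt_fst_of_contDiffOn hI hF hk z).deriv

/-- Symmetry of the mixed second derivatives. -/
lemma hasDerivAt_deriv_snd (hI : IsOpen I)
    (hF : ContDiffOn ℝ ∞ (fun p : ℝ × ℝ => F p.1 p.2) (I ×ˢ univ)) {k : ℝ} (hk : k ∈ I) (z : ℝ) :
    HasDerivAt (fun k => deriv (F k) z) (deriv (fun z => deriv (fun k => F k z) k) z) k := by
  set D := fderiv ℝ (fun p : ℝ × ℝ => F p.1 p.2)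
  have hat : ContDiffAt ℝ ∞ (fun p : ℝ × ℝ => F p.1 p.2) (k, z) :=
    hF.contDiffAt ((hI.prod isOpen_univ).mem_nhds ⟨hk, mem_univ z⟩)
  have hDat : HasFDerivAt D (fderiv ℝ D (k, z)) (k, z) :=
    ((hat.fderiv_right (m := ∞) (by simp)).differentiableAt (by simp)).hasFDerivAt
  have h1 : HasDerivAt (fun k => D (k, z) (0, 1)) (fderiv ℝ D (k, z) (1, 0) (0, 1)) k := by
    have := hDat.comp_hasDerivAt k ((hasDerivAt_id k).prodMk (hasDerivAt_const k z))
    simpa using this.clm_apply (hasDerivAt_const k ((0 : ℝ), (1 : ℝ)))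
  have h2 : HasDerivAt (fun z => D (k, z) (1, 0)) (fderiv ℝ D (k, z) (0, 1) (1, 0)) z := by
    have := hDat.comp_hasDerivAt z ((hasDerivAt_const z k).prodMk (hasDerivAt_id z))
    simpa using this.clm_apply (hasDerivAt_const z ((1 : ℝ), (0 : ℝ)))
  have h3 : deriv (fun z => deriv (fun k => F k z) k) z = fderiv ℝ D (k, z) (1, 0) (0, 1) := by
    have e : (fun z => deriv (fun k => F k z) k) = fun z => D (k, z) (1, 0) :=
      funext fun z => (hasDerivAt_fst_of_contDiffOn hI hF hk z).deriv
    rw [e, h2.deriv]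
    exact (hat.isSymmSndFDerivAt (by simpa using two_le_infty)) _ _
  rw [h3]
  refine h1.congr_of_eventuallyEq ?_
  filter_upwards [hI.mem_nhds hk] with k' hk'
  exact (hasDerivAt_snd_of_contDiffOn hI hF hk' z).deriv

end Mixed

variable {n : ℕ}

/-! ### The profile equation and its derivatives -/

/-- The travelling-wave equation at time `0` and position `ζ / k`. -/
lemma IsWaveTrain.profile {D : Matrix (Fin n) (Fin n) ℝ} {f : (Fin n → ℝ) → (Fin n → ℝ)}
    {k om : ℝ} {φ : ℝ → Fin n → ℝ} (h : IsWaveTrain D f k om φ) (hk : k ≠ 0) (ζ : ℝ) :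
    k ^ 2 • (D *ᵥ deriv (deriv φ) ζ) + om • deriv φ ζ + f (φ ζ) = 0 := by
  have hs := h.solves (ζ / k) 0
  have hd : Differentiable ℝ φ := h.smooth.differentiable (by simp)
  have h1 : deriv (fun s => φ (k * (ζ / k) - om * s)) 0 = -om • deriv φ ζ := by
    have hin : HasDerivAt (fun s : ℝ => k * (ζ / k) - om * s) (-om) 0 := by
      simpa using ((hasDerivAt_id (0 : ℝ)).const_mul om).const_sub (k * (ζ / k))
    have hφ : HasDerivAt φ (deriv φ ζ) (k * (ζ / k) - om * 0) := by
      rw [mul_zero, sub_zero, mul_div_cancel₀ _ hk]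
      exact (hd ζ).hasDerivAt
    exact (hφ.scomp (0 : ℝ) hin).deriv
  have h2 : iteratedDeriv 2 (fun y => φ (k * y - om * 0)) (ζ / k) = k ^ 2 • deriv (deriv φ) ζ := by
    simp only [mul_zero, sub_zero]
    rw [iteratedDeriv_comp_const_smul (h.smooth.of_le two_le_infty), iteratedDeriv_succ,
      iteratedDeriv_one]
    simp only
    rw [mul_div_cancel₀ _ hk]
  rw [h1, h2, mul_zero, sub_zero, mul_div_cancel₀ _ hk, Matrix.mulVec_smul] at hs
  rw [add_right_comm, ← hs]
  module

lemma hasDerivAt_mulVec (D : Matrix (Fin n) (Fin n) ℝ) {u : ℝ → Fin n → ℝ} {u' : Fin n → ℝ} {x : ℝ}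
    (hu : HasDerivAt u u' x) : HasDerivAt (fun x => D *ᵥ u x) (D *ᵥ u') x := by
  have := (LinearMap.toContinuousLinearMap (Matrix.mulVecLin D)).hasFDerivAt.comp_hasDerivAt x hu
  exact this

/-- The linearized equation for the derivative of the wave train. -/
lemma Data.H1.linearized_deriv {P : Data n} (h : P.H1) (ζ : ℝ) :
    P.k₀ ^ 2 • (P.D *ᵥ deriv (deriv (deriv P.φ₀)) ζ) + P.ω₀ • deriv (deriv P.φ₀) ζ
      + fderiv ℝ P.f (P.φ₀ ζ) (deriv P.φ₀ ζ) = 0 := by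
  have hs := h.waveTrain.smooth
  have hs1 := (contDiff_infty_iff_deriv.1 hs).2
  have hs2 := (contDiff_infty_iff_deriv.1 hs1).2
  have d0 := (hs.differentiable (by simp) ζ).hasDerivAt
  have d1 := (hs1.differentiable (by simp) ζ).hasDerivAt
  have d2 := (hs2.differentiable (by simp) ζ).hasDerivAt
  have df := (h.smooth.differentiable (by simp) (P.φ₀ ζ)).hasFDerivAt.comp_hasDerivAt ζ d0
  have hE := (((hasDerivAt_mulVec P.D d2).const_smul (P.k₀ ^ 2)).add (d1.const_smul P.ω₀)).add df
  refine hE.unique ?_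
  refine (hasDerivAt_const ζ (0 : Fin n → ℝ)).congr_of_eventuallyEq
    (Filter.Eventually.of_forall fun z => ?_)
  exact h.waveTrain.profile h.k₀_ne_zero z

/-- The derivative of the profile equation with respect to the wavenumber. -/
lemma Data.IsFamily.linearized_dk {P : Data n} (h : P.H1) {Ψ₀ : ℝ → Fin n → ℂ} {r₀ : ℝ}
    {φ : ℝ → ℝ → Fin n → ℝ} {om : ℝ → ℝ} (hf : P.IsFamily Ψ₀ r₀ φ om) (ζ : ℝ) :
    P.k₀ ^ 2 • (P.D *ᵥ deriv (deriv (dk φ P.k₀)) ζ) + P.ω₀ • deriv (dk φ P.k₀) ζ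
      + fderiv ℝ P.f (P.φ₀ ζ) (dk φ P.k₀ ζ)
      + (2 * P.k₀) • (P.D *ᵥ deriv (deriv P.φ₀) ζ) + deriv om P.k₀ • deriv P.φ₀ ζ = 0 := by
  set I := Ioo (P.k₀ - r₀) (P.k₀ + r₀)
  have hI : IsOpen I := isOpen_Ioo
  have hk : P.k₀ ∈ I := ⟨by linarith [hf.r₀_mem.1], by linarith [hf.r₀_mem.1]⟩
  have hF := hf.φ_smooth
  have hF1 := contDiffOn_deriv_snd hI hF
  have e1 : (fun z => deriv (fun k => deriv (φ k) z) P.k₀) = deriv (dk φ P.k₀) :=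
    funext fun z => (hasDerivAt_deriv_snd hI hF hk z).deriv
  have d0 : HasDerivAt (fun k => φ k ζ) (dk φ P.k₀ ζ) P.k₀ :=
    (hasDerivAt_fst_of_contDiffOn hI hF hk ζ).differentiableAt.hasDerivAt
  have d1 : HasDerivAt (fun k => deriv (φ k) ζ) (deriv (dk φ P.k₀) ζ) P.k₀ :=
    hasDerivAt_deriv_snd hI hF hk ζ
  have d2 : HasDerivAt (fun k => deriv (deriv (φ k)) ζ) (deriv (deriv (dk φ P.k₀)) ζ) P.k₀ := by
    have := hasDerivAt_deriv_snd (F := fun k z => deriv (φ k) z) hI hF1 hk ζ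
    rwa [e1] at this
  have dom : HasDerivAt om (deriv om P.k₀) P.k₀ :=
    ((hf.ω_smooth.contDiffAt (hI.mem_nhds hk)).differentiableAt (by simp)).hasDerivAt
  have dsq : HasDerivAt (fun k : ℝ => k ^ 2) (2 * P.k₀) P.k₀ := by
    simpa using hasDerivAt_pow 2 P.k₀
  have hfd : HasFDerivAt P.f (fderiv ℝ P.f (P.φ₀ ζ)) (φ P.k₀ ζ) := by
    rw [hf.φ_eq]
    exact (h.smooth.differentiable (by simp) (P.φ₀ ζ)).hasFDerivAt
  have df := hfd.comp_hasDerivAt P.k₀ d0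
  have hE := ((dsq.smul (hasDerivAt_mulVec P.D d2)).add (dom.smul d1)).add df
  -- The profile equation is available for `k` near `k₀`, where `k ≠ 0`; this suffices for its
  -- derivative at `k₀`.
  have hz := hE.unique ((hasDerivAt_const P.k₀ (0 : Fin n → ℝ)).congr_of_eventuallyEq (by
    filter_upwards [hI.mem_nhds hk, isOpen_ne.mem_nhds h.k₀_ne_zero] with k hkI hk0
    exact (hf.waveTrain k hkI).profile hk0 ζ))
  rw [hf.φ_eq, hf.ω_eq] at hz
  rw [← hz]
  module

/-! ### Smooth functions in the domain of the Bloch operators -/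

lemma periodic_deriv {E : Type*} [NormedAddCommGroup E] [NormedSpace ℝ E] {u : ℝ → E}
    (hu : Function.Periodic u 1) : Function.Periodic (deriv u) 1 := fun x => by
  rw [← deriv_comp_add_const]
  congr 1
  exact funext hu

instance : IsFiniteMeasure cell := by unfold cell; infer_instance

lemma IsL2per.of_continuous {u : ℝ → Fin n → ℂ} (hu : Continuous u) (hp : Function.Periodic u 1) :
    IsL2per u := by
  obtain ⟨M, hM⟩ := (isCompact_Icc (a := (0 : ℝ)) (b := 1)).exists_bound_of_continuousOn
    hu.continuousOn
  refine ⟨hp, MemLp.of_bound hu.aestronglyMeasurable M ?_⟩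
  unfold cell
  filter_upwards [ae_restrict_mem measurableSet_Ioc] with x hx using hM x (Ioc_subset_Icc_self hx)

lemma IsH2per.of_smooth {u : ℝ → Fin n → ℂ} (hu : ContDiff ℝ ∞ u) (hp : Function.Periodic u 1) :
    IsH2per u (deriv u) (deriv (deriv u)) := by
  have h1 := (contDiff_infty_iff_deriv.1 hu).2
  have h2 := (contDiff_infty_iff_deriv.1 h1).2
  refine ⟨hp, fun x => (hu.differentiable (by simp) x).hasDerivAt, fun x => ?_,
    .of_continuous h2.continuous (periodic_deriv (periodic_deriv hp))⟩
  rw [intervalIntegral.integral_deriv_eq_sub (fun y _ => h1.differentiable (by simp) y)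
    (h2.continuous.intervalIntegrable _ _)]
  abel

lemma toC_add (v w : Fin n → ℝ) : toC (v + w) = toC v + toC w := by
  funext j; simp [toC]

lemma toC_smul (r : ℝ) (w : Fin n → ℝ) : toC (r • w) = (r : ℂ) • toC w := by
  funext j; simp [toC]

lemma toC_zero : toC (0 : Fin n → ℝ) = 0 := by
  funext j; simp [toC]

lemma Data.DC_mulVec_toC (P : Data n) (w : Fin n → ℝ) : P.DC *ᵥ toC w = toC (P.D *ᵥ w) := by
  funext j
  simp [Data.DC, toC, Matrix.mulVec, dotProduct]

lemma Data.jac_mulVec_toC (P : Data n) (ζ : ℝ) (w : Fin n → ℝ) :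
    P.jac ζ *ᵥ toC w = toC (fderiv ℝ P.f (P.φ₀ ζ) w) := by
  have h : fderiv ℝ P.f (P.φ₀ ζ) w =
      LinearMap.toMatrix' (fderiv ℝ P.f (P.φ₀ ζ)).toLinearMap *ᵥ w := by
    rw [LinearMap.toMatrix'_mulVec]; rfl
  rw [h]
  funext j
  simp [Data.jac, toC, Matrix.mulVec, dotProduct]

/-- Componentwise embedding of `ℝⁿ` into `ℂⁿ`, as a continuous linear map. -/
def toCL : (Fin n → ℝ) →L[ℝ] (Fin n → ℂ) :=
  ContinuousLinearMap.pi fun j => Complex.ofRealCLM.comp (ContinuousLinearMap.proj j)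

lemma contDiff_toC {u : ℝ → Fin n → ℝ} (hu : ContDiff ℝ ∞ u) : ContDiff ℝ ∞ (fun x => toC (u x)) :=
  toCL.contDiff.comp hu

lemma hasDerivAt_toC {u : ℝ → Fin n → ℝ} {u' : Fin n → ℝ} {x : ℝ} (hu : HasDerivAt u u' x) :
    HasDerivAt (fun x => toC (u x)) (toC u') x :=
  toCL.hasFDerivAt.comp_hasDerivAt x hu

lemma deriv_toC_add_smul {u w : ℝ → Fin n → ℝ} (hu : ContDiff ℝ ∞ u) (hw : ContDiff ℝ ∞ w) (c : ℂ) :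
    deriv (fun x => toC (u x) + c • toC (w x)) = fun x => toC (deriv u x) + c • toC (deriv w x) := by
  funext x
  have h₁ := hasDerivAt_toC (hu.differentiable (by simp) x).hasDerivAt
  have h₂ := hasDerivAt_toC (hw.differentiable (by simp) x).hasDerivAt
  exact (h₁.add (h₂.const_smul c)).deriv

lemma contDiff_mulVec (D : Matrix (Fin n) (Fin n) ℝ) {u : ℝ → Fin n → ℝ} (hu : ContDiff ℝ ∞ u) :
    ContDiff ℝ ∞ (fun x => D *ᵥ u x) :=
  (LinearMap.toContinuousLinearMap (Matrix.mulVecLin D)).contDiff.comp hu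

/-! ### The pairing -/

lemma innerL2_smul_right (ψ u : ℝ → Fin n → ℂ) (c : ℂ) :
    innerL2 ψ (fun ζ => c • u ζ) = c * innerL2 ψ u := by
  unfold innerL2
  rw [← integral_const_mul]
  congr with ζ
  rw [dotProduct_smul, smul_eq_mul]

lemma innerL2_smul_left (ψ u : ℝ → Fin n → ℂ) (c : ℂ) :
    innerL2 (fun ζ => c • ψ ζ) u = star c * innerL2 ψ u := by
  unfold innerL2
  rw [← integral_const_mul]
  congr with ζ
  rw [star_smul, smul_dotProduct, smul_eq_mul]

lemma integrableOn_dotProduct {ψ u : ℝ → Fin n → ℂ} (hψ : Continuous ψ) (hu : Continuous u) :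
    IntegrableOn (fun ζ => star (ψ ζ) ⬝ᵥ u ζ) (Ioc (0 : ℝ) 1) := by
  have : Continuous (fun ζ => star (ψ ζ) ⬝ᵥ u ζ) := hψ.star.dotProduct hu
  exact (this.integrableOn_Icc).mono_set Ioc_subset_Icc_self

lemma innerL2_add_right {ψ u w : ℝ → Fin n → ℂ} (hψ : Continuous ψ) (hu : Continuous u)
    (hw : Continuous w) : innerL2 ψ (fun ζ => u ζ + w ζ) = innerL2 ψ u + innerL2 ψ w := by
  unfold innerL2
  rw [← integral_add (integrableOn_dotProduct hψ hu) (integrableOn_dotProduct hψ hw)]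
  congr with ζ
  rw [dotProduct_add]

/-! ### A trial eigenfunction -/

/-- The first-order approximation `φ₀' + iξk₀ ∂ₖφ` of the critical eigenfunction. -/
def Data.trial (P : Data n) (ψ : ℝ → Fin n → ℝ) (ξ ζ : ℝ) : Fin n → ℂ :=
  toC (deriv P.φ₀ ζ) + (Complex.I * ξ * P.k₀) • toC (ψ ζ)

/-- The second-order part of the residual of the trial eigenfunction. -/
def Data.resid₀ (P : Data n) (a : ℝ) (ψ : ℝ → Fin n → ℝ) (ζ : ℝ) : Fin n → ℂ :=
  toC (P.k₀ ^ 2 • (P.D *ᵥ deriv P.φ₀ ζ + (2 * P.k₀) • (P.D *ᵥ deriv ψ ζ))) +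
    ((P.k₀ * (P.ω₀ - a) : ℝ) : ℂ) • toC (ψ ζ)

/-- The third-order part of the residual of the trial eigenfunction. -/
def Data.resid₁ (P : Data n) (ψ : ℝ → Fin n → ℝ) (ζ : ℝ) : Fin n → ℂ :=
  (Complex.I * P.k₀ ^ 3) • toC (P.D *ᵥ ψ ζ)

section Trial

variable {P : Data n} {Ψ₀ : ℝ → Fin n → ℂ} {r₀ : ℝ} {φ : ℝ → ℝ → Fin n → ℝ} {om : ℝ → ℝ}

lemma Data.IsFamily.k₀_mem (hf : P.IsFamily Ψ₀ r₀ φ om) : P.k₀ ∈ Ioo (P.k₀ - r₀) (P.k₀ + r₀) :=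
  ⟨by linarith [hf.r₀_mem.1], by linarith [hf.r₀_mem.1]⟩

lemma Data.IsFamily.contDiff_dk (hf : P.IsFamily Ψ₀ r₀ φ om) : ContDiff ℝ ∞ (dk φ P.k₀) :=
  contDiff_deriv_fst isOpen_Ioo hf.φ_smooth hf.k₀_mem

lemma Data.IsFamily.periodic_dk (hf : P.IsFamily Ψ₀ r₀ φ om) :
    Function.Periodic (dk φ P.k₀) 1 := fun ζ => by
  refine Filter.EventuallyEq.deriv_eq ?_
  filter_upwards [isOpen_Ioo.mem_nhds hf.k₀_mem] with k hk
  exact (hf.waveTrain k hk).periodic ζ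

lemma Data.H1.contDiff_deriv (h : P.H1) : ContDiff ℝ ∞ (deriv P.φ₀) :=
  (contDiff_infty_iff_deriv.1 h.waveTrain.smooth).2

lemma Data.contDiff_trial (h : P.H1) {ψ : ℝ → Fin n → ℝ} (hψ : ContDiff ℝ ∞ ψ) (ξ : ℝ) :
    ContDiff ℝ ∞ (P.trial ψ ξ) :=
  (contDiff_toC h.contDiff_deriv).add ((contDiff_toC hψ).const_smul _)

lemma Data.contDiff_resid₀ (h : P.H1) {ψ : ℝ → Fin n → ℝ} (hψ : ContDiff ℝ ∞ ψ) (a : ℝ) :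
    ContDiff ℝ ∞ (P.resid₀ a ψ) := by
  have hψ' := (contDiff_infty_iff_deriv.1 hψ).2
  exact (contDiff_toC (((contDiff_mulVec P.D h.contDiff_deriv).add
    ((contDiff_mulVec P.D hψ').const_smul _)).const_smul _)).add ((contDiff_toC hψ).const_smul _)

lemma Data.contDiff_resid₁ {ψ : ℝ → Fin n → ℝ} (hψ : ContDiff ℝ ∞ ψ) :
    ContDiff ℝ ∞ (P.resid₁ ψ) :=
  (contDiff_toC (contDiff_mulVec P.D hψ)).const_smul _

/-- Order by order in `ξ`: at order zero `ℒ(0)φ₀' = 0`. At order one the equation for `∂ₖφ` replaces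
`k₀ℒ(0)∂ₖφ` by `-2k₀²Dφ₀'' - k₀ω'(k₀)φ₀'`, which cancels the second derivative and leaves `iaφ₀'`.
Subtracting `iaξ` times the whole trial function puts `k₀(ω₀ - a)∂ₖφ` into the second-order
residual. All profiles have period one, so `∂ₖφ` is periodic and the trial function lies in the
domain. -/
lemma Data.IsFamily.bloch_trial (h : P.H1) (hf : P.IsFamily Ψ₀ r₀ φ om) {a : ℝ}
    (ha : a = P.coeffA om) (ξ : ℝ) :
    P.Bloch ξ (P.trial (dk φ P.k₀) ξ) (fun ζ =>
      (Complex.I * a * ξ) • P.trial (dk φ P.k₀) ξ ζ +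
        (-((ξ : ℂ) ^ 2)) • (P.resid₀ a (dk φ P.k₀) ζ + (ξ : ℂ) • P.resid₁ (dk φ P.k₀) ζ)) := by
  set ψ := dk φ P.k₀
  have hψ : ContDiff ℝ ∞ ψ := hf.contDiff_dk
  have hψp : Function.Periodic ψ 1 := hf.periodic_dk
  have hφp := h.waveTrain.periodic
  have hψ1 := (contDiff_infty_iff_deriv.1 hψ).2
  have hφ1 := h.contDiff_deriv
  have hφ2 := (contDiff_infty_iff_deriv.1 hφ1).2
  have htr := P.contDiff_trial h hψ ξ
  have htp : Function.Periodic (P.trial ψ ξ) 1 := fun ζ => by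
    simp only [Data.trial, periodic_deriv hφp ζ, hψp ζ]
  have hd1 : deriv (P.trial ψ ξ) = fun ζ =>
      toC (deriv (deriv P.φ₀) ζ) + (Complex.I * ξ * P.k₀) • toC (deriv ψ ζ) :=
    deriv_toC_add_smul hφ1 hψ _
  have hd2 : deriv (deriv (P.trial ψ ξ)) = fun ζ =>
      toC (deriv (deriv (deriv P.φ₀)) ζ) + (Complex.I * ξ * P.k₀) • toC (deriv (deriv ψ) ζ) := by
    rw [hd1]
    exact deriv_toC_add_smul hφ2 hψ1 _
  have hH := IsH2per.of_smooth htr htp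
  rw [hd2, hd1] at hH
  refine ⟨.of_continuous ?_ ?_, _, _, hH, Filter.Eventually.of_forall fun ζ => ?_⟩
  · have c₁ := htr.continuous
    have c₂ := (P.contDiff_resid₀ h hψ a).continuous
    have c₃ := (P.contDiff_resid₁ hψ).continuous
    fun_prop
  · intro ζ
    simp only [htp ζ, Data.resid₀, Data.resid₁, periodic_deriv hφp ζ, periodic_deriv hψp ζ, hψp ζ]
  · have e1 := congrArg toC (h.linearized_deriv ζ)
    have e2 := congrArg toC (hf.linearized_dk h ζ)
    rw [show dk φ P.k₀ = ψ from rfl] at e2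
    have hak : (a : ℂ) = P.ω₀ - P.k₀ * ((deriv om P.k₀ : ℝ) : ℂ) := by
      rw [ha, Data.coeffA]; push_cast; rfl
    simp only [Data.trial, Data.resid₀, Data.resid₁, Matrix.mulVec_add,
      Matrix.mulVec_smul, P.DC_mulVec_toC, P.jac_mulVec_toC, toC_add, toC_smul, toC_zero] at e1 e2 ⊢
    funext j
    have e1j := congrFun e1 j
    have e2j := congrFun e2 j
    simp only [Pi.add_apply, Pi.smul_apply, Pi.zero_apply, smul_eq_mul] at e1j e2j ⊢
    push_cast at e1j e2j ⊢
    rw [hak]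
    -- The two linearized equations are combined as in the trial function, with weights `1` and
    -- `iξk₀`; the multiple of `Complex.I_sq` collects the terms containing `I²`.
    linear_combination -e1j - Complex.I * ξ * P.k₀ * e2j +
      (-(P.k₀ ^ 2 * ((deriv om P.k₀ : ℝ) : ℂ) * ξ ^ 2 * toC (ψ ζ) j)
        - 2 * P.k₀ ^ 3 * ξ ^ 2 * toC (P.D *ᵥ deriv ψ ζ) j
        - P.k₀ ^ 2 * ξ ^ 2 * (toC (P.D *ᵥ deriv P.φ₀ ζ) j
          + Complex.I * ξ * P.k₀ * toC (P.D *ᵥ ψ ζ) j)) * Complex.I_sq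

end Trial

/-! ### Reality of the adjoint eigenfunction at frequency zero -/

lemma innerL2_star (ψ u : ℝ → Fin n → ℂ) :
    innerL2 (fun ζ => star (ψ ζ)) (fun ζ => star (u ζ)) = star (innerL2 ψ u) := by
  unfold innerL2
  rw [← starRingEnd_apply, ← integral_conj]
  congr with ζ
  rw [starRingEnd_apply, Matrix.star_dotProduct, star_star, dotProduct_comm]

lemma IsL2per.star {u : ℝ → Fin n → ℂ} (hu : IsL2per u) : IsL2per (fun ζ => star (u ζ)) := by
  refine ⟨fun ζ => by simp only [hu.1 ζ], ?_⟩
  refine hu.2.mono (continuous_star.comp_aestronglyMeasurable hu.2.1)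
    (Filter.Eventually.of_forall fun ζ => ?_)
  rw [norm_star]

lemma star_toC (w : Fin n → ℝ) : star (toC w) = toC w := by
  funext j; simp [toC]

lemma IsH2per.star {u u₁ u₂ : ℝ → Fin n → ℂ} (h : IsH2per u u₁ u₂) :
    IsH2per (fun ζ => star (u ζ)) (fun ζ => star (u₁ ζ)) (fun ζ => star (u₂ ζ)) := by
  refine ⟨fun ζ => by simp only [h.periodic ζ], fun x => (h.hasDerivAt x).star, fun x => ?_,
    h.memL2.star⟩
  have hs := fun s : Set ℝ => (starL' ℝ (A := Fin n → ℂ)).integral_comp_comm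
    (μ := volume.restrict s) u₂
  simp only [starL'_apply] at hs
  rw [h.integral_eq x, star_add]
  unfold intervalIntegral
  rw [hs, hs, star_sub]

lemma star_map_ofReal_mulVec (A : Matrix (Fin n) (Fin n) ℝ) (w : Fin n → ℂ) :
    star (A.map Complex.ofReal *ᵥ w) = A.map Complex.ofReal *ᵥ star w := by
  funext j
  simp [Matrix.mulVec, dotProduct]

/-- At `ξ = 0` the operator has real coefficients and commutes with conjugation. -/
lemma Data.Bloch.star {P : Data n} {u w : ℝ → Fin n → ℂ} (h : P.Bloch 0 u w) :
    P.Bloch 0 (fun ζ => star (u ζ)) (fun ζ => star (w ζ)) := by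
  obtain ⟨hw, u₁, u₂, hu, he⟩ := h
  refine ⟨hw.star, _, _, hu.star, ?_⟩
  filter_upwards [he] with ζ hζ
  rw [hζ]
  simp [Data.DC, Data.jac, star_map_ofReal_mulVec, star_smul]

/-- The pairing of the adjoint eigenfunction at frequency zero with a real function is real. -/
lemma Data.IsCriticalCurve.star_innerL2 {P : Data n} {ξ₀ : ℝ} {lamc : ℝ → ℂ}
    {Φ Ψ : ℝ → ℝ → Fin n → ℂ} (h : P.IsCriticalCurve ξ₀ lamc Φ Ψ) (h0 : lamc 0 = 0)
    (w : ℝ → Fin n → ℝ) :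
    star (innerL2 (Ψ 0) (fun ζ => toC (w ζ))) = innerL2 (Ψ 0) (fun ζ => toC (w ζ)) := by
  have hmem : (0 : ℝ) ∈ Ioo (-ξ₀) ξ₀ := ⟨by linarith [h.ξ₀_mem.1], h.ξ₀_mem.1⟩
  have hΨ := h.adjoint_eigen 0 hmem
  rw [h0, star_zero] at hΨ
  -- The conjugate of `Ψ 0` also lies in the kernel of the adjoint, which is one-dimensional.
  obtain ⟨c, hc⟩ := hΨ.geometric (fun ζ => star (Ψ 0 ζ)) (by
    refine ⟨hΨ.eigen.1.star, ?_, fun u w huw => ?_⟩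
    · simpa using hΨ.eigen.2.1
    · have h1 := hΨ.eigen.2.2 _ _ huw.star
      rw [innerL2_smul_left, star_zero, zero_mul] at h1
      have h2 := innerL2_star (Ψ 0) (fun ζ => star (w ζ))
      simp only [star_star, h1, star_zero] at h2
      rw [innerL2_smul_left, star_zero, zero_mul, h2])
  have key : ∀ w : ℝ → Fin n → ℝ, star (innerL2 (Ψ 0) (fun ζ => toC (w ζ))) =
      star c * innerL2 (Ψ 0) (fun ζ => toC (w ζ)) := fun w => by
    rw [← innerL2_star, ← innerL2_smul_left]
    unfold innerL2
    refine integral_congr_ae (ae_restrict_of_ae ?_)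
    filter_upwards [hc] with ζ hζ
    rw [hζ, star_toC]
  -- The normalization against the real function `φ₀'` forces the factor `c` to be `1`.
  have h1 := h.Ψ_normalized 0 hmem
  rw [h.Φ_zero] at h1
  have h2 := key (deriv P.φ₀)
  change star (innerL2 (Ψ 0) P.dφ₀) = star c * innerL2 (Ψ 0) P.dφ₀ at h2
  rw [h1, star_one, mul_one] at h2
  rw [key w, ← h2, one_mul]

/-! ### The symbols of the principal part -/

/-- Points outside the interval lie off the closed support of `ρ`, so the product is locally zero
there, whatever values `F` takes. -/
lemma contDiff_cutoff_mul {E : Type*} [NormedAddCommGroup E] [NormedSpace ℝ E] {r : ℝ} {ρ : ℝ → ℝ}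
    (hρ : ContDiff ℝ ∞ ρ) (hs : tsupport ρ ⊆ Ioo (-r) r) {F : ℝ × E → ℂ}
    (hF : ContDiffOn ℝ ∞ F (Ioo (-r) r ×ˢ univ)) :
    ContDiff ℝ ∞ (fun p : ℝ × E => (ρ p.1 : ℂ) * F p) := by
  refine contDiff_iff_contDiffAt.2 fun p => ?_
  have hρc : ContDiff ℝ ∞ (fun p : ℝ × E => (ρ p.1 : ℂ)) :=
    Complex.ofRealCLM.contDiff.comp (hρ.comp contDiff_fst)
  by_cases hp : p.1 ∈ Ioo (-r) r
  · exact hρc.contDiffAt.mul (hF.contDiffAt ((isOpen_Ioo.prod isOpen_univ).mem_nhds ⟨hp, mem_univ _⟩))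
  · have h1 : ∀ᶠ q : ℝ × E in nhds p, ρ q.1 = 0 :=
      continuous_fst.continuousAt.eventually (notMem_tsupport_iff_eventuallyEq.1 fun h => hp (hs h))
    refine (contDiffAt_const (c := (0 : ℂ))).congr_of_eventuallyEq ?_
    filter_upwards [h1] with q hq
    simp [hq]

lemma cutoff_eq_zero {r : ℝ} {ρ : ℝ → ℝ} (hs : tsupport ρ ⊆ Ioo (-r) r) {ξ : ℝ} (hξ : r ≤ |ξ|) :
    ρ ξ = 0 := by
  by_contra hne
  have := hs (subset_tsupport ρ hne)
  exact absurd (abs_lt.2 this) (not_lt.2 hξ)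

/-- The components of the symbol `ρ(ξ) Ψ_ξ(x)^*`. -/
def adjSymb (ρ : ℝ → ℝ) (Ψ : ℝ → ℝ → Fin n → ℂ) (i : Fin n) (ξ x : ℝ) : ℂ :=
  (ρ ξ : ℂ) * star (Ψ ξ x i)

section Curve

variable {P : Data n} {ξ₀ : ℝ} {lamc : ℝ → ℂ} {Φ Ψ : ℝ → ℝ → Fin n → ℂ} {ρ : ℝ → ℝ}

lemma Data.IsCriticalCurve.zero_mem (h : P.IsCriticalCurve ξ₀ lamc Φ Ψ) :
    (0 : ℝ) ∈ Ioo (-ξ₀) ξ₀ := ⟨by linarith [h.ξ₀_mem.1], h.ξ₀_mem.1⟩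

lemma Data.IsCriticalCurve.isSymb (h : P.IsCriticalCurve ξ₀ lamc Φ Ψ) (hρ : IsFreqCutoff ξ₀ ρ)
    (i : Fin n) : IsSymb ξ₀ (adjSymb ρ Ψ i) := by
  refine ⟨?_, fun ξ x hξ => ?_, fun ξ x => ?_⟩
  · refine contDiff_cutoff_mul (F := fun p : ℝ × ℝ => star (Ψ p.1 p.2 i)) hρ.smooth hρ.support ?_
    exact Complex.conjCLE.contDiff.comp_contDiffOn
      ((contDiff_apply ℝ ℂ i).comp_contDiffOn h.Ψ_smooth)
  · simp [adjSymb, cutoff_eq_zero hρ.support hξ]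
  · by_cases hξ : ξ ∈ Ioo (-ξ₀) ξ₀
    · simp only [adjSymb, (h.adjoint_eigen ξ hξ).eigen.1.1 x]
    · have : ξ₀ ≤ |ξ| := by
        by_contra hcon
        exact hξ (abs_lt.1 (not_le.1 hcon))
      simp [adjSymb, cutoff_eq_zero hρ.support this]

lemma Data.IsCriticalCurve.continuous_Ψ (h : P.IsCriticalCurve ξ₀ lamc Φ Ψ) {ξ : ℝ}
    (hξ : ξ ∈ Ioo (-ξ₀) ξ₀) : Continuous (Ψ ξ) :=
  (contDiff_slice isOpen_Ioo h.Ψ_smooth hξ).continuous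

/-- Near `ξ = 0` the cut-off equals one, so `Ψ` may be replaced by the globally smooth symbols `ρ
Ψ^*`. -/
lemma Data.IsCriticalCurve.continuousAt_innerL2 (h : P.IsCriticalCurve ξ₀ lamc Φ Ψ)
    (hρ : IsFreqCutoff ξ₀ ρ) {u : ℝ → Fin n → ℂ} (hu : Continuous u) :
    ContinuousAt (fun ξ => innerL2 (Ψ ξ) u) 0 := by
  have hc : Continuous fun ξ => ∫ x in Icc (0 : ℝ) 1, ∑ i, adjSymb ρ Ψ i ξ x * u x i := by
    refine continuous_parametric_integral_of_continuous (f := fun ξ x => ∑ i, adjSymb ρ Ψ i ξ x * u x i)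
      ?_ isCompact_Icc
    refine continuous_finsetSum _ fun i _ => ?_
    exact (h.isSymb hρ i).smooth.continuous.mul
      ((continuous_apply i).comp (hu.comp continuous_snd))
  refine hc.continuousAt.congr ?_
  have hpos : 0 < ξ₀ / 2 := by linarith [h.ξ₀_mem.1]
  filter_upwards [Metric.ball_mem_nhds (0 : ℝ) hpos] with ξ hξ
  have h1 : ρ ξ = 1 := hρ.eq_one ξ (by simpa using hξ)
  rw [integral_Icc_eq_integral_Ioc]
  unfold innerL2
  congr with x
  simp [adjSymb, h1, dotProduct]

lemma Data.IsCriticalCurve.innerL2_bloch (h : P.IsCriticalCurve ξ₀ lamc Φ Ψ) {ξ : ℝ}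
    (hξ : ξ ∈ Ioo (-ξ₀) ξ₀) {u w : ℝ → Fin n → ℂ} (huw : P.Bloch ξ u w) :
    innerL2 (Ψ ξ) w = lamc ξ * innerL2 (Ψ ξ) u := by
  have := (h.adjoint_eigen ξ hξ).eigen.2.2 u w huw
  rwa [innerL2_smul_left, star_star] at this

/-- Critical eigenvalues belong to the spectrum. -/
lemma Data.IsCriticalCurve.not_inResolvent (h : P.IsCriticalCurve ξ₀ lamc Φ Ψ) {ξ : ℝ}
    (hξ : ξ ∈ Ioo (-ξ₀) ξ₀) : ¬ InResolvent (P.Bloch ξ) (lamc ξ) := by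
  rintro ⟨C, hC⟩
  have hz : IsL2per (fun _ => (0 : Fin n → ℂ)) := .of_continuous continuous_const fun _ => rfl
  -- With zero right-hand side both `Φ ξ` and `0` are solutions, contrary to uniqueness.
  obtain ⟨u, -, -, hu⟩ := hC (fun _ => 0) hz
  have h1 := hu (Φ ξ) (by simpa using (h.eigen ξ hξ).eigen)
  have h2 := hu (fun _ => 0) (by
    refine ⟨by simpa using hz, fun _ => 0, fun _ => 0, ⟨fun _ => rfl, fun x => hasDerivAt_const _ _,
      fun x => by simp, hz⟩, Filter.Eventually.of_forall fun ζ => by simp⟩)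
  exact (h.eigen ξ hξ).ne_zero (h1.trans h2.symm)

lemma Data.IsCriticalCurve.exists_re_le (h : P.IsCriticalCurve ξ₀ lamc Φ Ψ) (hD2 : P.D2) :
    ∃ θ : ℝ, 0 < θ ∧ ∀ ξ ∈ Ioo (-ξ₀) ξ₀, (lamc ξ).re ≤ -θ * ξ ^ 2 := by
  obtain ⟨θ, hθ, hs⟩ := hD2
  have hpi := h.ξ₀_mem.2
  exact ⟨θ, hθ, fun ξ hξ => hs ξ ⟨by linarith [hξ.1], by linarith [hξ.2]⟩ _ (h.not_inResolvent hξ)⟩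

variable {r₀ : ℝ} {φ : ℝ → ℝ → Fin n → ℝ} {om : ℝ → ℝ} {a : ℝ}

/-- The pairing of the trial eigenfunction with the adjoint eigenfunctions. -/
lemma Data.IsCriticalCurve.dispersion_identity (h : P.IsCriticalCurve ξ₀ lamc Φ Ψ) (hH : P.H1)
    (hf : P.IsFamily (Ψ 0) r₀ φ om) (ha : a = P.coeffA om) {ξ : ℝ} (hξ : ξ ∈ Ioo (-ξ₀) ξ₀) :
    (lamc ξ - Complex.I * a * ξ) * (innerL2 (Ψ ξ) P.dφ₀ +
        Complex.I * ξ * P.k₀ * innerL2 (Ψ ξ) (fun ζ => toC (dk φ P.k₀ ζ))) =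
      -(ξ : ℂ) ^ 2 * (innerL2 (Ψ ξ) (P.resid₀ a (dk φ P.k₀)) +
        ξ * innerL2 (Ψ ξ) (P.resid₁ (dk φ P.k₀))) := by
  have hψ := hf.contDiff_dk
  have cΨ := h.continuous_Ψ hξ
  have c₁ := (P.contDiff_trial hH hψ ξ).continuous
  have c₂ := (P.contDiff_resid₀ hH hψ a).continuous
  have c₃ := (P.contDiff_resid₁ hψ).continuous
  have c₄ := (contDiff_toC hH.contDiff_deriv).continuous
  have c₅ := (contDiff_toC hψ).continuous
  have e := h.innerL2_bloch hξ (hf.bloch_trial hH ha ξ)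
  rw [innerL2_add_right cΨ (by fun_prop) (by fun_prop), innerL2_smul_right, innerL2_smul_right,
    innerL2_add_right cΨ c₂ (by fun_prop), innerL2_smul_right] at e
  have et : innerL2 (Ψ ξ) (P.trial (dk φ P.k₀) ξ) = innerL2 (Ψ ξ) P.dφ₀ +
      Complex.I * ξ * P.k₀ * innerL2 (Ψ ξ) (fun ζ => toC (dk φ P.k₀ ζ)) := by
    unfold Data.trial
    rw [innerL2_add_right cΨ c₄ (by fun_prop), innerL2_smul_right]
    rfl
  rw [et] at e
  linear_combination -e

end Curve

/-! ### The dispersion relation -/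

/-- Division of an analytic function by `ξ²`. -/
lemma exists_sq_factor {r : ℝ} (hr : 0 < r) {f N Q : ℝ → ℂ} (hf : AnalyticOnNhd ℝ f (Ioo (-r) r))
    (hN : ContinuousAt N 0) (hQ : ContinuousAt Q 0) (hN0 : N 0 = 1)
    (he : ∀ ξ ∈ Ioo (-r) r, f ξ * N ξ = -(ξ : ℂ) ^ 2 * Q ξ) :
    ∃ ν : ℝ → ℂ, ContDiffOn ℝ ∞ ν (Ioo (-r) r) ∧ (∀ ξ, f ξ = (ξ : ℂ) ^ 2 * ν ξ) ∧ ν 0 = -Q 0 := by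
  have hmem : (0 : ℝ) ∈ Ioo (-r) r := ⟨by linarith, hr⟩
  have hnhds : ∀ᶠ ξ in nhdsWithin (0 : ℝ) {0}ᶜ, ξ ∈ Ioo (-r) r ∧ ξ ≠ 0 :=
    (eventually_nhdsWithin_of_eventually_nhds (isOpen_Ioo.mem_nhds hmem)).and self_mem_nhdsWithin
  have hf0 : f 0 = 0 := by simpa [hN0] using he 0 hmem
  -- Removing a factor `ξ` by `dslope` preserves analyticity at `0`. Since `N` and `Q` are only
  -- continuous there, the values of `g` and of the next quotient at `0` come from limits of the
  -- identity divided by `ξ` and by `ξ²`.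
  set g := dslope f 0
  obtain ⟨p, hp⟩ := hf 0 hmem
  have hgp := hp.has_fpower_series_dslope_fslope
  have hgc : ContinuousAt g 0 := hgp.continuousAt
  have hfg : ∀ ξ, f ξ = (ξ : ℂ) * g ξ := fun ξ => by
    have := sub_smul_dslope f 0 ξ
    rw [hf0, sub_zero, sub_zero, Complex.real_smul] at this
    exact this.symm
  have hg0 : g 0 = 0 := by
    have h1 : Filter.Tendsto (fun ξ => g ξ * N ξ) (nhdsWithin (0 : ℝ) {0}ᶜ) (nhds (g 0 * N 0)) :=
      (hgc.mul hN).tendsto.mono_left nhdsWithin_le_nhds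
    have h2 : Filter.Tendsto (fun ξ : ℝ => -(ξ : ℂ) * Q ξ) (nhdsWithin (0 : ℝ) {0}ᶜ)
        (nhds (-((0 : ℝ) : ℂ) * Q 0)) :=
      ((Complex.continuous_ofReal.continuousAt.neg).mul hQ).tendsto.mono_left nhdsWithin_le_nhds
    have h3 := tendsto_nhds_unique (h1.congr' (by
      filter_upwards [hnhds] with ξ hξ
      have hc : (ξ : ℂ) ≠ 0 := by exact_mod_cast hξ.2
      have := he ξ hξ.1
      rw [hfg ξ] at this
      refine mul_left_cancel₀ hc ?_
      linear_combination this)) h2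
    simpa [hN0] using h3
  set ν := dslope g 0
  have hνp := hgp.has_fpower_series_dslope_fslope
  have hνc : ContinuousAt ν 0 := hνp.continuousAt
  have hgν : ∀ ξ, g ξ = (ξ : ℂ) * ν ξ := fun ξ => by
    have := sub_smul_dslope g 0 ξ
    rw [hg0, sub_zero, sub_zero, Complex.real_smul] at this
    exact this.symm
  have hfν : ∀ ξ, f ξ = (ξ : ℂ) ^ 2 * ν ξ := fun ξ => by rw [hfg, hgν]; ring
  refine ⟨ν, fun ξ hξ => ?_, hfν, ?_⟩
  · by_cases h0 : ξ = 0
    · subst h0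
      exact hνp.analyticAt.contDiffAt.contDiffWithinAt
    · have h1 : ContDiffAt ℝ ∞ (fun ξ : ℝ => ((ξ : ℂ) ^ 2)⁻¹ * f ξ) ξ := by
        refine ContDiffAt.mul (ContDiffAt.inv (Complex.ofRealCLM.contDiff.pow 2).contDiffAt ?_)
          (hf ξ hξ).contDiffAt
        exact pow_ne_zero 2 (by exact_mod_cast h0)
      refine (h1.congr_of_eventuallyEq ?_).contDiffWithinAt
      filter_upwards [isOpen_ne.mem_nhds h0] with η hη
      have hc : (η : ℂ) ≠ 0 := by exact_mod_cast hη
      rw [hfν η]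
      field_simp
  · have h1 : Filter.Tendsto (fun ξ => ν ξ * N ξ) (nhdsWithin (0 : ℝ) {0}ᶜ) (nhds (ν 0 * N 0)) :=
      (hνc.mul hN).tendsto.mono_left nhdsWithin_le_nhds
    have h2 : Filter.Tendsto (fun ξ : ℝ => -Q ξ) (nhdsWithin (0 : ℝ) {0}ᶜ) (nhds (-Q 0)) :=
      hQ.neg.tendsto.mono_left nhdsWithin_le_nhds
    have h3 := tendsto_nhds_unique (h1.congr' (by
      filter_upwards [hnhds] with ξ hξ
      have hc : (ξ : ℂ) ≠ 0 := by exact_mod_cast hξ.2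
      have := he ξ hξ.1
      rw [hfν ξ] at this
      refine mul_left_cancel₀ (pow_ne_zero 2 hc) ?_
      linear_combination this)) h2
    simpa [hN0] using h3

/-- Globally defined extension of the reduced dispersion relation. -/
lemma exists_isDiffusive {r θ : ℝ} {ν : ℝ → ℂ} {ρ : ℝ → ℝ} (hr : 0 < r) (hθ : 0 < θ)
    (hν : ContDiffOn ℝ ∞ ν (Ioo (-r) r)) (hre : ∀ ξ ∈ Ioo (-r) r, (ν ξ).re ≤ -θ)
    (hs : tsupport ρ ⊆ Ioo (-r) r) (h0 : ρ 0 ≠ 0) :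
    ∃ (N : ℝ) (ν' : ℝ → ℂ), IsDiffusive θ N ν' ∧ ∀ ξ, ρ ξ ≠ 0 → ν' ξ = ν ξ := by
  have hcomp : IsCompact (tsupport ρ) :=
    (isCompact_Icc (a := -r) (b := r)).of_isClosed_subset (isClosed_tsupport ρ)
      (hs.trans Ioo_subset_Icc_self)
  obtain ⟨ξ₁, hξ₁, hmax⟩ := hcomp.exists_isMaxOn ⟨0, subset_tsupport ρ h0⟩
    continuous_abs.continuousOn
  have h1 : |ξ₁| < r := abs_lt.2 (hs hξ₁)
  -- The point `ξ₁` is the farthest one in the support of `ρ`; both radii lie strictly between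
  -- `|ξ₁|` and `r`.
  let σ : ContDiffBump (0 : ℝ) :=
    ⟨(|ξ₁| + r) / 2, (|ξ₁| + 3 * r) / 4, by positivity, by linarith⟩
  have hσs : tsupport σ ⊆ Ioo (-r) r := by
    rw [σ.tsupport_eq]
    intro ξ hξ
    have h2 : |ξ| ≤ (|ξ₁| + 3 * r) / 4 := by simpa [σ] using hξ
    exact abs_lt.1 (by linarith)
  have hσ1 : ∀ ξ, ρ ξ ≠ 0 → σ ξ = 1 := fun ξ hξ => by
    refine σ.one_of_mem_closedBall ?_
    have h2 : |ξ| ≤ |ξ₁| := hmax (subset_tsupport ρ hξ)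
    have h3 : |ξ| ≤ (|ξ₁| + r) / 2 := by linarith
    simpa [σ] using h3
  have hsm : ContDiff ℝ ∞ (fun ξ : ℝ => (σ ξ : ℂ) * (ν ξ + θ)) := by
    have h2 := contDiff_cutoff_mul (E := ℝ) (F := fun p => ν p.1 + θ) (σ.contDiff (n := ⊤)) hσs
      ((hν.comp contDiffOn_fst fun p hp => hp.1).add contDiffOn_const)
    exact ContDiff.comp (f := fun ξ : ℝ => (ξ, (0 : ℝ))) h2 (contDiff_id.prodMk contDiff_const)
  have hsymb : IsSymb r (fun ξ _ => (σ ξ : ℂ) * (ν ξ + θ)) := IsSymb.of_smooth hsm fun ξ hξ => by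
    simp [cutoff_eq_zero hσs hξ]
  obtain ⟨M, hM⟩ := hsymb.exists_gaussBdd 4
  -- The extension `σν + (1 - σ)(-θ)` is a convex combination of two quantities whose real parts are
  -- at most `-θ`; outside the interval it equals `-θ`.
  refine ⟨M + ‖(-θ : ℂ)‖, fun ξ => (σ ξ : ℂ) * (ν ξ + θ) + -θ, ⟨hθ, hsm.add contDiff_const,
    ((hM 0).mono zero_le_one le_rfl).add (GaussBdd.const 4 _), fun ξ => ?_⟩, fun ξ hξ => ?_⟩
  · have h2 : ((σ ξ : ℂ) * (ν ξ + θ) + -θ).re = σ ξ * ((ν ξ).re + θ) - θ := by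
      rw [← Complex.ofReal_neg, Complex.add_re, Complex.re_ofReal_mul, Complex.add_re,
        Complex.ofReal_re, Complex.ofReal_re, sub_eq_add_neg]
    rw [h2]
    by_cases hξ : ξ ∈ Ioo (-r) r
    · have h3 := hre ξ hξ
      have h4 : 0 ≤ σ ξ := σ.nonneg
      nlinarith
    · have : r ≤ |ξ| := by
        by_contra hcon
        exact hξ (abs_lt.1 (not_le.1 hcon))
      rw [cutoff_eq_zero hσs this]
      simp
  · simp [hσ1 ξ hξ]

/-- The expansion `λ_c(ξ) = iaξ - dξ² + O(ξ³)` with `d > 0`, in terms of a global reduced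
dispersion relation. -/
theorem Data.IsCriticalCurve.exists_dispersion {P : Data n} {ξ₀ : ℝ} {lamc : ℝ → ℂ}
    {Φ Ψ : ℝ → ℝ → Fin n → ℂ} {ρ : ℝ → ℝ} {r₀ : ℝ} {φ : ℝ → ℝ → Fin n → ℝ} {om : ℝ → ℝ}
    {a d : ℝ} (h : P.IsCriticalCurve ξ₀ lamc Φ Ψ) (hH : P.H1) (hD2 : P.D2)
    (hf : P.IsFamily (Ψ 0) r₀ φ om) (hρ : IsFreqCutoff ξ₀ ρ) (ha : a = P.coeffA om)
    (hd : d = P.coeffD (Ψ 0) φ) :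
    0 < d ∧ ∃ (θ N : ℝ) (ν : ℝ → ℂ), IsDiffusive θ N ν ∧ ν 0 = -d ∧
      ∀ ξ, ρ ξ ≠ 0 → lamc ξ = Complex.I * a * ξ + disp ν ξ := by
  have hr := h.ξ₀_mem.1
  have hmem := h.zero_mem
  have hψ := hf.contDiff_dk
  have c₀ := (contDiff_toC hH.contDiff_deriv).continuous
  have c₁ := (contDiff_toC hψ).continuous
  have c₂ := (P.contDiff_resid₀ hH hψ a).continuous
  have c₃ := (P.contDiff_resid₁ hψ).continuous
  have hofReal : ContinuousAt (fun ξ : ℝ => (ξ : ℂ)) 0 := Complex.continuous_ofReal.continuousAt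
  have hnorm : innerL2 (Ψ 0) P.dφ₀ = 1 := by
    have := h.Ψ_normalized 0 hmem
    rwa [h.Φ_zero] at this
  have hid := fun ξ (hξ : ξ ∈ Ioo (-ξ₀) ξ₀) => h.dispersion_identity hH hf ha hξ
  have hfan : AnalyticOnNhd ℝ (fun ξ : ℝ => lamc ξ - Complex.I * a * ξ) (Ioo (-ξ₀) ξ₀) :=
    h.analytic.sub (analyticOnNhd_const.mul (Complex.ofRealCLM.analyticOnNhd _))
  -- The dispersion identity is divided by the pairing of the trial function with `Ψ ξ`, which is
  -- continuous at `0` with value `1`.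
  obtain ⟨ν, hν, hfν, hν0⟩ := exists_sq_factor hr hfan
    ((h.continuousAt_innerL2 hρ c₀).add (((continuousAt_const.mul hofReal).mul
      continuousAt_const).mul (h.continuousAt_innerL2 hρ c₁)))
    ((h.continuousAt_innerL2 hρ c₂).add (hofReal.mul (h.continuousAt_innerL2 hρ c₃)))
    (by
      change innerL2 (Ψ 0) P.dφ₀ + _ = 1
      simp [hnorm]) hid
  have hl0 : lamc 0 = 0 := by simpa using hfν 0
  -- The gauge condition removes the `∂ₖφ` term of the residual; reality of the pairing makes the
  -- real part in the definition of `d` immaterial.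
  have hdν : ν 0 = -d := by
    have h1 : innerL2 (Ψ 0) (P.resid₀ a (dk φ P.k₀)) = P.k₀ ^ 2 * innerL2 (Ψ 0) (fun ζ =>
        toC (P.D *ᵥ deriv P.φ₀ ζ + (2 * P.k₀) • (P.D *ᵥ deriv (dk φ P.k₀) ζ))) := by
      have hψ' := (contDiff_infty_iff_deriv.1 hψ).2
      have c₄ : Continuous (fun ζ => toC (P.k₀ ^ 2 • (P.D *ᵥ deriv P.φ₀ ζ +
          (2 * P.k₀) • (P.D *ᵥ deriv (dk φ P.k₀) ζ)))) :=
        (contDiff_toC (((contDiff_mulVec P.D hH.contDiff_deriv).add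
          ((contDiff_mulVec P.D hψ').const_smul _)).const_smul _)).continuous
      unfold Data.resid₀
      rw [innerL2_add_right (h.continuous_Ψ hmem) c₄ (by fun_prop), innerL2_smul_right, hf.gauge,
        mul_zero, add_zero]
      simp only [toC_smul (P.k₀ ^ 2)]
      rw [innerL2_smul_right]
      push_cast
      rfl
    have h2 := h.star_innerL2 hl0 (fun ζ =>
      P.D *ᵥ deriv P.φ₀ ζ + (2 * P.k₀) • (P.D *ᵥ deriv (dk φ P.k₀) ζ))
    have h3 := Complex.conj_eq_iff_re.1 h2
    rw [hν0, hd, Data.coeffD]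
    push_cast
    rw [h3, ← h1]
    simp
  obtain ⟨θ, hθ, hre⟩ := h.exists_re_le hD2
  have hreν : ∀ ξ ∈ Ioo (-ξ₀) ξ₀, ξ ≠ 0 → (ν ξ).re ≤ -θ := fun ξ hξ h0 => by
    have h1 := hre ξ hξ
    have h2 : (lamc ξ).re = ξ ^ 2 * (ν ξ).re := by
      have h3 := congrArg Complex.re (hfν ξ)
      rw [← Complex.ofReal_pow, Complex.re_ofReal_mul] at h3
      rw [← h3]
      simp
    have h3 : 0 < ξ ^ 2 := by positivity
    nlinarith
  -- At `ξ = 0` the spectral bound is empty after division by `ξ²`; continuity of `ν` extends it and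
  -- yields `d ≥ θ`.
  have hre0 : (ν 0).re ≤ -θ := by
    have hc : ContinuousAt (fun ξ => (ν ξ).re) 0 :=
      Complex.continuous_re.continuousAt.comp (hν.continuousOn.continuousAt (isOpen_Ioo.mem_nhds hmem))
    refine le_of_tendsto (hc.tendsto.mono_left (nhdsWithin_le_nhds (s := {0}ᶜ))) ?_
    filter_upwards [eventually_nhdsWithin_of_eventually_nhds (isOpen_Ioo.mem_nhds hmem),
      self_mem_nhdsWithin] with ξ h1 h2 using hreν ξ h1 h2
  have hρ0 : ρ 0 ≠ 0 := by
    rw [hρ.eq_one 0 (by rw [abs_zero]; linarith)]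
    exact one_ne_zero
  refine ⟨?_, ?_⟩
  · rw [hdν] at hre0
    simp at hre0
    linarith
  · obtain ⟨N, ν', hν', he⟩ := exists_isDiffusive hr hθ hν (fun ξ hξ => by
      by_cases h0 : ξ = 0
      · rw [h0]; exact hre0
      · exact hreν ξ hξ h0) hρ.support hρ0
    refine ⟨θ, N, ν', hν', by rw [he 0 hρ0, hdν], fun ξ hξ => ?_⟩
    rw [disp, he ξ hξ, ← hfν ξ]
    ring

/-! ### The temporal cut-off -/

namespace IsTimeCutoff

variable {χ : ℝ → ℝ}

lemma iteratedDeriv_eq_zero (hχ : IsTimeCutoff χ) (j : ℕ) {t : ℝ} (ht : t < 1) :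
    iteratedDeriv j χ t = 0 := by
  have h : χ =ᶠ[nhds t] fun _ => 0 := by
    filter_upwards [Iio_mem_nhds ht] with s hs using hχ.eq_zero s (le_of_lt hs)
  rw [h.iteratedDeriv_eq j, iteratedDeriv_const]
  simp

lemma iteratedDeriv_succ_eq_zero (hχ : IsTimeCutoff χ) (j : ℕ) {t : ℝ} (ht : 2 < t) :
    iteratedDeriv (j + 1) χ t = 0 := by
  have h : χ =ᶠ[nhds t] fun _ => 1 := by
    filter_upwards [Ioi_mem_nhds ht] with s hs using hχ.eq_one s (le_of_lt hs)
  rw [h.iteratedDeriv_eq (j + 1), iteratedDeriv_const]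
  simp

/-- For `j ≥ 1` the derivative is supported in `[1,2]`, so any rate is available. The rate `j` is
what a Leibniz term loses when `j` of the factors `ξ²ν` are missing. -/
lemma exists_norm_iteratedDeriv_le (hχ : IsTimeCutoff χ) (j : ℕ) :
    ∃ C, 0 ≤ C ∧ ∀ t, 1 ≤ t → |iteratedDeriv j χ t| ≤ C * (1 + t) ^ (-(j : ℝ)) := by
  rcases j with _ | j
  · refine ⟨1, zero_le_one, fun t _ => ?_⟩
    simp [abs_le.2 ⟨by linarith [(hχ.mem t).1], (hχ.mem t).2⟩]
  · have hc : Continuous (iteratedDeriv (j + 1) χ) :=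
      hχ.smooth.continuous_iteratedDeriv _ (mod_cast le_top)
    obtain ⟨M, hM⟩ := (isCompact_Icc (a := (1 : ℝ)) (b := 2)).exists_bound_of_continuousOn
      hc.continuousOn
    have hM0 : 0 ≤ M := (norm_nonneg _).trans (hM 1 (by norm_num))
    -- On `[1,2]` one has `1 + t ≤ 3`.
    refine ⟨M * 3 ^ (j + 1), by positivity, fun t ht => ?_⟩
    rcases le_or_gt t 2 with h2 | h2
    · refine (hM t ⟨ht, h2⟩).trans ?_
      rw [Real.rpow_neg (by linarith), Real.rpow_natCast, ← div_eq_mul_inv, le_div_iff₀ (by positivity)]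
      gcongr
      linarith
    · rw [hχ.iteratedDeriv_succ_eq_zero j h2, abs_zero]
      positivity

end IsTimeCutoff

/-! ### Decay of the terms in the Leibniz formula -/

lemma inv_sqrt_pow_le {t : ℝ} (ht : 1 ≤ t) (p : ℕ) :
    (√t)⁻¹ ^ p ≤ √2 ^ p * (1 + t) ^ (-((p : ℝ) / 2)) := by
  have h1 : (√t)⁻¹ ≤ √2 * (1 + t) ^ (-(1 / 2) : ℝ) := by
    rw [Real.rpow_neg (by linarith), ← Real.sqrt_eq_rpow, ← div_eq_mul_inv,
      le_div_iff₀ (by positivity), inv_mul_le_iff₀ (by positivity), ← Real.sqrt_mul (by linarith)]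
    exact Real.sqrt_le_sqrt (by linarith)
  calc (√t)⁻¹ ^ p ≤ (√2 * (1 + t) ^ (-(1 / 2) : ℝ)) ^ p := by gcongr
    _ = √2 ^ p * (1 + t) ^ (-((p : ℝ) / 2)) := by
      rw [mul_pow, ← Real.rpow_natCast ((1 + t) ^ (-(1 / 2) : ℝ)), ← Real.rpow_mul (by linarith)]
      ring_nf

section Terms

variable {ι : Type*} [Fintype ι] {θ N R : ℝ} {ν : ℝ → ℂ} {b : ι → ℝ → ℝ → ℂ} {h : ι → ℝ → ℂ}

/-- The multiplier is `ξ ^ (2q + l)` times a smooth function, and `s = √t`. At least one power of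
`ξ` is needed to trade `v` for `v'`. -/
lemma IsDiffusive.exists_norm_sumOp_le (hν : IsDiffusive θ N ν) (hb : ∀ i, IsSymb R (b i))
    (hR : R ≤ 2 * Real.pi) (hh : ∀ i, IsL1per (h i)) {q l : ℕ} (hql : 1 ≤ 2 * q + l) :
    ∃ C, 0 ≤ C ∧ ∀ v : ℝ → ℝ, IsCub 1 v → ∀ t y, 1 ≤ t →
      ‖sumOp (disp ν) b (fun i x => h i x * v x)
          (fun ξ => disp ν ξ ^ q * (Complex.I * ξ) ^ l) t y‖
        ≤ C * (1 + t) ^ (-((2 * (q : ℝ) + l - 1) / 2)) * supNorm (deriv v) := by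
  have hb' : ∀ i, IsSymb R (fun ξ x => ν ξ ^ q * Complex.I ^ l * b i ξ x) := fun i =>
    (hb i).mul_left ((hν.smooth.pow q).mul contDiff_const)
  choose C hC0 hC using fun i => hν.exists_norm_oscOp_pow_le (hb' i) hR (hh i) hql
  refine ⟨(∑ i, C i) * √2 ^ (2 * q + l - 1),
    mul_nonneg (Finset.sum_nonneg fun i _ => hC0 i) (by positivity), fun v hv t y ht => ?_⟩
  have hs : 1 ≤ √t := Real.one_le_sqrt.2 ht
  have hsq : √t ^ 2 = t := Real.sq_sqrt (by linarith)
  have hexp : (((2 * q + l - 1 : ℕ) : ℝ)) = 2 * (q : ℝ) + l - 1 := by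
    rw [Nat.cast_sub hql]; push_cast; ring
  have hsn := hv.supNorm_nonneg
  have hdec := inv_sqrt_pow_le ht (2 * q + l - 1)
  rw [hexp] at hdec
  calc _ ≤ ∑ i, C i * (√t)⁻¹ ^ (2 * q + l - 1) * supNorm (deriv v) := by
        refine norm_sum_le_of_le _ fun i _ => ?_
        have := hC i v hv (√t) y hs
        rw [hsq] at this
        have hsymb : (fun ξ x => disp ν ξ ^ q * (Complex.I * ξ) ^ l * b i ξ x) =
            fun (ξ x : ℝ) => (ξ : ℂ) ^ (2 * q + l) * (ν ξ ^ q * Complex.I ^ l * b i ξ x) := by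
          funext ξ x
          rw [disp, mul_pow, mul_pow, ← pow_mul, pow_add]
          ring
        rwa [hsymb]
    _ = (∑ i, C i) * (√t)⁻¹ ^ (2 * q + l - 1) * supNorm (deriv v) := by
        rw [Finset.sum_mul, Finset.sum_mul]
    _ ≤ (∑ i, C i) * (√2 ^ (2 * q + l - 1) * (1 + t) ^ (-((2 * (q : ℝ) + l - 1) / 2)))
          * supNorm (deriv v) := by
        have := Finset.sum_nonneg fun i (_ : i ∈ Finset.univ) => hC0 i
        gcongr
    _ = _ := by ring

/-- The decay `(1 + t)^{-j}` of the cut-off derivative and that of the multiplier with `m - j`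
factors combine to a rate independent of `j`. For `t < 1` everything vanishes. -/
lemma IsDiffusive.exists_norm_leibniz_term_le (hν : IsDiffusive θ N ν)
    (hb : ∀ i, IsSymb R (b i)) (hR : R ≤ 2 * Real.pi) (hh : ∀ i, IsL1per (h i)) {χ : ℝ → ℝ}
    (hχ : IsTimeCutoff χ) {m l j : ℕ} (hj : j ≤ m) (hjl : 1 ≤ 2 * (m - j) + l) :
    ∃ C, 0 ≤ C ∧ ∀ v : ℝ → ℝ, IsCub 1 v → ∀ t y, 0 ≤ t →
      ‖(m.choose j : ℂ) * ((iteratedDeriv j χ t : ℝ) : ℂ) *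
          sumOp (disp ν) b (fun i x => h i x * v x)
            (fun ξ => disp ν ξ ^ (m - j) * (Complex.I * ξ) ^ l) t y‖
        ≤ C * (1 + t) ^ (-((2 * (m : ℝ) + l - 1) / 2)) * supNorm (deriv v) := by
  obtain ⟨A, hA0, hA⟩ := hχ.exists_norm_iteratedDeriv_le j
  obtain ⟨B, hB0, hB⟩ := hν.exists_norm_sumOp_le hb hR hh hjl
  refine ⟨m.choose j * A * B, by positivity, fun v hv t y ht0 => ?_⟩
  have hsn := hv.supNorm_nonneg
  rcases lt_or_ge t 1 with ht | ht
  · rw [hχ.iteratedDeriv_eq_zero j ht]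
    simp only [Complex.ofReal_zero, mul_zero, zero_mul, norm_zero]
    positivity
  · rw [norm_mul, norm_mul, Complex.norm_natCast, Complex.norm_real, Real.norm_eq_abs]
    have h1 := hA t ht
    have h2 := hB v hv t y ht
    calc _ ≤ (m.choose j : ℝ) * (A * (1 + t) ^ (-(j : ℝ))) *
          (B * (1 + t) ^ (-((2 * ((m - j : ℕ) : ℝ) + l - 1) / 2)) * supNorm (deriv v)) := by
          gcongr
      _ = m.choose j * A * B * ((1 + t) ^ (-(j : ℝ)) *
          (1 + t) ^ (-((2 * ((m - j : ℕ) : ℝ) + l - 1) / 2))) * supNorm (deriv v) := by ring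
      _ = _ := by
          rw [← Real.rpow_add (by linarith), Nat.cast_sub hj]
          ring_nf

lemma IsDiffusive.exists_norm_leibniz_sum_le (hν : IsDiffusive θ N ν)
    (hb : ∀ i, IsSymb R (b i)) (hR : R ≤ 2 * Real.pi) (hh : ∀ i, IsL1per (h i)) {χ : ℝ → ℝ}
    (hχ : IsTimeCutoff χ) {m l : ℕ} (s : Finset ℕ)
    (hs : ∀ j ∈ s, j ≤ m ∧ 1 ≤ 2 * (m - j) + l) :
    ∃ C, 0 ≤ C ∧ ∀ v : ℝ → ℝ, IsCub 1 v → ∀ t y, 0 ≤ t →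
      ‖∑ j ∈ s, (m.choose j : ℂ) * ((iteratedDeriv j χ t : ℝ) : ℂ) *
          sumOp (disp ν) b (fun i x => h i x * v x)
            (fun ξ => disp ν ξ ^ (m - j) * (Complex.I * ξ) ^ l) t y‖
        ≤ C * (1 + t) ^ (-((2 * (m : ℝ) + l - 1) / 2)) * supNorm (deriv v) := by
  choose! C hC0 hC using fun j hj =>
    hν.exists_norm_leibniz_term_le hb hR hh hχ (hs j hj).1 (hs j hj).2
  refine ⟨∑ j ∈ s, C j, Finset.sum_nonneg hC0, fun v hv t y ht => ?_⟩
  rw [Finset.sum_mul, Finset.sum_mul]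
  exact norm_sum_le_of_le _ fun j hj => hC j hj v hv t y ht

end Terms

/-! ### The principal part in the comoving frame -/

lemma IsL2per.isL1per {h : ℝ → Fin n → ℂ} (hh : IsL2per h) (i : Fin n) :
    IsL1per (fun x => ((2 * Real.pi : ℝ) : ℂ)⁻¹ * h x i) := by
  refine ⟨fun x => by simp [hh.1 x], ?_⟩
  have h1 : Integrable h cell := hh.2.integrable (by norm_num)
  exact (h1.eval i).const_mul _

section Principal

variable {P : Data n} {ξ₀ a θ N : ℝ} {lamc ν : ℝ → ℂ} {Φ Ψ : ℝ → ℝ → Fin n → ℂ} {ρ χ : ℝ → ℝ}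
  {h : ℝ → Fin n → ℂ} {v : ℝ → ℝ}

/-- The linear part `iaξ` of the dispersion relation is absorbed in the oscillating exponential as
the shift `ζ + a t`. Where `ρ` vanishes the dispersion relation plays no role. -/
lemma kernelGp_apply (hb : ∀ i, IsSymb ξ₀ (adjSymb ρ Ψ i)) (hν : IsDiffusive θ N ν)
    (hlam : ∀ ξ, ρ ξ ≠ 0 → lamc ξ = Complex.I * a * ξ + disp ν ξ) (ζ ζ' t : ℝ) (i : Fin n) :
    kernelGp ρ lamc Ψ ζ ζ' t i = ((2 * Real.pi : ℝ) : ℂ)⁻¹ *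
      osc (evo (disp ν) t (adjSymb ρ Ψ i)) (ζ + a * t - ζ') ζ' := by
  have hpt : ∀ i (ξ : ℝ), (((ρ ξ : ℂ) * Complex.exp (Complex.I * ξ * (ζ - ζ')) *
      Complex.exp (lamc ξ * t)) • star (Ψ ξ ζ')) i = evo (disp ν) t (adjSymb ρ Ψ i) ξ ζ' *
        Complex.exp (Complex.I * ξ * ((ζ + a * t - ζ' : ℝ) : ℂ)) := by
    intro i ξ
    by_cases h0 : ρ ξ = 0
    · simp [evo, adjSymb, h0]
    · simp only [Pi.smul_apply, Pi.star_apply, smul_eq_mul, evo, adjSymb]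
      have : Complex.exp (Complex.I * ξ * (ζ - ζ')) * Complex.exp (lamc ξ * t) =
          Complex.exp (disp ν ξ * t) *
            Complex.exp (Complex.I * ξ * ((ζ + a * t - ζ' : ℝ) : ℂ)) := by
        rw [← Complex.exp_add, ← Complex.exp_add, hlam ξ h0]
        congr 1
        push_cast
        ring
      rw [mul_assoc (ρ ξ : ℂ), this]
      ring
  rw [kernelGp, Pi.smul_apply, smul_eq_mul, eval_integral]
  · simp only [hpt, osc]
  · intro i
    simp only [hpt]
    exact ((hb i).evo hν.smooth_disp t).integrable_integrand _ _

lemma kernelGp_dotProduct (hb : ∀ i, IsSymb ξ₀ (adjSymb ρ Ψ i)) (hν : IsDiffusive θ N ν)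
    (hlam : ∀ ξ, ρ ξ ≠ 0 → lamc ξ = Complex.I * a * ξ + disp ν ξ) (ζ ζ' t : ℝ) :
    kernelGp ρ lamc Ψ ζ ζ' t ⬝ᵥ modulate h v ζ' =
      ∑ i, osc (evo (disp ν) t (adjSymb ρ Ψ i)) (ζ + a * t - ζ') ζ' *
        (((2 * Real.pi : ℝ) : ℂ)⁻¹ * h ζ' i * v ζ') := by
  refine Finset.sum_congr rfl fun i _ => ?_
  rw [kernelGp_apply hb hν hlam, modulate, Pi.smul_apply, smul_eq_mul]
  ring

lemma lorentzIntegrable_modulate (hh : IsL2per h) (hv : IsCub 1 v) (i : Fin n) :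
    LorentzIntegrable (fun x => ((2 * Real.pi : ℝ) : ℂ)⁻¹ * h x i * v x) := by
  obtain ⟨M, hM⟩ := hv.exists_bound
  exact (hh.isL1per i).lorentzIntegrable_mul hv.continuous_ofReal hM

lemma integrable_kernelGp (hb : ∀ i, IsSymb ξ₀ (adjSymb ρ Ψ i)) (hν : IsDiffusive θ N ν)
    (hlam : ∀ ξ, ρ ξ ≠ 0 → lamc ξ = Complex.I * a * ξ + disp ν ξ) (hh : IsL2per h)
    (hv : IsCub 1 v) (ζ t : ℝ) :
    Integrable (fun ζ' => kernelGp ρ lamc Ψ ζ ζ' t ⬝ᵥ modulate h v ζ') := by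
  simp only [kernelGp_dotProduct hb hν hlam]
  exact integrable_finsetSum _ fun i _ => (hb i).integrable_osc_evo hν.smooth_disp
    (lorentzIntegrable_modulate hh hv i) (t, ζ + a * t)

lemma Sp_modulate (hb : ∀ i, IsSymb ξ₀ (adjSymb ρ Ψ i)) (hν : IsDiffusive θ N ν)
    (hlam : ∀ ξ, ρ ξ ≠ 0 → lamc ξ = Complex.I * a * ξ + disp ν ξ) (hh : IsL2per h)
    (hv : IsCub 1 v) :
    Sp ρ χ lamc Ψ (modulate h v) = fun t ζ => (χ t : ℂ) * sumOp (disp ν) (adjSymb ρ Ψ)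
      (fun i x => ((2 * Real.pi : ℝ) : ℂ)⁻¹ * h x i * v x) (fun _ => 1) t (ζ + a * t) := by
  funext t ζ
  simp only [Sp, kernelGp_dotProduct hb hν hlam, sumOp, oscOp, one_mul]
  rw [integral_finsetSum _ fun i _ => (hb i).integrable_osc_evo hν.smooth_disp
    (lorentzIntegrable_modulate hh hv i) (t, ζ + a * t)]

lemma contDiff_Sp (hb : ∀ i, IsSymb ξ₀ (adjSymb ρ Ψ i)) (hν : IsDiffusive θ N ν)
    (hlam : ∀ ξ, ρ ξ ≠ 0 → lamc ξ = Complex.I * a * ξ + disp ν ξ) (hχ : IsTimeCutoff χ)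
    (hh : IsL2per h) (hv : IsCub 1 v) :
    ContDiff ℝ ∞ (fun p : ℝ × ℝ => Sp ρ χ lamc Ψ (modulate h v) p.1 p.2) := by
  rw [Sp_modulate hb hν hlam hh hv]
  refine (Complex.ofRealCLM.contDiff.comp (hχ.smooth.comp contDiff_fst)).mul ?_
  exact (contDiff_sumOp hb hν.smooth_disp (lorentzIntegrable_modulate hh hv)
    (B := fun _ => 1) contDiff_const).comp
    (contDiff_fst.prodMk (contDiff_snd.add (contDiff_const.mul contDiff_fst)))

lemma exists_norm_iterate_dtr_dζ_Sp_le (hb : ∀ i, IsSymb ξ₀ (adjSymb ρ Ψ i))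
    (hR : ξ₀ ≤ 2 * Real.pi) (hν : IsDiffusive θ N ν)
    (hlam : ∀ ξ, ρ ξ ≠ 0 → lamc ξ = Complex.I * a * ξ + disp ν ξ) (hχ : IsTimeCutoff χ)
    (hh : IsL2per h) {l : ℕ} (hl : 1 ≤ l) (m : ℕ) :
    ∃ C : ℝ, 0 < C ∧ ∀ v : ℝ → ℝ, IsCub 1 v → ∀ t ζ : ℝ, 0 ≤ t →
      ‖(dtr a)^[m] (dζ^[l] (Sp ρ χ lamc Ψ (modulate h v))) t ζ‖
        ≤ C * (1 + t) ^ (-((2 * (m : ℝ) + l - 1) / 2)) * supNorm (deriv v) := by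
  obtain ⟨C, hC0, hC⟩ := hν.exists_norm_leibniz_sum_le hb hR (fun i => hh.isL1per i) hχ
    (m := m) (l := l) (Finset.range (m + 1))
    fun j hj => ⟨by simpa [Nat.lt_succ_iff] using hj, by omega⟩
  refine ⟨C + 1, by positivity, fun v hv t ζ ht => ?_⟩
  have hsn := hv.supNorm_nonneg
  rw [Sp_modulate hb hν hlam hh hv, iterate_dtr_dζ_sumOp hb hν.smooth_disp
    (lorentzIntegrable_modulate hh hv) hχ.smooth]
  refine (hC v hv t _ ht).trans ?_
  gcongr
  linarith

end Principal

/-! ### Comparison with the convective heat semigroup -/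

section Comparison

variable {P : Data n} {ξ₀ a d θ N : ℝ} {lamc ν : ℝ → ℂ} {Φ Ψ : ℝ → ℝ → Fin n → ℂ} {ρ χ : ℝ → ℝ}

lemma Data.contDiff_dφ₀ (hH : P.H1) : ContDiff ℝ ∞ P.dφ₀ := contDiff_toC hH.contDiff_deriv

lemma Data.periodic_dφ₀ (hH : P.H1) : Function.Periodic P.dφ₀ 1 := fun x => by
  rw [Data.dφ₀, Data.dφ₀, periodic_deriv hH.waveTrain.periodic x]

lemma Data.isL2per_dφ₀ (hH : P.H1) : IsL2per P.dφ₀ :=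
  .of_continuous (Data.contDiff_dφ₀ hH).continuous (Data.periodic_dφ₀ hH)

/-- As `φ₀'` is smooth and periodic, it can be moved into the symbol, which leaves `v` alone as the
argument. The mean of the new symbol at `ξ = 0` is `⟨Ψ₀, φ₀'⟩ = 1`. -/
lemma Data.IsCriticalCurve.exists_norm_sumOp_sub_convHeat_le
    (hc : P.IsCriticalCurve ξ₀ lamc Φ Ψ) (hH : P.H1) (hρ : IsFreqCutoff ξ₀ ρ)
    (hν : IsDiffusive θ N ν) (hd : 0 < d) (hν0 : ν 0 = -d) :
    ∃ C, 0 ≤ C ∧ ∀ v : ℝ → ℝ, IsCub 1 v → ∀ t ζ, 1 ≤ t →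
      ‖sumOp (disp ν) (adjSymb ρ Ψ) (fun i x => ((2 * Real.pi : ℝ) : ℂ)⁻¹ * P.dφ₀ x i * v x)
          (fun _ => 1) t (ζ + a * t) - (convHeat d a t v ζ : ℂ)‖ ≤ C * supNorm (deriv v) := by
  have hpi := Real.pi_pos
  have hpiC : ((2 * Real.pi : ℝ) : ℂ) ≠ 0 := by exact_mod_cast (by positivity)
  have hρ0 : ρ 0 = 1 := hρ.eq_one 0 (by simpa using hc.ξ₀_mem.1)
  have hb := hc.isSymb hρ
  have hdφ := Data.contDiff_dφ₀ hH
  have hs : IsSymb ξ₀ (fun ξ x => ∑ i, adjSymb ρ Ψ i ξ x * P.dφ₀ x i) :=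
    IsSymb.sum _ fun i _ => (hb i).mul_right ((contDiff_apply ℝ ℂ i).comp hdφ)
      fun x => by rw [Data.periodic_dφ₀ hH x]
  have hmean : ∫ x in Ioc (0 : ℝ) 1, ∑ i, adjSymb ρ Ψ i 0 x * P.dφ₀ x i = 1 := by
    have := hc.Ψ_normalized 0 hc.zero_mem
    rw [hc.Φ_zero] at this
    rw [← this]
    simp [adjSymb, hρ0, innerL2, dotProduct]
  obtain ⟨C, hC0, hC⟩ := hν.exists_norm_oscOp_mean_one_sub_heat_le hd hν0
    (ρ := fun ξ => (ρ ξ : ℂ)) (Complex.ofRealCLM.contDiff.comp hρ.smooth)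
    (by linarith [hc.ξ₀_mem.2])
    (fun ξ hξ => by simp [cutoff_eq_zero hρ.support hξ]) (by simp [hρ0]) hs hmean
  refine ⟨(2 * Real.pi)⁻¹ * C, by positivity, fun v hv t ζ ht => ?_⟩
  have hsq : √t ^ 2 = t := Real.sq_sqrt (by linarith)
  have h1 := hC v hv (√t) (ζ + a * t) (Real.one_le_sqrt.2 ht)
  rw [hsq] at h1
  have hheat : convHeat d a t v ζ = heat d t v (ζ + a * t) := by
    rw [convHeat, if_neg (by linarith), heat]
  have hop : sumOp (disp ν) (adjSymb ρ Ψ)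
      (fun i x => ((2 * Real.pi : ℝ) : ℂ)⁻¹ * P.dφ₀ x i * v x) (fun _ => 1) t (ζ + a * t) =
      ((2 * Real.pi : ℝ) : ℂ)⁻¹ * oscOp (disp ν) (fun ξ x => ∑ i, adjSymb ρ Ψ i ξ x * P.dφ₀ x i)
        (fun x => (v x : ℂ)) t (ζ + a * t) := by
    simp only [sumOp, oscOp, one_mul]
    rw [← integral_finsetSum _ fun i _ => (hb i).integrable_osc_evo hν.smooth_disp
      (lorentzIntegrable_modulate (Data.isL2per_dφ₀ hH) hv i) (t, ζ + a * t),
      ← integral_const_mul]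
    congr 1
    funext x
    have : osc (evo (disp ν) t fun ξ x => ∑ i, adjSymb ρ Ψ i ξ x * P.dφ₀ x i)
        (ζ + a * t - x) x = ∑ i, osc (evo (disp ν) t (adjSymb ρ Ψ i)) (ζ + a * t - x) x *
          P.dφ₀ x i := by
      simp only [osc, ← integral_mul_const]
      rw [← integral_finsetSum _ fun i _ =>
        (((hb i).evo hν.smooth_disp t).integrable_integrand _ _).mul_const _]
      congr 1
      funext ξ
      simp only [evo, Finset.mul_sum, Finset.sum_mul]
      exact Finset.sum_congr rfl fun i _ => by ring
    rw [this, Finset.sum_mul, Finset.mul_sum]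
    exact Finset.sum_congr rfl fun i _ => by ring
  rw [hop, hheat, show (heat d t v (ζ + a * t) : ℂ) = ((2 * Real.pi : ℝ) : ℂ)⁻¹ *
    ((2 * Real.pi * heat d t v (ζ + a * t) : ℝ) : ℂ) by
      rw [Complex.ofReal_mul (2 * Real.pi), inv_mul_cancel_left₀ hpiC], ← mul_sub, norm_mul,
    norm_inv, Complex.norm_real, Real.norm_of_nonneg (by positivity), mul_assoc _ C]
  gcongr

/-- Leibniz terms with `j < m` keep at least two powers of `ξ` and are bounded by the kernel
estimate; only `j = m` needs the heat semigroup. -/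
lemma Data.IsCriticalCurve.exists_norm_iterate_dtr_Sp_sub_le
    (hc : P.IsCriticalCurve ξ₀ lamc Φ Ψ) (hH : P.H1) (hρ : IsFreqCutoff ξ₀ ρ)
    (hν : IsDiffusive θ N ν) (hd : 0 < d) (hν0 : ν 0 = -d)
    (hlam : ∀ ξ, ρ ξ ≠ 0 → lamc ξ = Complex.I * a * ξ + disp ν ξ) (hχ : IsTimeCutoff χ) (m : ℕ) :
    ∃ C : ℝ, 0 < C ∧ ∀ v : ℝ → ℝ, IsCub 1 v → ∀ t ζ : ℝ, 0 ≤ t →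
      ‖(dtr a)^[m] (Sp ρ χ lamc Ψ (modulate P.dφ₀ v)) t ζ
          - ((iteratedDeriv m χ t * convHeat d a t v ζ : ℝ) : ℂ)‖ ≤ C * supNorm (deriv v) := by
  have hb := hc.isSymb hρ
  have hL2 := Data.isL2per_dφ₀ hH
  have hR : ξ₀ ≤ 2 * Real.pi := by linarith [hc.ξ₀_mem.2, Real.pi_pos]
  obtain ⟨C, hC0, hC⟩ := hν.exists_norm_leibniz_sum_le hb hR (fun i => hL2.isL1per i) hχ
    (m := m) (l := 0) (Finset.range m)
    fun j hj => ⟨(Finset.mem_range.1 hj).le, by have := Finset.mem_range.1 hj; omega⟩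
  obtain ⟨A, hA0, hA⟩ := hχ.exists_norm_iteratedDeriv_le m
  obtain ⟨B, hB0, hB⟩ := hc.exists_norm_sumOp_sub_convHeat_le (a := a) hH hρ hν hd hν0
  refine ⟨C + A * B + 1, by positivity, fun v hv t ζ ht => ?_⟩
  have hsn := hv.supNorm_nonneg
  have hleib := iterate_dtr_dζ_sumOp hb hν.smooth_disp (lorentzIntegrable_modulate hL2 hv)
    hχ.smooth 0 m a t ζ
  rw [Function.iterate_zero, id_eq, Finset.sum_range_succ] at hleib
  rw [Sp_modulate hb hν hlam hL2 hv, hleib, add_sub_assoc,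
    Complex.ofReal_mul (iteratedDeriv m χ t)]
  refine (norm_add_le _ _).trans ?_
  have hfirst : ‖∑ j ∈ Finset.range m, (m.choose j : ℂ) * ((iteratedDeriv j χ t : ℝ) : ℂ) *
      sumOp (disp ν) (adjSymb ρ Ψ) (fun i x => ((2 * Real.pi : ℝ) : ℂ)⁻¹ * P.dφ₀ x i * v x)
        (fun ξ => disp ν ξ ^ (m - j) * (Complex.I * ξ) ^ 0) t (ζ + a * t)‖
        ≤ C * supNorm (deriv v) := by
    -- For `m = 0` the sum is empty, while the general rate would be the growing factor `(1 +
    -- t)^{1/2}`; for `m ≥ 1` the exponent is negative.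
    rcases m with _ | m
    · simpa using mul_nonneg hC0 hsn
    · refine (hC v hv t _ ht).trans ?_
      gcongr
      refine mul_le_of_le_one_right hC0 (Real.rpow_le_one_of_one_le_of_nonpos (by linarith) ?_)
      push_cast
      linarith [m.cast_nonneg (α := ℝ)]
  have hlast : ‖((iteratedDeriv m χ t : ℝ) : ℂ) *
      (sumOp (disp ν) (adjSymb ρ Ψ) (fun i x => ((2 * Real.pi : ℝ) : ℂ)⁻¹ * P.dφ₀ x i * v x)
        (fun _ => 1) t (ζ + a * t) - (convHeat d a t v ζ : ℂ))‖ ≤ A * B * supNorm (deriv v) := by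
    rw [norm_mul, Complex.norm_real, Real.norm_eq_abs]
    rcases lt_or_ge t 1 with ht1 | ht1
    · rw [hχ.iteratedDeriv_eq_zero m ht1, abs_zero, zero_mul]
      positivity
    · have h1 : |iteratedDeriv m χ t| ≤ A := (hA t ht1).trans
        (mul_le_of_le_one_right hA0
          (Real.rpow_le_one_of_one_le_of_nonpos (by linarith) (by simp)))
      rw [mul_assoc]
      exact mul_le_mul h1 (hB v hv t ζ ht1) (norm_nonneg _) hA0
  simp only [Nat.choose_self, Nat.cast_one, one_mul, Nat.sub_self, pow_zero, ← mul_sub]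
    at hfirst ⊢
  refine (add_le_add hfirst hlast).trans ?_
  rw [← add_mul]
  exact mul_le_mul_of_nonneg_right (by linarith) hsn

end Comparison

end WaveTrain

end

/-! ### The proposition -/

theorem proposition4p4 {n : ℕ} (P : WaveTrain.Data n)
    (hH1 : P.H1) (hD1 : P.D1) (hD2 : P.D2) (hD3 : P.D3)
    (ξ₀ : ℝ) (lamc : ℝ → ℂ) (Φ Ψ : ℝ → ℝ → Fin n → ℂ)
    (hcurve : P.IsCriticalCurve ξ₀ lamc Φ Ψ)
    (r₀ : ℝ) (φ : ℝ → ℝ → Fin n → ℝ) (om : ℝ → ℝ)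
    (hfamily : P.IsFamily (Ψ 0) r₀ φ om)
    (ρ χ : ℝ → ℝ) (hρ : WaveTrain.IsFreqCutoff ξ₀ ρ) (hχ : WaveTrain.IsTimeCutoff χ)
    (a d : ℝ) (ha : a = P.coeffA om) (hd : d = P.coeffD (Ψ 0) φ)
    (g : ℝ → Fin n → ℂ) (hg : WaveTrain.IsL2per g) (l m : ℕ) (hl : 1 ≤ l) :
    -- the objects in the estimates are well defined
    0 < d ∧ WaveTrain.IsL2per P.dφ₀ ∧
    (∀ h : ℝ → Fin n → ℂ, WaveTrain.IsL2per h → ∀ v : ℝ → ℝ, WaveTrain.IsCub 1 v →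
      (∀ t ζ : ℝ, 0 ≤ t → MeasureTheory.Integrable (fun ζ' =>
        WaveTrain.kernelGp ρ lamc Ψ ζ ζ' t ⬝ᵥ WaveTrain.modulate h v ζ')) ∧
      ContDiff ℝ ∞ (fun p : ℝ × ℝ =>
        WaveTrain.Sp ρ χ lamc Ψ (WaveTrain.modulate h v) p.1 p.2)) ∧
    -- the first estimate
    (∃ C : ℝ, 0 < C ∧ ∀ v : ℝ → ℝ, WaveTrain.IsCub 1 v → ∀ t ζ : ℝ, 0 ≤ t →
      ‖(WaveTrain.dtr a)^[m] (WaveTrain.dζ^[l]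
          (WaveTrain.Sp ρ χ lamc Ψ (WaveTrain.modulate g v))) t ζ‖
        ≤ C * (1 + t) ^ (-((2 * (m : ℝ) + l - 1) / 2)) * WaveTrain.supNorm (deriv v)) ∧
    -- the second estimate
    (∃ C : ℝ, 0 < C ∧ ∀ v : ℝ → ℝ, WaveTrain.IsCub 1 v → ∀ t ζ : ℝ, 0 ≤ t →
      ‖(WaveTrain.dtr a)^[m] (WaveTrain.Sp ρ χ lamc Ψ (WaveTrain.modulate P.dφ₀ v)) t ζ
          - ((iteratedDeriv m χ t * WaveTrain.convHeat d a t v ζ : ℝ) : ℂ)‖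
        ≤ C * WaveTrain.supNorm (deriv v)) := by
  obtain ⟨hd0, θ, N, ν, hν, hν0, hlam⟩ := hcurve.exists_dispersion hH1 hD2 hfamily hρ ha hd
  have hb := hcurve.isSymb hρ
  have hR : ξ₀ ≤ 2 * Real.pi := by linarith [hcurve.ξ₀_mem.2, Real.pi_pos]
  exact ⟨hd0, WaveTrain.Data.isL2per_dφ₀ hH1,
    fun h hh v hv => ⟨fun t ζ _ => WaveTrain.integrable_kernelGp hb hν hlam hh hv ζ t,
      WaveTrain.contDiff_Sp hb hν hlam hχ hh hv⟩,
    WaveTrain.exists_norm_iterate_dtr_dζ_Sp_le hb hR hν hlam hχ hg hl m,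
    hcurve.exists_norm_iterate_dtr_Sp_sub_le hH1 hρ hν hd0 hν0 hlam hχ m⟩
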